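/- **Setting.** Consider a finite-horizon contextual MDP with state space $\mathcal S$, finite action set $\mathcal A$, context space $\mathcal W$, horizon $H$, transition kernels $\mathbb P_h(\cdot\mid s,a)$ that do not depend on the context, and known rewards $r_h(s,a,w)\in[0,1]$, $h\in[H]$. In episode $k=1,\dots,K$ a context $w^k$ and an initial state $s_1^k$ are chosen adversarially (possibly depending on the past); the learner follows a policy $\pi^k$, playing $a_h^k=\pi_h^k(s_h^k,w^k)$, and $s_{h+1}^k\sim\mathbb P_h(\cdot\mid s_h^k,a_h^k)$. The regret is $R_K=\sum_{k=1}^K\big(V_1^*(s_1^k,w^k)-V_1^{\pi^k}(s_1^k,w^k)\big)$, where $V^\pi_h(s,w)$ is the expected sum of the rewards of steps $h,\dots,H$ under $\pi$ and $V_h^*=\sup_\pi V_h^\pi$. Put $T=KH$. For a positive semidefinite matrix $B$ put $\|x\|_B=\sqrt{x^\top Bx}$. **Assumptions.** There are known measurable feature maps $\phi:\mathcal S\times\mathcal A\to\mathbb R^d$ and $\psi:\mathcal S\times\mathcal A\times\mathcal W\to\mathbb R^{d'}$ such that: 1. (Linear MDP, boundedness) $\|\phi(s,a)\|_2\le1$,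 $\|\psi(s,a,w)\|_2\le1$, and for each $h\in[H]$ there are $\eta_h\in\mathbb R^{d'}$ with $\|\eta_h\|_2\le\sqrt{d'}$ and (possibly signed) finite measures $\mu_h^{(1)},\dots,\mu_h^{(d)}$ on $\mathcal S$ with $\big\|\big(|\mu_h^{(i)}|(\mathcal S)\big)_{i\le d}\big\|_2\le\sqrt d$, such that $\mathbb P_h(\cdot\mid s,a)=\langle\mu_h(\cdot),\phi(s,a)\rangle$ and $r_h(s,a,w)=\langle\eta_h,\psi(s,a,w)\rangle$. (Here $|\mu|$ is the total variation measure, so $|\mu|(\mathcal S)=\mu(\mathcal S)$ if $\mu\ge0$.) 2. (Completeness) For every $\nu\in\mathbb R^{d'}$, positive definite $\Lambda\in\mathbb R^{d\times d}$ and $b\in\mathbb R$, the function $f(s,w)=\min\{\max_{a}\{\langle\nu,\psi(s,a,w)\rangle+b\|\phi(s,a)\|_{\Lambda^{-1}}\}^+,H\}$ satisfies: for each $h\in[H]$ there is $\xi_h^f\in\mathbb R^{d'}$ with $\|\xi_h^f\|_2\le H\sqrt{d'}$ and $\int f(s',w)\,\mathbb P_h(ds'\mid s,a)=\langle\xi_h^f,\psi(s,a,w)\rangle$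 for all $(s,a,w)$. 3. (Span condition) There are known contexts $w^{(1)},\dots,w^{(n)}$, $n\le d'$, and a known number $L$ such that for all $(s,a,w)$ one has $\psi(s,a,w)=\sum_{j}c_j\,\psi(s,a,w^{(j)})$ for some $c_j=c_j(s,a,w)$ with $\sum_j|c_j|\le L$. For each $j\in[n]$ let $\mathcal D(w^{(j)})\subset\mathcal S\times\mathcal A$ be a finite set of pairs at which the vectors $\tilde\psi(s,a,w^{(j)})=[\phi(s,a)^\top,\psi(s,a,w^{(j)})^\top]^\top$ form a maximal linearly independent family among all vectors $\tilde\psi(s,a,w^{(j)})$, $(s,a)\in\mathcal S\times\mathcal A$. **Modified UCBlvd** (inputs $\lambda>0$, $\beta$). With $\phi_h^\tau=\phi(s_h^\tau,a_h^\tau)$ let $$\Lambda_h^k=\lambda I_d+\sum_{\tau<k}\phi_h^\tau{\phi_h^\tau}^\top,\quad Q_h^k(s,a,w)=\big\{r_h(s,a,w)+\langle\hat\xi_h^k,\psi(s,a,w)\rangle+2L\beta\|\phi(s,a)\|_{(\Lambda_h^k)^{-1}}\big\}^+,$$ $$Q_{H+1}^k=0,\quad V_h^k(s,w)=\min\{\max_aQ_h^k(s,a,w),H\},\quad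 \tilde\theta_h^k(w)=(\Lambda_h^k)^{-1}\sum_{\tau<k}\phi_h^\tau\,V_{h+1}^k(s_{h+1}^\tau,w),$$ where, for $h=H,\dots,1$, $\hat\xi_h^k$ is the $\xi$-component of a minimiser $(\xi,\theta^{(1)},\dots,\theta^{(n)})$ of $$\sum_{j\in[n]}\ \sum_{(s,a)\in\mathcal D(w^{(j)})}\big(\langle\theta^{(j)},\phi(s,a)\rangle-\langle\xi,\psi(s,a,w^{(j)})\rangle\big)^2$$ subject to $\|\theta^{(j)}-\tilde\theta_h^k(w^{(j)})\|_{\Lambda_h^k}\le\beta$ for all $j\in[n]$ and $\|\xi\|_2\le H\sqrt{d'}$. Start with $\tilde k=1$. In episode $k$, if $\det\Lambda_h^k/\det\Lambda_h^{\tilde k}>e$ for some $h\in[H]$, set $\tilde k=k$ and replan, i.e. compute $(\hat\xi_h^{k})_{h\in[H]}$; this is one planning call. (The initial parameters $\hat\xi^1_h$, computed from no data, are not counted as a call.) Then play $\pi_h^k(s,w)\in\arg\max_aQ_h^{\tilde k}(s,a,w)$. Ties, and non-unique minimisers, are resolved arbitrarily but measurably and without using the future. **Theorem.** Under these assumptions: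 (i) for every $\lambda>0$ and $\beta$, on every sample path, the number of planning calls in the $K$ episodes is at most $dH\log\!\big(1+\tfrac{K}{d\lambda}\big)$; (ii) there are absolute constants $c>0$ and $C>0$ such that for every $\delta\in(0,\tfrac12)$, if $\lambda=1$ and $\beta=cH(d+\sqrt{d'})\sqrt{\log(dd'T/\delta)}$, then with probability at least $1-2\delta$ $$R_K\le 2H\sqrt{T\log(dT/\delta)}+8HL\beta\sqrt{2dK\log K},$$ and the right-hand side is at most $C\,L\sqrt{(d^3+dd')H^3T}\;\log(dd'T/\delta)$, i.e. $\tilde{\mathcal O}\big(L\sqrt{(d^3+dd')H^3T}\big)$. -/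

import Mathlib

open MeasureTheory ProbabilityTheory

universe u₁ u₂ u₃ u₄

noncomputable section

namespace UCBlvd

/-- Euclidean space `ℝ^d` with its 2-norm. -/
abbrev Vec (d : ℕ) : Type := EuclideanSpace ℝ (Fin d)

/-- The weighted norm `‖x‖_B = √(xᵀ B x)`. -/
def wnorm {d : ℕ} (B : Matrix (Fin d) (Fin d) ℝ) (x : Vec d) : ℝ :=
  Real.sqrt (inner ℝ x (Matrix.toEuclideanLin B x))

/-! ### Finite-horizon contextual MDPs -/

/-- A finite-horizon contextual MDP. Time steps are `h = 1, …, H`; the context determines the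
reward, with values in `[0,1]`, and does not affect the dynamics. -/
structure ContextualMDP (S A W : Type*) [MeasurableSpace S] [MeasurableSpace A] where
  H : ℕ
  P : ℕ → Kernel (S × A) S
  r : ℕ → S → A → W → ℝ
  isMarkov : ∀ h, IsMarkovKernel (P h)
  r_mem : ∀ h ∈ Finset.Icc 1 H, ∀ s a w, r h s a w ∈ Set.Icc (0 : ℝ) 1

section MDP

variable {S A W : Type*} [MeasurableSpace S] [MeasurableSpace A]

/-- Expected sum of the rewards of the `j` steps `h, …, h + j - 1`, started from state `s` at
time `h` in context `w`, when `π` is followed (an iterated integral along the Markov chain). -/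
def ContextualMDP.valueAux (M : ContextualMDP S A W) (π : ℕ → S → W → A) :
    ℕ → ℕ → S → W → ℝ
  | 0, _, _, _ => 0
  | j + 1, h, s, w =>
      M.r h s (π h s w) w + ∫ s', M.valueAux π j (h + 1) s' w ∂(M.P h (s, π h s w))

/-- `V_h^π(s,w)`, the expected sum of the rewards of the steps `h, …, H`. -/
def ContextualMDP.value (M : ContextualMDP S A W) (π : ℕ → S → W → A)
    (h : ℕ) (s : S) (w : W) : ℝ :=
  M.valueAux π (M.H + 1 - h) h s w

/-- The policies: each `π_h(·,w)` is a measurable map from states to actions. -/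
def IsPolicy (π : ℕ → S → W → A) : Prop :=
  ∀ h w, Measurable fun s => π h s w

/-- `V_h^*(s,w) = sup_π V_h^π(s,w)`. -/
def ContextualMDP.optValue (M : ContextualMDP S A W) (h : ℕ) (s : S) (w : W) : ℝ :=
  ⨆ π : {π : ℕ → S → W → A // IsPolicy π}, M.value π.1 h s w

end MDP

/-! ### The problem data and the assumptions -/

/-- A contextual MDP together with what the learner is given besides the rewards: the feature maps
`φ` and `ψ`, the representative contexts `w⁽¹⁾, …, w⁽ⁿ⁾`, the number `L`, and, for each
representative context, the finite set of state-action pairs that is used in planning. -/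
structure Problem (S A W : Type*) [MeasurableSpace S] [MeasurableSpace A] (d d' n : ℕ) extends
    ContextualMDP S A W where
  φ : S → A → Vec d
  ψ : S → A → W → Vec d'
  wRep : Fin n → W
  L : ℝ
  D : Fin n → Finset (S × A)

section Assumptions

variable {S A W : Type*} [MeasurableSpace S] [MeasurableSpace A] [MeasurableSpace W]
  {d d' n : ℕ}

/-- Linear MDP, with the normalisation of features and parameters. The `μ i` may be signed
measures; `|μ i|` is the total variation, so `|μ i|(S) = μ i S` when `μ i` is nonnegative. -/
structure Problem.IsLinear (X : Problem S A W d d' n) : Prop where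
  φ_meas : ∀ a, Measurable fun s => X.φ s a
  ψ_meas : ∀ a, Measurable fun p : S × W => X.ψ p.1 a p.2
  φ_norm : ∀ s a, ‖X.φ s a‖ ≤ 1
  ψ_norm : ∀ s a w, ‖X.ψ s a w‖ ≤ 1
  linear : ∀ h ∈ Finset.Icc 1 X.H, ∃ (η : Vec d') (μ : Fin d → SignedMeasure S),
    ‖η‖ ≤ Real.sqrt d' ∧
    ‖(WithLp.toLp 2 fun i => (μ i).totalVariation.real Set.univ : Vec d)‖ ≤ Real.sqrt d ∧
    (∀ s a, ∀ B : Set S, MeasurableSet B →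
      (X.P h (s, a)).real B = ∑ i, μ i B * X.φ s a i) ∧
    ∀ s a w, X.r h s a w = inner ℝ η (X.ψ s a w)

/-- The function class `𝓕` of the completeness assumption. -/
def Problem.functionClass (X : Problem S A W d d' n) : Set (S → W → ℝ) :=
  {f | ∃ (ν : Vec d') (Λ : Matrix (Fin d) (Fin d) ℝ) (b : ℝ), Λ.PosDef ∧
    ∀ s w, f s w =
      min (⨆ a : A, max (inner ℝ ν (X.ψ s a w) + b * wnorm Λ⁻¹ (X.φ s a)) 0) (X.H : ℝ)}

/-- Completeness. -/
def Problem.IsComplete (X : Problem S A W d d' n) : Prop :=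
  ∀ f ∈ X.functionClass, ∀ h ∈ Finset.Icc 1 X.H, ∃ ξ : Vec d',
    ‖ξ‖ ≤ X.H * Real.sqrt d' ∧
    ∀ s a w, ∫ s', f s' w ∂(X.P h (s, a)) = inner ℝ ξ (X.ψ s a w)

/-- The span condition with `ℓ¹`-bounded coefficients. -/
def Problem.SpanCondition (X : Problem S A W d d' n) : Prop :=
  n ≤ d' ∧ ∀ s a w, ∃ c : Fin n → ℝ,
    X.ψ s a w = ∑ j, c j • X.ψ s a (X.wRep j) ∧ ∑ j, |c j| ≤ X.L

/-- `D j` consists of finitely many state-action pairs at which the concatenated features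
`(φ(s,a), ψ(s,a,w⁽ʲ⁾))` are linearly independent and span all such features, that is, form a
maximal linearly independent family. -/
def Problem.PlanningSets (X : Problem S A W d d' n) : Prop :=
  ∀ j, LinearIndepOn ℝ (fun p : S × A => (X.φ p.1 p.2, X.ψ p.1 p.2 (X.wRep j))) (X.D j : Set (S × A)) ∧
    ∀ s a, (X.φ s a, X.ψ s a (X.wRep j)) ∈
      Submodule.span ℝ
        ((fun p : S × A => (X.φ p.1 p.2, X.ψ p.1 p.2 (X.wRep j))) '' (X.D j : Set (S × A)))

/-- All assumptions together. -/
structure Problem.Assumptions (X : Problem S A W d d' n) : Prop where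
  linear : X.IsLinear
  complete : X.IsComplete
  span : X.SpanCondition
  planningSets : X.PlanningSets

end Assumptions

/-! ### The algorithm, along one realisation -/

/-- What happens along one realisation: `state k h` and `action k h` are the state and the action
of step `h` of episode `k`, and `xi k h` is the parameter computed for step `h` when planning is
done in episode `k`. -/
structure Trace (S A : Type*) (d' : ℕ) where
  state : ℕ → ℕ → S
  action : ℕ → ℕ → A
  xi : ℕ → ℕ → Vec d'

section Algorithm

variable {S A W : Type*} [MeasurableSpace S] [MeasurableSpace A] {d d' n : ℕ}

/-- `Λ_h^k = λ I + ∑_{τ<k} φ_h^τ (φ_h^τ)ᵀ`. -/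
def gram (X : Problem S A W d d' n) (lam : ℝ) (t : Trace S A d') (k h : ℕ) :
    Matrix (Fin d) (Fin d) ℝ :=
  lam • (1 : Matrix (Fin d) (Fin d) ℝ) + ∑ τ ∈ Finset.Ico 1 k,
    Matrix.vecMulVec (X.φ (t.state τ h) (t.action τ h)).ofLp
      (X.φ (t.state τ h) (t.action τ h)).ofLp

/-- The action-value function `Q_h^k`, with `Q_{H+1}^k = 0`. -/
def qFun (X : Problem S A W d d' n) (lam β : ℝ) (t : Trace S A d') (k h : ℕ)
    (s : S) (a : A) (w : W) : ℝ :=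
  if h ≤ X.H then
    max (X.r h s a w + inner ℝ (t.xi k h) (X.ψ s a w)
      + 2 * X.L * β * wnorm (gram X lam t k h)⁻¹ (X.φ s a)) 0
  else 0

/-- `V_h^k(s,w) = min {max_a Q_h^k(s,a,w), H}`. -/
def vFun (X : Problem S A W d d' n) (lam β : ℝ) (t : Trace S A d') (k h : ℕ)
    (s : S) (w : W) : ℝ :=
  min (⨆ a : A, qFun X lam β t k h s a w) (X.H : ℝ)

/-- The regularised least-squares estimator `θ̃_h^k(w)`. -/
def thetaTilde (X : Problem S A W d d' n) (lam β : ℝ) (t : Trace S A d') (k h : ℕ) (w : W) :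
    Vec d :=
  Matrix.toEuclideanLin (gram X lam t k h)⁻¹
    (∑ τ ∈ Finset.Ico 1 k,
      vFun X lam β t k (h + 1) (t.state τ (h + 1)) w • X.φ (t.state τ h) (t.action τ h))

/-- The objective of the planning program. -/
def planObjective (X : Problem S A W d d' n) (z : Vec d' × (Fin n → Vec d)) : ℝ :=
  ∑ j, ∑ p ∈ X.D j,
    (inner ℝ (z.2 j) (X.φ p.1 p.2) - inner ℝ z.1 (X.ψ p.1 p.2 (X.wRep j))) ^ 2

/-- The feasible set of the planning program for step `h` in episode `k`. -/
def planFeasible (X : Problem S A W d d' n) (lam β : ℝ) (t : Trace S A d') (k h : ℕ) :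
    Set (Vec d' × (Fin n → Vec d)) :=
  {z | (∀ j, wnorm (gram X lam t k h) (z.2 j - thetaTilde X lam β t k h (X.wRep j)) ≤ β) ∧
    ‖z.1‖ ≤ X.H * Real.sqrt d'}

/-- `xi k h` is the first component of a minimiser of the planning program. -/
def IsPlanned (X : Problem S A W d d' n) (lam β : ℝ) (t : Trace S A d') (k h : ℕ) : Prop :=
  ∃ θ : Fin n → Vec d, (t.xi k h, θ) ∈ planFeasible X lam β t k h ∧
    IsMinOn (planObjective X) (planFeasible X lam β t k h) (t.xi k h, θ)

/-- The test `∃ h ∈ [H], det Λ_h^k / det Λ_h^{k₀} > e`. -/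
def DetTest (X : Problem S A W d d' n) (lam : ℝ) (t : Trace S A d') (k k₀ : ℕ) : Prop :=
  ∃ h ∈ Finset.Icc 1 X.H, Real.exp 1 < (gram X lam t k h).det / (gram X lam t k₀ h).det

open Classical in
/-- The value of `k̃` after the test of episode `k`; initially `k̃ = 1`. -/
def kTilde (X : Problem S A W d d' n) (lam : ℝ) (t : Trace S A d') : ℕ → ℕ
  | 0 => 1
  | k + 1 => if DetTest X lam t (k + 1) (kTilde X lam t k) then k + 1 else kTilde X lam t k

open Classical in
/-- The number of planning calls: episodes in `1, …, K` in which the test succeeds. -/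
def planningCalls (X : Problem S A W d d' n) (lam : ℝ) (t : Trace S A d') (K : ℕ) : ℕ :=
  ((Finset.Icc 1 K).filter fun k => DetTest X lam t k (kTilde X lam t (k - 1))).card

end Algorithm

/-! ### The interaction -/

/-- `K` episodes of Modified UCBlvd with parameters `lam` and `β` on the problem `X`, on a
probability space `(Ω, Pr)`. `filt (k, h)` is the information available once the state of step `h`
of episode `k` has been observed. The context and the initial state of episode `k` may depend
in any way on the past; ties and non-unique minimisers may be resolved in any way that
does not use the future. -/
structure Run {S A W Ω : Type*} [MeasurableSpace S] [MeasurableSpace A] [MeasurableSpace W]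
    [mΩ : MeasurableSpace Ω] {d d' n : ℕ} (X : Problem S A W d d' n) (Pr : Measure Ω)
    (K : ℕ) (lam β : ℝ) where
  filt : Filtration (ℕ ×ₗ ℕ) mΩ
  context : ℕ → Ω → W
  trace : Ω → Trace S A d'
  /-- `policy k h ω` is the map `π_h^k` in realisation `ω`. -/
  policy : ℕ → ℕ → Ω → S → W → A
  context_meas : ∀ k ∈ Finset.Icc 1 K, Measurable[filt (toLex (k, 1))] (context k)
  state_meas : ∀ k ∈ Finset.Icc 1 K, ∀ h ∈ Finset.Icc 1 (X.H + 1),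
    Measurable[filt (toLex (k, h))] fun ω => (trace ω).state k h
  xi_meas : ∀ k ∈ Finset.Icc 1 K, ∀ h ∈ Finset.Icc 1 X.H,
    Measurable[filt (toLex (k, 1))] fun ω => (trace ω).xi k h
  policy_meas : ∀ k ∈ Finset.Icc 1 K, ∀ h ∈ Finset.Icc 1 X.H,
    Measurable[(filt (toLex (k, 1))).prod (inferInstance : MeasurableSpace (S × W))]
      fun p : Ω × (S × W) => policy k h p.1 p.2.1 p.2.2
  /-- The parameters are computed in episode `1` and whenever `k̃` is set to `k`. -/
  planned : ∀ ω, ∀ k ∈ Finset.Icc 1 K, kTilde X lam (trace ω) k = k →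
    ∀ h ∈ Finset.Icc 1 X.H, IsPlanned X lam β (trace ω) k h
  greedy : ∀ ω, ∀ k ∈ Finset.Icc 1 K, ∀ h ∈ Finset.Icc 1 X.H, ∀ s w a,
    qFun X lam β (trace ω) (kTilde X lam (trace ω) k) h s a w ≤
      qFun X lam β (trace ω) (kTilde X lam (trace ω) k) h s (policy k h ω s w) w
  action_eq : ∀ ω, ∀ k ∈ Finset.Icc 1 K, ∀ h ∈ Finset.Icc 1 X.H,
    (trace ω).action k h = policy k h ω ((trace ω).state k h) (context k ω)
  /-- Given the past, the next state has law `P_h(· | s_h^k, a_h^k)`. -/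
  transition : ∀ k ∈ Finset.Icc 1 K, ∀ h ∈ Finset.Icc 1 X.H, ∀ B : Set S, MeasurableSet B →
    Pr[((fun ω => (trace ω).state k (h + 1)) ⁻¹' B).indicator (fun _ => (1 : ℝ)) |
        filt (toLex (k, h))] =ᵐ[Pr]
      fun ω => (X.P h ((trace ω).state k h, (trace ω).action k h)).real B

/-- `R_K = ∑_{k=1}^K (V_1^*(s_1^k,w^k) - V_1^{π^k}(s_1^k,w^k))`. -/
def Run.regret {S A W Ω : Type*} [MeasurableSpace S] [MeasurableSpace A] [MeasurableSpace W]
    [MeasurableSpace Ω] {d d' n : ℕ} {X : Problem S A W d d' n} {Pr : Measure Ω}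
    {K : ℕ} {lam β : ℝ} (R : Run X Pr K lam β) (ω : Ω) : ℝ :=
  ∑ k ∈ Finset.Icc 1 K,
    (X.optValue 1 ((R.trace ω).state k 1) (R.context k ω) -
      X.value (fun h => R.policy k h ω) 1 ((R.trace ω).state k 1) (R.context k ω))

end UCBlvd

end

/-! Planning calls. A call requires some det Λ_h to have grown by a factor greater than e, and these
determinants never decrease. The number of calls is therefore at most the total growth of Σ_h log
det Λ_h. Features of norm at most 1 bound the trace, and concavity of the logarithm turns this into
d log(1 + K/(dλ)) for each h (`planningCalls_le`).

Regret. The core is `IsAccurate`: at every state, action and context, ⟨ξ̂, ψ⟩ is within 2Lβ‖φ‖ (norm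
of Λ⁻¹) of the true expected next value. Contexts are adversarial, but concentration is needed only
at the n representative ones. There the linear MDP supplies vectors θ⁽ʲ⁾ that represent the expected
next value exactly, and the ridge regression error is a regularisation term plus a self-normalised
sum of noise. The function being regressed depends on the data, so the noise bound is made uniform
over a finite net of functions; for each function it comes from exponential supermartingales
(Hoeffding's lemma) and a union bound over a grid of directions (`wnorm_inv_sum_noise_sq_le`,
`Run.exists_event_wnorm_inv_sum_noise_le`).

Once every θ⁽ʲ⁾ lies in its confidence ellipsoid, the θ⁽ʲ⁾ and the vector from completeness are
feasible with objective zero. Hence any minimiser has objective zero, the planning sets spread its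
equations to all state-action pairs, and the span condition carries them to all contexts at the
price of a factor L (`abs_inner_xi_sub_integral_le`).

Accuracy gives optimism. The gap between the optimistic value and the value of the played policy
then telescopes into martingale differences plus bonuses (`Run.regret_le`). The determinant test
makes the use of an old Gram matrix cost only √e; Azuma's inequality and the elliptical potential
bound the two sums. The parameter β need not involve L, because the claim is trivial for L > K. -/

namespace UCBlvd

open Matrix

/-! ### Positive definite quadratic forms and rank-one updates -/

section QuadraticForms

variable {ι : Type*} [Fintype ι] {A : Matrix ι ι ℝ}

lemma dotProduct_mulVec_swap (hA : A.IsHermitian) (x y : ι → ℝ) :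
    x ⬝ᵥ A *ᵥ y = y ⬝ᵥ A *ᵥ x := by
  have h : Aᵀ = A := by simpa [IsHermitian] using hA
  rw [dotProduct_mulVec, ← mulVec_transpose, h, dotProduct_comm]

lemma dotProduct_mulVec_nonneg (hA : A.PosSemidef) (x : ι → ℝ) : 0 ≤ x ⬝ᵥ A *ᵥ x := by
  simpa using hA.dotProduct_mulVec_nonneg x

/-- The Cauchy–Schwarz inequality for a positive semidefinite matrix. -/
lemma dotProduct_mulVec_sq_le (hA : A.PosSemidef) (x y : ι → ℝ) :
    (x ⬝ᵥ A *ᵥ y) ^ 2 ≤ (x ⬝ᵥ A *ᵥ x) * (y ⬝ᵥ A *ᵥ y) := by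
  have key : ∀ t : ℝ, 0 ≤ (y ⬝ᵥ A *ᵥ y) * (t * t) + (2 * (x ⬝ᵥ A *ᵥ y)) * t + x ⬝ᵥ A *ᵥ x := by
    intro t
    have h := dotProduct_mulVec_nonneg hA (x + t • y)
    simp only [mulVec_add, mulVec_smul, dotProduct_add, add_dotProduct, smul_dotProduct,
      dotProduct_smul, smul_eq_mul, dotProduct_mulVec_swap hA.1 y x] at h
    linarith
  have h := discrim_le_zero key
  rw [discrim] at h
  nlinarith

lemma PosDef.add_vecMulVec_self (hA : A.PosDef) (v : ι → ℝ) : (A + vecMulVec v v).PosDef :=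
  hA.add_posSemidef (by simpa using posSemidef_vecMulVec_self_star v)

lemma dotProduct_add_vecMulVec_mulVec (x v : ι → ℝ) :
    x ⬝ᵥ (A + vecMulVec v v) *ᵥ x = x ⬝ᵥ A *ᵥ x + (v ⬝ᵥ x) ^ 2 := by
  rw [add_mulVec, dotProduct_add, vecMulVec_mulVec, dotProduct_smul]
  simp [dotProduct_comm x v, sq]

variable [DecidableEq ι]

lemma mulVec_inv_mulVec (hA : A.PosDef) (x : ι → ℝ) : A *ᵥ (A⁻¹ *ᵥ x) = x := by
  rw [mulVec_mulVec, mul_nonsing_inv _ ((isUnit_iff_isUnit_det A).1 hA.isUnit), one_mulVec]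

lemma inv_mulVec_mulVec (hA : A.PosDef) (x : ι → ℝ) : A⁻¹ *ᵥ (A *ᵥ x) = x := by
  rw [mulVec_mulVec, nonsing_inv_mul _ ((isUnit_iff_isUnit_det A).1 hA.isUnit), one_mulVec]

lemma dotProduct_sq_le_mul_inv (hA : A.PosDef) (x y : ι → ℝ) :
    (x ⬝ᵥ y) ^ 2 ≤ (x ⬝ᵥ A *ᵥ x) * (y ⬝ᵥ A⁻¹ *ᵥ y) := by
  have h := dotProduct_mulVec_sq_le hA.posSemidef x (A⁻¹ *ᵥ y)
  rw [mulVec_inv_mulVec hA, dotProduct_comm (A⁻¹ *ᵥ y) y] at h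
  exact h

lemma det_add_vecMulVec_self (hA : A.PosDef) (v : ι → ℝ) :
    (A + vecMulVec v v).det = A.det * (1 + v ⬝ᵥ A⁻¹ *ᵥ v) := by
  rw [vecMulVec_eq Unit, det_add_replicateCol_mul_replicateRow
    ((isUnit_iff_isUnit_det A).1 hA.isUnit)]
  congr 2
  rw [Matrix.mul_assoc]
  simp [Matrix.mul_apply, replicateRow, replicateCol, dotProduct, mulVec]

/-- Substituting `x = (A + vvᵀ) y` cancels the inverses, and what remains is `(v·y)² ≤
(yᵀAy)(vᵀA⁻¹v)`. The factor is the one by which the determinant grows. -/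
lemma dotProduct_inv_mulVec_le_of_add_vecMulVec (hA : A.PosDef) (v x : ι → ℝ) :
    x ⬝ᵥ A⁻¹ *ᵥ x ≤ (1 + v ⬝ᵥ A⁻¹ *ᵥ v) * (x ⬝ᵥ (A + vecMulVec v v)⁻¹ *ᵥ x) := by
  have hB := PosDef.add_vecMulVec_self hA v
  obtain ⟨y, rfl⟩ : ∃ y, x = (A + vecMulVec v v) *ᵥ y := ⟨_, (mulVec_inv_mulVec hB x).symm⟩
  rw [inv_mulVec_mulVec hB, dotProduct_comm _ y, dotProduct_add_vecMulVec_mulVec]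
  have e : (A + vecMulVec v v) *ᵥ y = A *ᵥ y + (v ⬝ᵥ y) • v := by
    rw [add_mulVec, vecMulVec_mulVec]; simp
  rw [e]
  simp only [mulVec_add, mulVec_smul, dotProduct_add, add_dotProduct, smul_dotProduct,
    dotProduct_smul, smul_eq_mul, inv_mulVec_mulVec hA]
  rw [dotProduct_mulVec_swap hA.inv.1 (A *ᵥ y) v, inv_mulVec_mulVec hA,
    dotProduct_comm (A *ᵥ y) y]
  have h := dotProduct_sq_le_mul_inv hA y v
  rw [dotProduct_comm y v] at h
  nlinarith

/-- After the same substitution, with `p = yᵀAy` and `q` the right-hand side, Cauchy–Schwarz reads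
`(p + (v·y)²)² ≤ p q`, which excludes `q < p + (v·y)²`. -/
lemma dotProduct_inv_mulVec_antitone (hA : A.PosDef) (v x : ι → ℝ) :
    x ⬝ᵥ (A + vecMulVec v v)⁻¹ *ᵥ x ≤ x ⬝ᵥ A⁻¹ *ᵥ x := by
  have hB := PosDef.add_vecMulVec_self hA v
  obtain ⟨y, rfl⟩ : ∃ y, x = (A + vecMulVec v v) *ᵥ y := ⟨_, (mulVec_inv_mulVec hB x).symm⟩
  have h1 := dotProduct_sq_le_mul_inv hA y ((A + vecMulVec v v) *ᵥ y)
  rw [dotProduct_add_vecMulVec_mulVec] at h1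
  rw [inv_mulVec_mulVec hB, dotProduct_comm _ y, dotProduct_add_vecMulVec_mulVec]
  set p := y ⬝ᵥ A *ᵥ y
  have hp : 0 ≤ p := dotProduct_mulVec_nonneg hA.posSemidef y
  set q := ((A + vecMulVec v v) *ᵥ y) ⬝ᵥ A⁻¹ *ᵥ ((A + vecMulVec v v) *ᵥ y)
  have hq : 0 ≤ q := dotProduct_mulVec_nonneg hA.inv.posSemidef _
  by_contra! hlt
  have hs := sq_nonneg (v ⬝ᵥ y)
  rcases hp.eq_or_lt with h0 | h0
  · rw [← h0] at h1 hlt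
    nlinarith
  · nlinarith

/-- The arithmetic-geometric mean inequality for the eigenvalues of a positive definite matrix. -/
lemma log_det_le (hA : A.PosDef) {a : ℝ} (ha : 0 < a) (htr : A.trace ≤ Fintype.card ι * a) :
    Real.log A.det ≤ Fintype.card ι * Real.log a := by
  have hdet := hA.1.det_eq_prod_eigenvalues
  have htr' := hA.1.trace_eq_sum_eigenvalues
  simp only [RCLike.ofReal_real_eq_id, id] at hdet htr'
  rw [hdet, Real.log_prod fun i _ => (hA.eigenvalues_pos i).ne']
  -- The tangent line of `log` at `a` bounds each term; after summation its linear part is `trace /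
  -- a - card ι ≤ 0`.
  calc ∑ i, Real.log (hA.1.eigenvalues i)
      ≤ ∑ i, (hA.1.eigenvalues i / a - 1 + Real.log a) := by
        refine Finset.sum_le_sum fun i _ => ?_
        have h := Real.log_le_sub_one_of_pos (div_pos (hA.eigenvalues_pos i) ha)
        rw [Real.log_div (hA.eigenvalues_pos i).ne' ha.ne'] at h
        linarith
    _ = A.trace / a - Fintype.card ι + Fintype.card ι * Real.log a := by
        rw [htr']
        simp [Finset.sum_add_distrib, Finset.sum_sub_distrib, Finset.sum_div]
    _ ≤ Fintype.card ι * Real.log a := by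
        have : A.trace / a ≤ Fintype.card ι := (div_le_iff₀ ha).2 htr
        linarith

end QuadraticForms

/-! ### Weighted norms and their duality -/

section WeightedNorm

variable {d : ℕ} {B : Matrix (Fin d) (Fin d) ℝ}

lemma wnorm_eq (B : Matrix (Fin d) (Fin d) ℝ) (x : Vec d) :
    wnorm B x = Real.sqrt (x.ofLp ⬝ᵥ B *ᵥ x.ofLp) := by
  rw [wnorm, EuclideanSpace.inner_eq_star_dotProduct]
  simp [dotProduct_comm]

lemma wnorm_nonneg (B : Matrix (Fin d) (Fin d) ℝ) (x : Vec d) : 0 ≤ wnorm B x :=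
  Real.sqrt_nonneg _

lemma wnorm_sq (hB : B.PosSemidef) (x : Vec d) : wnorm B x ^ 2 = x.ofLp ⬝ᵥ B *ᵥ x.ofLp := by
  rw [wnorm_eq, Real.sq_sqrt (dotProduct_mulVec_nonneg hB _)]

lemma real_inner_eq (x y : Vec d) : inner ℝ x y = x.ofLp ⬝ᵥ y.ofLp := by
  rw [EuclideanSpace.inner_eq_star_dotProduct]
  simp [dotProduct_comm]

lemma norm_sq_eq_dotProduct (x : Vec d) : ‖x‖ ^ 2 = x.ofLp ⬝ᵥ x.ofLp := by
  rw [← real_inner_eq, real_inner_self_eq_norm_sq]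

lemma wnorm_one (x : Vec d) : wnorm 1 x = ‖x‖ := by
  rw [wnorm_eq, one_mulVec, ← norm_sq_eq_dotProduct, Real.sqrt_sq (norm_nonneg _)]

lemma wnorm_add_le (hB : B.PosSemidef) (x y : Vec d) :
    wnorm B (x + y) ≤ wnorm B x + wnorm B y := by
  refine abs_le_of_sq_le_sq' ?_ (add_nonneg (wnorm_nonneg B x) (wnorm_nonneg B y)) |>.2
  have hx := wnorm_sq hB x
  have hy := wnorm_sq hB y
  have hcs := dotProduct_mulVec_sq_le hB x.ofLp y.ofLp
  rw [← hx, ← hy, ← mul_pow] at hcs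
  have h1 := abs_le_of_sq_le_sq' hcs (mul_nonneg (wnorm_nonneg B x) (wnorm_nonneg B y)) |>.2
  rw [wnorm_sq hB]
  simp only [WithLp.ofLp_add, mulVec_add, dotProduct_add, add_dotProduct,
    dotProduct_mulVec_swap hB.1 y.ofLp x.ofLp]
  nlinarith

lemma wnorm_neg (B : Matrix (Fin d) (Fin d) ℝ) (x : Vec d) : wnorm B (-x) = wnorm B x := by
  simp [wnorm_eq, mulVec_neg]

lemma abs_inner_le_wnorm_mul_wnorm_inv (hB : B.PosDef) (x y : Vec d) :
    |inner ℝ x y| ≤ wnorm B x * wnorm B⁻¹ y := by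
  refine abs_le_of_sq_le_sq ?_ (mul_nonneg (wnorm_nonneg _ _) (wnorm_nonneg _ _))
  rw [mul_pow, wnorm_sq hB.posSemidef, wnorm_sq hB.inv.posSemidef, real_inner_eq]
  exact dotProduct_sq_le_mul_inv hB _ _

lemma wnorm_toEuclideanLin_inv (hB : B.PosDef) (x : Vec d) :
    wnorm B (Matrix.toEuclideanLin B⁻¹ x) = wnorm B⁻¹ x := by
  rw [wnorm_eq, wnorm_eq]
  simp only [Matrix.ofLp_toLpLin, toLin'_apply]
  rw [mulVec_inv_mulVec hB, dotProduct_comm]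

end WeightedNorm

end UCBlvd
namespace UCBlvd

open Matrix

/-! ### Gram matrices, elliptical potential and the number of planning calls -/

section Gram

variable {S A W : Type*} [MeasurableSpace S] [MeasurableSpace A] {d d' n : ℕ}
  {X : Problem S A W d d' n} {lam : ℝ} {t : Trace S A d'}

lemma gram_one (h : ℕ) : gram X lam t 1 h = lam • (1 : Matrix (Fin d) (Fin d) ℝ) := by
  simp [gram]

lemma gram_succ {k : ℕ} (hk : 1 ≤ k) (h : ℕ) :
    gram X lam t (k + 1) h = gram X lam t k h +
      vecMulVec (X.φ (t.state k h) (t.action k h)).ofLp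
        (X.φ (t.state k h) (t.action k h)).ofLp := by
  rw [gram, gram, Finset.sum_Ico_succ_top hk, add_assoc]

lemma gram_posDef (hlam : 0 < lam) (k h : ℕ) : (gram X lam t k h).PosDef := by
  refine (PosDef.one.smul hlam).add_posSemidef (posSemidef_sum _ fun τ _ => ?_)
  simpa using posSemidef_vecMulVec_self_star (X.φ (t.state τ h) (t.action τ h)).ofLp

lemma det_gram_succ (hlam : 0 < lam) {k : ℕ} (hk : 1 ≤ k) (h : ℕ) :
    (gram X lam t (k + 1) h).det = (gram X lam t k h).det *
      (1 + wnorm (gram X lam t k h)⁻¹ (X.φ (t.state k h) (t.action k h)) ^ 2) := by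
  rw [gram_succ hk, det_add_vecMulVec_self (gram_posDef hlam k h),
    wnorm_sq (gram_posDef hlam k h).inv.posSemidef]

lemma det_gram_pos (hlam : 0 < lam) (k h : ℕ) : 0 < (gram X lam t k h).det :=
  (gram_posDef hlam k h).det_pos

lemma det_gram_mono (hlam : 0 < lam) {k k' : ℕ} (hk : 1 ≤ k) (hkk : k ≤ k') (h : ℕ) :
    (gram X lam t k h).det ≤ (gram X lam t k' h).det := by
  induction k', hkk using Nat.le_induction with
  | base => exact le_rfl
  | succ m hm ih =>
    rw [det_gram_succ hlam (hk.trans hm)]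
    nlinarith [det_gram_pos (X := X) (t := t) hlam m h,
      sq_nonneg (wnorm (gram X lam t m h)⁻¹ (X.φ (t.state m h) (t.action m h)))]

/-- Each rank-one update multiplies the determinant by `1 + vᵀΛ⁻¹v` and shrinks the inverse form by
at most that factor, so the product can only grow. -/
lemma wnorm_gram_inv_sq_mul_det_le (hlam : 0 < lam) {k k' : ℕ} (hk : 1 ≤ k) (hkk : k ≤ k')
    (h : ℕ) (x : Vec d) :
    wnorm (gram X lam t k h)⁻¹ x ^ 2 * (gram X lam t k h).det ≤
      wnorm (gram X lam t k' h)⁻¹ x ^ 2 * (gram X lam t k' h).det := by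
  induction k', hkk using Nat.le_induction with
  | base => exact le_rfl
  | succ m hm ih =>
    refine ih.trans ?_
    have hP := gram_posDef (X := X) (t := t) hlam m h
    rw [det_gram_succ hlam (hk.trans hm), wnorm_sq (gram_posDef hlam _ _).inv.posSemidef,
      wnorm_sq (gram_posDef hlam _ _).inv.posSemidef, wnorm_sq hP.inv.posSemidef,
      gram_succ (hk.trans hm)]
    have := dotProduct_inv_mulVec_le_of_add_vecMulVec hP
      (X.φ (t.state m h) (t.action m h)).ofLp x.ofLp
    nlinarith [hP.det_pos]

/-- The weighted norms of two nearby episodes are comparable as long as the test fails. -/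
lemma wnorm_gram_inv_le_of_not_detTest (hlam : 0 < lam) {k k₀ : ℕ} (hk₀ : 1 ≤ k₀) (hk : k₀ ≤ k)
    {h : ℕ} (hh : h ∈ Finset.Icc 1 X.H) (ht : ¬ DetTest X lam t k k₀) (x : Vec d) :
    wnorm (gram X lam t k₀ h)⁻¹ x ≤
      Real.sqrt (Real.exp 1) * wnorm (gram X lam t k h)⁻¹ x := by
  have hle : (gram X lam t k h).det ≤ Real.exp 1 * (gram X lam t k₀ h).det := by
    by_contra! hlt
    exact ht ⟨h, hh, (lt_div_iff₀ (det_gram_pos hlam k₀ h)).2 hlt⟩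
  have h1 := wnorm_gram_inv_sq_mul_det_le (X := X) (t := t) hlam hk₀ hk h x
  have h2 : wnorm (gram X lam t k₀ h)⁻¹ x ^ 2 ≤
      Real.exp 1 * wnorm (gram X lam t k h)⁻¹ x ^ 2 := by
    refine le_of_mul_le_mul_right ?_ (det_gram_pos (X := X) (t := t) hlam k₀ h)
    nlinarith [mul_le_mul_of_nonneg_left hle (sq_nonneg (wnorm (gram X lam t k h)⁻¹ x))]
  refine abs_le_of_sq_le_sq' ?_ (mul_nonneg (Real.sqrt_nonneg _) (wnorm_nonneg _ _)) |>.2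
  rwa [mul_pow, Real.sq_sqrt (Real.exp_pos 1).le]

lemma trace_gram_le (hφ : ∀ s a, ‖X.φ s a‖ ≤ 1) {k : ℕ} (hk : 1 ≤ k) (h : ℕ) :
    (gram X lam t k h).trace ≤ d * lam + (k - 1) := by
  rw [gram, trace_add, trace_smul, trace_sum]
  simp only [trace_one, Fintype.card_fin, smul_eq_mul, trace_vecMulVec]
  have : ∑ τ ∈ Finset.Ico 1 k, (X.φ (t.state τ h) (t.action τ h)).ofLp ⬝ᵥ
      (X.φ (t.state τ h) (t.action τ h)).ofLp ≤ ∑ τ ∈ Finset.Ico 1 k, (1 : ℝ) := by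
    refine Finset.sum_le_sum fun τ _ => ?_
    rw [← norm_sq_eq_dotProduct]
    exact pow_le_one₀ (norm_nonneg _) (hφ _ _)
  simp only [Finset.sum_const, Nat.card_Ico, nsmul_eq_mul, mul_one, Nat.cast_sub hk,
    Nat.cast_one] at this
  linarith

lemma log_det_gram_le (hlam : 0 < lam) (hφ : ∀ s a, ‖X.φ s a‖ ≤ 1) (h0 : 1 ≤ d) {k : ℕ}
    (hk : 1 ≤ k) (h : ℕ) :
    Real.log (gram X lam t k h).det - Real.log (gram X lam t 1 h).det ≤
      d * Real.log (1 + (k - 1) / (d * lam)) := by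
  have hd : (0 : ℝ) < d := by exact_mod_cast h0
  have hk' : (0 : ℝ) ≤ (k : ℝ) - 1 := by rw [sub_nonneg]; exact_mod_cast hk
  -- This `a` bounds the mean eigenvalue, the trace being at most `dλ + (k - 1)`.
  have h1 := log_det_le (gram_posDef (X := X) (t := t) hlam k h)
    (a := lam * (1 + (k - 1) / (d * lam))) (by positivity) (by
      refine (trace_gram_le hφ hk h).trans (le_of_eq ?_)
      rw [Fintype.card_fin]; field_simp)
  rw [Real.log_mul hlam.ne' (by positivity), Fintype.card_fin] at h1
  rw [gram_one, det_smul, det_one, mul_one, Real.log_pow, Fintype.card_fin]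
  linarith

lemma wnorm_gram_inv_le_norm {k : ℕ} (hk : 1 ≤ k) (h : ℕ) (x : Vec d) :
    wnorm (gram X 1 t k h)⁻¹ x ≤ ‖x‖ := by
  induction k, hk using Nat.le_induction with
  | base => rw [gram_one, one_smul, inv_one, wnorm_one]
  | succ k hk ih =>
    refine le_trans ?_ ih
    rw [wnorm_eq, wnorm_eq, gram_succ hk]
    exact Real.sqrt_le_sqrt (dotProduct_inv_mulVec_antitone (gram_posDef one_pos k h) _ _)

/-- The elliptical potential lemma. -/
lemma sum_wnorm_gram_inv_sq_le (hφ : ∀ s a, ‖X.φ s a‖ ≤ 1) (h K : ℕ) :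
    ∑ k ∈ Finset.Icc 1 K,
      wnorm (gram X 1 t k h)⁻¹ (X.φ (t.state k h) (t.action k h)) ^ 2 ≤
        2 * Real.log (gram X 1 t (K + 1) h).det := by
  induction K with
  | zero => simp [gram_one]
  | succ K ih =>
    rw [Finset.sum_Icc_succ_top (by omega), det_gram_succ one_pos (by omega : 1 ≤ K + 1)]
    set x := wnorm (gram X 1 t (K + 1) h)⁻¹ (X.φ (t.state (K + 1) h) (t.action (K + 1) h)) ^ 2
      with hx
    have hx0 : 0 ≤ x := sq_nonneg _
    have hx1 : x ≤ 1 := pow_le_one₀ (wnorm_nonneg _ _)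
      ((wnorm_gram_inv_le_norm (by omega) h _).trans (hφ _ _))
    rw [Real.log_mul (det_gram_pos one_pos _ _).ne' (by positivity)]
    -- On `[0, 1]` one has `log (1 + x) ≥ x / (1 + x) ≥ x / 2`; `x ≤ 1` comes from `λ = 1` and `‖φ‖
    -- ≤ 1`.
    have hlog : x ≤ 2 * Real.log (1 + x) := by
      have h1 := Real.one_sub_inv_le_log_of_pos (show 0 < 1 + x by linarith)
      have h2 : x / 2 ≤ 1 - (1 + x)⁻¹ := by
        rw [← sub_nonneg, show 1 - (1 + x)⁻¹ - x / 2 = x * (1 - x) / (2 * (1 + x)) by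
          field_simp; ring]
        exact div_nonneg (mul_nonneg hx0 (by linarith)) (by linarith)
      linarith
    linarith

lemma one_le_kTilde (k : ℕ) : 1 ≤ kTilde X lam t k := by
  induction k with
  | zero => simp [kTilde]
  | succ k ih => rw [kTilde]; split_ifs <;> omega

lemma kTilde_le {k : ℕ} (hk : 1 ≤ k) : kTilde X lam t k ≤ k := by
  induction k, hk using Nat.le_induction with
  | base => rw [kTilde]; split_ifs <;> simp [kTilde]
  | succ k hk ih => rw [kTilde]; split_ifs <;> omega

lemma not_detTest_self (hlam : 0 < lam) (k : ℕ) : ¬ DetTest X lam t k k := by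
  rintro ⟨h, -, hlt⟩
  rw [div_self (det_gram_pos hlam k h).ne'] at hlt
  linarith [Real.add_one_le_exp (1 : ℝ)]

/-- The parameters in use always stem from an episode in which planning took place, so accuracy is
needed only at the fixed points of `kTilde`. -/
lemma kTilde_kTilde (k : ℕ) :
    kTilde X lam t (kTilde X lam t k) = kTilde X lam t k := by
  induction k with
  | zero =>
    have h1 : kTilde X lam t 1 = 1 := by rw [kTilde]; split_ifs <;> rfl
    exact h1
  | succ k ih =>
    by_cases hD : DetTest X lam t (k + 1) (kTilde X lam t k)
    · have : kTilde X lam t (k + 1) = k + 1 := by rw [kTilde, if_pos hD]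
      rw [this, this]
    · have : kTilde X lam t (k + 1) = kTilde X lam t k := by rw [kTilde, if_neg hD]
      rw [this, ih]

lemma not_detTest_kTilde (hlam : 0 < lam) {k : ℕ} (hk : 1 ≤ k) :
    ¬ DetTest X lam t k (kTilde X lam t k) := by
  obtain ⟨k, rfl⟩ : ∃ m, k = m + 1 := ⟨k - 1, by omega⟩
  by_cases hD : DetTest X lam t (k + 1) (kTilde X lam t k)
  · rw [kTilde, if_pos hD]; exact not_detTest_self hlam _
  · rw [kTilde, if_neg hD]; exact hD

lemma planningCalls_succ (K : ℕ) [Decidable (DetTest X lam t (K + 1) (kTilde X lam t K))] :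
    planningCalls X lam t (K + 1) = planningCalls X lam t K +
      if DetTest X lam t (K + 1) (kTilde X lam t K) then 1 else 0 := by
  classical
  simp only [planningCalls]
  rw [← Finset.insert_Icc_right_eq_Icc_add_one (by omega : 1 ≤ K + 1), Finset.filter_insert]
  simp only [Nat.add_sub_cancel]
  split_ifs with h
  · rw [Finset.card_insert_of_notMem (by simp)]
  · simp

/-- Each planning call increases the sum of the logarithms of the determinants by one. -/
lemma planningCalls_le_sum_log_det (hlam : 0 < lam) (K : ℕ) :
    (planningCalls X lam t K : ℝ) ≤ ∑ h ∈ Finset.Icc 1 X.H,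
      (Real.log (gram X lam t (kTilde X lam t K) h).det - Real.log (gram X lam t 1 h).det) := by
  classical
  induction K with
  | zero => simp [planningCalls, kTilde]
  | succ K ih =>
    rw [planningCalls_succ]
    by_cases hD : DetTest X lam t (K + 1) (kTilde X lam t K)
    · rw [if_pos hD, kTilde, if_pos hD]
      -- `K = 0` is separate because `kTilde` starts at `1`, above its index.
      have hle : kTilde X lam t K ≤ K + 1 := by
        rcases Nat.eq_zero_or_pos K with rfl | h
        · simp [kTilde]
        · exact (kTilde_le h).trans (by omega)
      obtain ⟨h₀, hh₀, hlt⟩ := hD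
      have hmono : ∀ h, Real.log (gram X lam t (kTilde X lam t K) h).det ≤
          Real.log (gram X lam t (K + 1) h).det := fun h =>
        Real.log_le_log (det_gram_pos hlam _ _) (det_gram_mono hlam (one_le_kTilde K) hle h)
      have hstep : 1 ≤ ∑ h ∈ Finset.Icc 1 X.H, (Real.log (gram X lam t (K + 1) h).det -
          Real.log (gram X lam t (kTilde X lam t K) h).det) := by
        refine le_trans ?_ (Finset.single_le_sum (fun h _ => sub_nonneg.2 (hmono h)) hh₀)
        rw [← Real.log_div (det_gram_pos hlam _ _).ne' (det_gram_pos hlam _ _).ne',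
          Real.le_log_iff_exp_le (div_pos (det_gram_pos hlam _ _) (det_gram_pos hlam _ _))]
        exact hlt.le
      rw [Finset.sum_sub_distrib] at hstep ih ⊢
      push_cast
      linarith
    · rw [if_neg hD, kTilde, if_neg hD]
      simpa using ih

lemma planningCalls_le (hlam : 0 < lam) (hφ : ∀ s a, ‖X.φ s a‖ ≤ 1) (K : ℕ) :
    (planningCalls X lam t K : ℝ) ≤ d * X.H * Real.log (1 + K / (d * lam)) := by
  refine (planningCalls_le_sum_log_det hlam K).trans ?_
  rcases Nat.eq_zero_or_pos d with rfl | hd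
  · simp
  rcases Nat.eq_zero_or_pos K with rfl | hK
  · simp [kTilde]
  have hd' : (0 : ℝ) < d := by exact_mod_cast hd
  calc _ ≤ ∑ h ∈ Finset.Icc 1 X.H, (d * Real.log (1 + K / (d * lam)) : ℝ) := by
        refine Finset.sum_le_sum fun h _ => ?_
        have h1 : (1 : ℝ) ≤ kTilde X lam t K := by exact_mod_cast one_le_kTilde K
        have h2 : (kTilde X lam t K : ℝ) ≤ K := by exact_mod_cast kTilde_le hK
        refine (log_det_gram_le hlam hφ hd (one_le_kTilde K) h).trans ?_
        have : (0 : ℝ) ≤ ((kTilde X lam t K : ℝ) - 1) / (d * lam) :=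
          div_nonneg (by linarith) (by positivity)
        gcongr
        linarith
    _ = _ := by simp; ring

end Gram

end UCBlvd
namespace UCBlvd

/-! ### Disintegration, and one step of an exponential supermartingale -/

section Disintegration

variable {Ω Ω' S : Type*} [MeasurableSpace Ω] [MeasurableSpace Ω'] [MeasurableSpace S]
  {Pr : Measure Ω} [IsProbabilityMeasure Pr] {I : Ω → Ω'} {Y : Ω → S}
  {κ : Kernel Ω' S} [IsMarkovKernel κ]

/-- Rectangles determine a finite measure on a product. In the application `Ω'` is `Ω` with the
σ-algebra of the past. -/
lemma map_prodMk_eq_compProd (hI : Measurable I) (hY : Measurable Y)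
    (h : ∀ A B, MeasurableSet A → MeasurableSet B →
      Pr (I ⁻¹' A ∩ Y ⁻¹' B) = ∫⁻ ω in I ⁻¹' A, κ (I ω) B ∂Pr) :
    Pr.map (fun ω => (I ω, Y ω)) = (Pr.map I).compProd κ := by
  have : IsProbabilityMeasure (Pr.map I) := Measure.isProbabilityMeasure_map hI.aemeasurable
  have : IsProbabilityMeasure (Pr.map fun ω => (I ω, Y ω)) :=
    Measure.isProbabilityMeasure_map (hI.prodMk hY).aemeasurable
  refine Measure.ext_prod fun {A B} hA hB => ?_
  rw [Measure.map_apply (hI.prodMk hY) (hA.prod hB), Measure.compProd_apply_prod hA hB,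
    setLIntegral_map hA (κ.measurable_coe hB) hI]
  exact h A B hA hB

lemma lintegral_comp_prodMk (hI : Measurable I) (hY : Measurable Y)
    (h : ∀ A B, MeasurableSet A → MeasurableSet B →
      Pr (I ⁻¹' A ∩ Y ⁻¹' B) = ∫⁻ ω in I ⁻¹' A, κ (I ω) B ∂Pr)
    {g : Ω' × S → ENNReal} (hg : Measurable g) :
    ∫⁻ ω, g (I ω, Y ω) ∂Pr = ∫⁻ ω, ∫⁻ s, g (I ω, s) ∂(κ (I ω)) ∂Pr := by
  have : IsProbabilityMeasure (Pr.map I) := Measure.isProbabilityMeasure_map hI.aemeasurable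
  rw [← lintegral_map hg (hI.prodMk hY), map_prodMk_eq_compProd hI hY h,
    Measure.lintegral_compProd hg,
    lintegral_map (f := fun x => ∫⁻ s, g (x, s) ∂(κ x)) hg.lintegral_kernel_prod_right' hI]

/-- Hoeffding's lemma as a bound on a lower integral. -/
lemma lintegral_exp_le {μ : Measure S} [IsProbabilityMeasure μ] {f : S → ℝ} (hf : Measurable f)
    {a b : ℝ} (hab : ∀ s, f s ∈ Set.Icc a b) (u : ℝ) :
    ∫⁻ s, ENNReal.ofReal (Real.exp (u * (f s - ∫ s, f s ∂μ) - u ^ 2 * ((b - a) ^ 2 / 8))) ∂μ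
      ≤ 1 := by
  have hsub := hasSubgaussianMGF_of_mem_Icc (μ := μ) hf.aemeasurable (ae_of_all _ hab)
  have hint := hsub.integrable_exp_mul u
  have hmgf := hsub.mgf_le u
  -- The variance proxy `((b - a) / 2)²`, halved in the exponent, gives the `8`.
  have hc : ((((‖b - a‖₊ / 2) ^ 2 : NNReal) : ℝ) * u ^ 2 / 2) = u ^ 2 * ((b - a) ^ 2 / 8) := by
    push_cast
    rw [div_pow, Real.norm_eq_abs, sq_abs]
    ring
  rw [hc] at hmgf
  simp_rw [Real.exp_sub, ENNReal.ofReal_div_of_pos (Real.exp_pos _), ENNReal.div_eq_inv_mul]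
  rw [lintegral_const_mul _ (by fun_prop), ← ofReal_integral_eq_lintegral_ofReal hint
    (ae_of_all _ fun s => (Real.exp_pos _).le), ← ENNReal.div_eq_inv_mul]
  refine ENNReal.div_le_of_le_mul ?_
  rw [one_mul]
  exact ENNReal.ofReal_le_ofReal hmgf

/-- The weight, the coefficient and the function may all depend on the past; conditioning freezes
them and leaves Hoeffding's lemma for `κ (I ω)`. Lower integrals avoid any integrability condition
on `G`. -/
lemma lintegral_mul_exp_le (hI : Measurable I) (hY : Measurable Y)
    (h : ∀ A B, MeasurableSet A → MeasurableSet B →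
      Pr (I ⁻¹' A ∩ Y ⁻¹' B) = ∫⁻ ω in I ⁻¹' A, κ (I ω) B ∂Pr)
    {G : Ω' → ENNReal} (hG : Measurable G) {u : Ω' → ℝ} (hu : Measurable u)
    {f : Ω' → S → ℝ} (hf : Measurable fun p : Ω' × S => f p.1 p.2) {a b : ℝ}
    (hab : ∀ x s, f x s ∈ Set.Icc a b) :
    ∫⁻ ω, G (I ω) * ENNReal.ofReal (Real.exp (u (I ω) *
        (f (I ω) (Y ω) - ∫ s, f (I ω) s ∂(κ (I ω))) - u (I ω) ^ 2 * ((b - a) ^ 2 / 8))) ∂Pr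
      ≤ ∫⁻ ω, G (I ω) ∂Pr := by
  have hκ : Measurable fun x => ∫ s, f x s ∂(κ x) :=
    (hf.stronglyMeasurable.integral_kernel_prod_right).measurable
  have hmeas : Measurable fun p : Ω' × S => G p.1 * ENNReal.ofReal (Real.exp (u p.1 *
      (f p.1 p.2 - ∫ s, f p.1 s ∂(κ p.1)) - u p.1 ^ 2 * ((b - a) ^ 2 / 8))) := by
    have hhκ := hκ.comp (measurable_fst : Measurable (Prod.fst : Ω' × S → Ω'))
    have hhu := hu.comp (measurable_fst : Measurable (Prod.fst : Ω' × S → Ω'))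
    have hhG := hG.comp (measurable_fst : Measurable (Prod.fst : Ω' × S → Ω'))
    exact hhG.mul (((hhu.mul (hf.sub hhκ)).sub ((hhu.pow_const 2).mul_const _)).exp.ennreal_ofReal)
  rw [lintegral_comp_prodMk hI hY h hmeas]
  refine lintegral_mono fun ω => ?_
  have hfω : Measurable (f (I ω)) := hf.comp measurable_prodMk_left
  simp only
  rw [lintegral_const_mul _ (by fun_prop)]
  exact mul_le_of_le_one_right' (lintegral_exp_le hfω (hab _) _)

end Disintegration

/-! ### One transition of the run given the past -/

section Step

variable {S A W Ω : Type*} [MeasurableSpace S] [MeasurableSpace A] [MeasurableSpace W]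
    [mΩ : MeasurableSpace Ω] {d d' n : ℕ} {X : Problem S A W d d' n} {Pr : Measure Ω}
    {K : ℕ} {lam β : ℝ}

lemma Run.filt_mono (R : Run X Pr K lam β) {k k' h h' : ℕ} (hk : k < k' ∨ k = k' ∧ h ≤ h') :
    R.filt (toLex (k, h)) ≤ R.filt (toLex (k', h')) :=
  R.filt.mono (Prod.Lex.toLex_le_toLex.2 hk)

lemma Run.measurable_action (R : Run X Pr K lam β) {k h : ℕ} (hk : k ∈ Finset.Icc 1 K)
    (hh : h ∈ Finset.Icc 1 X.H) :
    Measurable[R.filt (toLex (k, h))] fun ω => (R.trace ω).action k h := by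
  have hle : R.filt (toLex (k, 1)) ≤ R.filt (toLex (k, h)) :=
    R.filt_mono (Or.inr ⟨rfl, (Finset.mem_Icc.1 hh).1⟩)
  have hs := R.state_meas k hk h (by simp only [Finset.mem_Icc] at hh ⊢; omega)
  have hc := (R.context_meas k hk).mono hle le_rfl
  have hp := R.policy_meas k hk h hh
  have hid : Measurable[R.filt (toLex (k, h)), R.filt (toLex (k, 1))] (id : Ω → Ω) :=
    measurable_id'' hle
  have := hp.comp (hid.prodMk (hs.prodMk hc))
  rw [show (fun ω => (R.trace ω).action k h) = _ from
    funext fun ω => R.action_eq ω k hk h hh]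
  exact this

lemma Run.lintegral_mul_exp_le [IsProbabilityMeasure Pr] (R : Run X Pr K lam β) {k h : ℕ}
    (hk : k ∈ Finset.Icc 1 K) (hh : h ∈ Finset.Icc 1 X.H) {G : Ω → ENNReal}
    (hG : Measurable[R.filt (toLex (k, h))] G)
    {u : Ω → ℝ} (hu : Measurable[R.filt (toLex (k, h))] u) {f : Ω → S → ℝ}
    (hf : Measurable[(R.filt (toLex (k, h))).prod (inferInstance : MeasurableSpace S)]
      fun p : Ω × S => f p.1 p.2) {a b : ℝ} (hab : ∀ ω s, f ω s ∈ Set.Icc a b) :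
    ∫⁻ ω, G ω * ENNReal.ofReal (Real.exp (u ω *
        (f ω ((R.trace ω).state k (h + 1)) -
          ∫ s, f ω s ∂(X.P h ((R.trace ω).state k h, (R.trace ω).action k h)))
          - u ω ^ 2 * ((b - a) ^ 2 / 8))) ∂Pr
      ≤ ∫⁻ ω, G ω ∂Pr := by
  have hle : R.filt (toLex (k, h)) ≤ mΩ := R.filt.le _
  have hs := R.state_meas k hk h (by simp only [Finset.mem_Icc] at hh ⊢; omega)
  have hs' := (R.state_meas k hk (h + 1) (by simp only [Finset.mem_Icc] at hh ⊢; omega)).mono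
    (R.filt.le _) le_rfl
  have ha := R.measurable_action hk hh
  have := X.isMarkov h
  -- The past is encoded by the identity from `Ω` to `Ω` with the smaller σ-algebra. The transition
  -- kernel is pulled back along the current state and action, which are measurable for it.
  let κ : @Kernel Ω S (R.filt (toLex (k, h))) _ :=
    @Kernel.comap _ _ _ _ _ (R.filt (toLex (k, h))) (X.P h) _ (hs.prodMk ha)
  have hκ : @IsMarkovKernel _ _ (R.filt (toLex (k, h))) _ κ :=
    @IsMarkovKernel.mk _ _ (R.filt (toLex (k, h))) _ κ fun ω =>
      (X.isMarkov h).isProbabilityMeasure ((R.trace ω).state k h, (R.trace ω).action k h)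
  refine @UCBlvd.lintegral_mul_exp_le Ω Ω S mΩ (R.filt (toLex (k, h))) _ Pr _ id
    (fun ω => (R.trace ω).state k (h + 1)) κ hκ (measurable_id'' hle) hs' ?_ G hG u hu f hf a b hab
  intro B C hB hC
  have ht := R.transition k hk h hh C hC
  have hC' : MeasurableSet[mΩ] ((fun ω => (R.trace ω).state k (h + 1)) ⁻¹' C) := hs' hC
  have hint : Integrable (((fun ω => (R.trace ω).state k (h + 1)) ⁻¹' C).indicator
      (fun _ => (1 : ℝ))) Pr := (integrable_const _).indicator hC'
  have h1 := setIntegral_condExp hle hint hB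
  rw [setIntegral_congr_ae (hle _ hB) (ht.mono fun ω h _ => h), integral_indicator hC', setIntegral_const,
    smul_eq_mul, mul_one, Measure.real, Measure.restrict_apply hC'] at h1
  have hmeas : Measurable fun ω =>
      (X.P h ((R.trace ω).state k h, (R.trace ω).action k h)).real C :=
    (((X.P h).measurable_coe hC).ennreal_toReal.comp (hs.prodMk ha)).mono hle le_rfl
  have h2 := ofReal_integral_eq_lintegral_ofReal (μ := Pr.restrict B)
    (Integrable.of_mem_Icc 0 1 hmeas.aemeasurable
      (ae_of_all _ fun ω => ⟨measureReal_nonneg, measureReal_le_one⟩))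
    (ae_of_all _ fun ω => measureReal_nonneg)
  rw [h1, ENNReal.ofReal_toReal (measure_ne_top _ _), Set.inter_comm] at h2
  refine h2.trans (lintegral_congr fun ω => ?_)
  exact ENNReal.ofReal_toReal (measure_ne_top _ _)

end Step

end UCBlvd
namespace UCBlvd

/-! ### Exponential supermartingales of the regression noise -/

section Noise

variable {S A W Ω : Type*} [MeasurableSpace S] [MeasurableSpace A]
  {d d' n : ℕ} {X : Problem S A W d d' n}

/-- The deviation of `f` at the next state from its conditional mean. -/
noncomputable def noise (X : Problem S A W d d' n) (t : Trace S A d') (f : S → ℝ) (k h : ℕ) : ℝ :=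
  f (t.state k (h + 1)) - ∫ s, f s ∂(X.P h (t.state k h, t.action k h))

/-- The logarithm of the exponential supermartingale of the noise in direction `θ`. -/
noncomputable def logSupermartingale (X : Problem S A W d d' n) (t : Trace S A d') (θ : Vec d) (f : S → ℝ)
    (k h : ℕ) : ℝ :=
  ∑ τ ∈ Finset.Ico 1 k, (inner ℝ θ (X.φ (t.state τ h) (t.action τ h)) * noise X t f τ h -
    inner ℝ θ (X.φ (t.state τ h) (t.action τ h)) ^ 2 * ((X.H : ℝ) ^ 2 / 8))

lemma measurable_integral_P {f : S → ℝ} (hf : Measurable f) (h : ℕ) :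
    Measurable fun p : S × A => ∫ s, f s ∂(X.P h p) := by
  have := X.isMarkov h
  exact hf.stronglyMeasurable.integral_kernel.measurable

variable [MeasurableSpace W] [mΩ : MeasurableSpace Ω] {Pr : Measure Ω} {K : ℕ} {lam β : ℝ}

lemma Problem.IsLinear.measurable_φ [DiscreteMeasurableSpace A] [Finite A] (hX : X.IsLinear) :
    Measurable fun p : S × A => X.φ p.1 p.2 :=
  measurable_from_prod_countable_left hX.φ_meas

lemma Run.measurable_noise (R : Run X Pr K lam β) {f : S → ℝ} (hf : Measurable f) {k h : ℕ}
    (hk : k ∈ Finset.Icc 1 K) (hh : h ∈ Finset.Icc 1 X.H) :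
    Measurable[R.filt (toLex (k, h + 1))] fun ω => noise X (R.trace ω) f k h := by
  have hs := R.state_meas k hk h (by simp only [Finset.mem_Icc] at hh ⊢; omega)
  have hs' := R.state_meas k hk (h + 1) (by simp only [Finset.mem_Icc] at hh ⊢; omega)
  have h1 := ((measurable_integral_P (X := X) hf h).comp
    (hs.prodMk (R.measurable_action hk hh))).mono
    (R.filt_mono (Or.inr ⟨rfl, (by omega : h ≤ h + 1)⟩)) le_rfl
  exact (hf.comp hs').sub h1

variable [DiscreteMeasurableSpace A] [Finite A]

lemma Run.measurable_φ (hX : X.IsLinear) (R : Run X Pr K lam β) {k h : ℕ}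
    (hk : k ∈ Finset.Icc 1 K) (hh : h ∈ Finset.Icc 1 X.H) :
    Measurable[R.filt (toLex (k, h))]
      fun ω => X.φ ((R.trace ω).state k h) ((R.trace ω).action k h) := by
  have hs := R.state_meas k hk h (by simp only [Finset.mem_Icc] at hh ⊢; omega)
  exact hX.measurable_φ.comp (hs.prodMk (R.measurable_action hk hh))

lemma Run.measurable_logSupermartingale (hX : X.IsLinear) (R : Run X Pr K lam β) (θ : Vec d)
    {f : S → ℝ} (hf : Measurable f) {k h : ℕ} (hk : k ≤ K + 1) (hh : h ∈ Finset.Icc 1 X.H) :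
    Measurable[R.filt (toLex (k, h))] fun ω => logSupermartingale X (R.trace ω) θ f k h := by
  refine Finset.measurable_fun_sum _ fun τ hτ => ?_
  rw [Finset.mem_Ico] at hτ
  have hτK : τ ∈ Finset.Icc 1 K := Finset.mem_Icc.2 (by omega)
  have h1 := (R.measurable_φ hX hτK hh).mono (R.filt_mono (Or.inl hτ.2) (h' := h)) le_rfl
  have h2 := (R.measurable_noise hf hτK hh).mono (R.filt_mono (Or.inl hτ.2) (h' := h)) le_rfl
  have h3 : Measurable[R.filt (toLex (k, h))] fun ω =>
      inner ℝ θ (X.φ ((R.trace ω).state τ h) ((R.trace ω).action τ h)) :=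
    (measurable_const.inner measurable_id : Measurable fun x : Vec d => inner ℝ θ x).comp h1
  exact (h3.mul h2).sub ((h3.pow_const 2).mul_const _)

/-- For fixed `h`, the noise of episode `τ` is revealed at time `(τ, h + 1)`, which precedes `(k,
h)` whenever `τ < k`. Thus step `h` of successive episodes yields martingale differences. -/
lemma Run.lintegral_exp_logSupermartingale_le [IsProbabilityMeasure Pr] (hX : X.IsLinear)
    (R : Run X Pr K lam β) (θ : Vec d) {f : S → ℝ} (hf : Measurable f)
    (hfH : ∀ s, f s ∈ Set.Icc (0 : ℝ) X.H) {k h : ℕ} (hk1 : 1 ≤ k) (hk : k ≤ K + 1)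
    (hh : h ∈ Finset.Icc 1 X.H) :
    ∫⁻ ω, ENNReal.ofReal (Real.exp (logSupermartingale X (R.trace ω) θ f k h)) ∂Pr ≤ 1 := by
  induction k, hk1 using Nat.le_induction with
  | base => simp [logSupermartingale]
  | succ k hk1 ih =>
    have hkK : k ∈ Finset.Icc 1 K := Finset.mem_Icc.2 (by omega)
    refine le_trans (le_of_eq ?_) ((R.lintegral_mul_exp_le hkK hh
      (G := fun ω => ENNReal.ofReal (Real.exp (logSupermartingale X (R.trace ω) θ f k h)))
      (R.measurable_logSupermartingale hX θ hf (by omega) hh).exp.ennreal_ofReal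
      (u := fun ω => inner ℝ θ (X.φ ((R.trace ω).state k h) ((R.trace ω).action k h)))
      ((measurable_const.inner measurable_id : Measurable fun x : Vec d => inner ℝ θ x).comp
        (R.measurable_φ hX hkK hh))
      (f := fun _ => f) (hf.comp measurable_snd) (fun _ => hfH)).trans (ih (by omega)))
    refine lintegral_congr fun ω => ?_
    rw [← ENNReal.ofReal_mul (Real.exp_pos _).le, ← Real.exp_add, logSupermartingale,
      Finset.sum_Ico_succ_top hk1, sub_zero]
    rfl

/-- Markov's inequality for exponentials. -/
lemma measure_lt_le_of_lintegral_exp_le [IsProbabilityMeasure Pr] {g : Ω → ℝ} (hg : Measurable g)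
    {c : ℝ} (h : ∫⁻ ω, ENNReal.ofReal (Real.exp (g ω)) ∂Pr ≤ ENNReal.ofReal (Real.exp c)) (x : ℝ) :
    Pr {ω | x < g ω} ≤ ENNReal.ofReal (Real.exp (c - x)) := by
  have h1 := mul_meas_ge_le_lintegral (μ := Pr) hg.exp.ennreal_ofReal
    (ENNReal.ofReal (Real.exp x))
  have hsub : {ω | x < g ω} ⊆
      {ω | ENNReal.ofReal (Real.exp x) ≤ ENNReal.ofReal (Real.exp (g ω))} := fun ω hω =>
    ENNReal.ofReal_le_ofReal (Real.exp_le_exp.2 (le_of_lt hω))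
  have hx : ENNReal.ofReal (Real.exp x) ≠ 0 := by simp [Real.exp_pos]
  rw [Real.exp_sub, ENNReal.ofReal_div_of_pos (Real.exp_pos x),
    ENNReal.le_div_iff_mul_le (Or.inl hx) (Or.inl ENNReal.ofReal_ne_top), mul_comm]
  exact (mul_le_mul_right (measure_mono hsub) _).trans (h1.trans h)

/-- Finitely many supermartingales are bounded simultaneously with high probability. -/
lemma Run.exists_event_logSupermartingale_le [IsProbabilityMeasure Pr] (hX : X.IsLinear)
    (R : Run X Pr K lam β) {ι : Type*} (J : Finset ι) (θ : ι → Vec d) (f : ι → S → ℝ)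
    (hf : ∀ i, Measurable (f i)) (hfH : ∀ i s, f i s ∈ Set.Icc (0 : ℝ) X.H)
    (hN : 0 < J.card * (K * X.H)) {η : ℝ} (hη : 0 < η) :
    ∃ E : Set Ω, MeasurableSet E ∧ Pr Eᶜ ≤ ENNReal.ofReal η ∧
      ∀ ω ∈ E, ∀ i ∈ J, ∀ k ∈ Finset.Icc 1 K, ∀ h ∈ Finset.Icc 1 X.H,
        logSupermartingale X (R.trace ω) (θ i) (f i) k h ≤
          Real.log (((J.card * (K * X.H) : ℕ) : ℝ) / η) := by
  classical
  set N : ℕ := J.card * (K * X.H) with hNdef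
  have hN' : (0 : ℝ) < N := by exact_mod_cast hN
  let I := J ×ˢ (Finset.Icc 1 K ×ˢ Finset.Icc 1 X.H)
  -- At level `log (N / η)`, Markov's inequality gives each of the `N` bad events probability at
  -- most `η / N`.
  let F : ι × ℕ × ℕ → Set Ω := fun p =>
    {ω | Real.log (N / η) < logSupermartingale X (R.trace ω) (θ p.1) (f p.1) p.2.1 p.2.2}
  have hmeas : ∀ p ∈ I, Measurable fun ω =>
      logSupermartingale X (R.trace ω) (θ p.1) (f p.1) p.2.1 p.2.2 := by
    intro p hp
    simp only [I, Finset.mem_product] at hp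
    exact (R.measurable_logSupermartingale hX _ (hf _)
      (by have := Finset.mem_Icc.1 hp.2.1; omega) hp.2.2).mono (R.filt.le _) le_rfl
  have hF : ∀ p ∈ I, MeasurableSet (F p) := fun p hp =>
    measurableSet_lt measurable_const (hmeas p hp)
  refine ⟨(⋃ p ∈ I, F p)ᶜ, (Finset.measurableSet_biUnion _ hF).compl, ?_, ?_⟩
  · rw [compl_compl]
    calc Pr (⋃ p ∈ I, F p) ≤ ∑ p ∈ I, Pr (F p) := measure_biUnion_finset_le _ _
      _ ≤ ∑ p ∈ I, ENNReal.ofReal (η / N) := by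
          refine Finset.sum_le_sum fun p hp => ?_
          have hp' := hp
          simp only [I, Finset.mem_product] at hp'
          have h1 := measure_lt_le_of_lintegral_exp_le (c := 0) (hmeas p hp) (by
            simpa using R.lintegral_exp_logSupermartingale_le hX (θ p.1) (hf p.1) (hfH p.1)
              (Finset.mem_Icc.1 hp'.2.1).1 (by have := Finset.mem_Icc.1 hp'.2.1; omega) hp'.2.2)
            (Real.log (N / η))
          rwa [zero_sub, Real.exp_neg, Real.exp_log (div_pos hN' hη), inv_div] at h1
      _ = ENNReal.ofReal η := by
          rw [Finset.sum_const, nsmul_eq_mul, show I.card = N by simp [I, N],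
            ← ENNReal.ofReal_natCast, ← ENNReal.ofReal_mul hN'.le]
          congr 1
          field_simp
  · intro ω hω i hi k hk h hh
    by_contra! hlt
    have hI : (i, k, h) ∈ I := by
      simp only [I, Finset.mem_product]
      exact ⟨hi, hk, hh⟩
    exact hω (Set.mem_biUnion hI hlt)

end Noise

end UCBlvd
namespace UCBlvd

/-! ### Azuma's inequality over all steps of all episodes -/

section Azuma

variable {S A W Ω : Type*} [MeasurableSpace S] [MeasurableSpace A] [MeasurableSpace W]
    [mΩ : MeasurableSpace Ω] {d d' n : ℕ} {X : Problem S A W d d' n} {Pr : Measure Ω}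
    {K : ℕ} {lam β : ℝ}

/-- The normalised increment of the exponential supermartingale of Azuma's inequality. -/
noncomputable def Run.increment (R : Run X Pr K lam β) (f : ℕ → ℕ → Ω → S → ℝ) (u c : ℝ)
    (k h : ℕ) (ω : Ω) : ℝ :=
  u * (f k h ω ((R.trace ω).state k (h + 1)) -
    ∫ s, f k h ω s ∂(X.P h ((R.trace ω).state k h, (R.trace ω).action k h))) - u ^ 2 * c

lemma Run.measurable_increment (R : Run X Pr K lam β) {f : ℕ → ℕ → Ω → S → ℝ} {k h : ℕ}
    (hk : k ∈ Finset.Icc 1 K) (hh : h ∈ Finset.Icc 1 X.H)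
    (hf : Measurable[(R.filt (toLex (k, 1))).prod (inferInstance : MeasurableSpace S)]
      fun p : Ω × S => f k h p.1 p.2) (u c : ℝ) :
    Measurable[R.filt (toLex (k, h + 1))] (R.increment f u c k h) := by
  have := X.isMarkov h
  have hle : R.filt (toLex (k, h)) ≤ R.filt (toLex (k, h + 1)) :=
    R.filt_mono (Or.inr ⟨rfl, by omega⟩)
  have hs := (R.state_meas k hk h (by simp only [Finset.mem_Icc] at hh ⊢; omega)).mono hle le_rfl
  have hs' := R.state_meas k hk (h + 1) (by simp only [Finset.mem_Icc] at hh ⊢; omega)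
  have ha := (R.measurable_action hk hh).mono hle le_rfl
  have hid : Measurable[R.filt (toLex (k, h + 1)), R.filt (toLex (k, 1))] (id : Ω → Ω) :=
    measurable_id'' (R.filt_mono (Or.inr ⟨rfl, by omega⟩))
  have h1 : Measurable[R.filt (toLex (k, h + 1))]
      fun ω => f k h ω ((R.trace ω).state k (h + 1)) := hf.comp (hid.prodMk hs')
  let κ : @Kernel Ω S (R.filt (toLex (k, h + 1))) _ :=
    @Kernel.comap _ _ _ _ _ (R.filt (toLex (k, h + 1))) (X.P h) _ (hs.prodMk ha)
  have hκ : @IsMarkovKernel _ _ (R.filt (toLex (k, h + 1))) _ κ :=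
    @IsMarkovKernel.mk _ _ (R.filt (toLex (k, h + 1))) _ κ fun ω =>
      (X.isMarkov h).isProbabilityMeasure ((R.trace ω).state k h, (R.trace ω).action k h)
  have hf' : Measurable[(R.filt (toLex (k, h + 1))).prod (inferInstance : MeasurableSpace S)]
      fun p : Ω × S => f k h p.1 p.2 :=
    hf.comp ((hid.comp (@measurable_fst _ _ (R.filt (toLex (k, h + 1))) _)).prodMk
      (@measurable_snd _ _ (R.filt (toLex (k, h + 1))) _))
  have h2 : Measurable[R.filt (toLex (k, h + 1))] fun ω =>
      ∫ s, f k h ω s ∂(X.P h ((R.trace ω).state k h, (R.trace ω).action k h)) :=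
    (@StronglyMeasurable.integral_kernel_prod_right Ω S (R.filt (toLex (k, h + 1))) _ κ _ _ _ _
      (fun ω s => f k h ω s)
      (@Measurable.stronglyMeasurable _ _ (_) _ _ _ _ _ _ hf')).measurable
  exact ((h1.sub h2).const_mul u).sub_const _

/-- Two nested inductions follow the lexicographic order of time. Each `f k h` is known at the start
of episode `k`, hence predictable at every step of that episode. -/
lemma Run.lintegral_exp_sum_increment_le [IsProbabilityMeasure Pr] (R : Run X Pr K lam β)
    {f : ℕ → ℕ → Ω → S → ℝ}
    (hf : ∀ k ∈ Finset.Icc 1 K, ∀ h ∈ Finset.Icc 1 X.H,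
      Measurable[(R.filt (toLex (k, 1))).prod (inferInstance : MeasurableSpace S)]
        fun p : Ω × S => f k h p.1 p.2) {a b : ℝ}
    (hab : ∀ k ∈ Finset.Icc 1 K, ∀ h ∈ Finset.Icc 1 X.H, ∀ ω s, f k h ω s ∈ Set.Icc a b) (u : ℝ) :
    ∫⁻ ω, ENNReal.ofReal (Real.exp (∑ k ∈ Finset.Ico 1 (K + 1), ∑ h ∈ Finset.Ico 1 (X.H + 1),
      R.increment f u ((b - a) ^ 2 / 8) k h ω)) ∂Pr ≤ 1 := by
  set D := R.increment f u ((b - a) ^ 2 / 8) with hD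
  have hmem : ∀ {m N : ℕ}, m ∈ Finset.Ico 1 (N + 1) → m ∈ Finset.Icc 1 N := by
    intro m N hm; simp only [Finset.mem_Ico, Finset.mem_Icc] at hm ⊢; omega
  have hDm : ∀ k ∈ Finset.Icc 1 K, ∀ h ∈ Finset.Icc 1 X.H,
      Measurable[R.filt (toLex (k, h + 1))] (D k h) := fun k hk h hh =>
    R.measurable_increment hk hh (hf k hk h hh) _ _
  have key : ∀ k, 1 ≤ k → k ≤ K + 1 → ∫⁻ ω, ENNReal.ofReal (Real.exp
      (∑ k' ∈ Finset.Ico 1 k, ∑ h' ∈ Finset.Ico 1 (X.H + 1), D k' h' ω)) ∂Pr ≤ 1 := by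
    intro k hk
    induction k, hk using Nat.le_induction with
    | base => simp
    | succ k hk1 ih =>
      intro hkK
      have hk : k ∈ Finset.Icc 1 K := Finset.mem_Icc.2 (by omega)
      have inner_key : ∀ h, 1 ≤ h → h ≤ X.H + 1 → ∫⁻ ω, ENNReal.ofReal (Real.exp
          (∑ k' ∈ Finset.Ico 1 k, ∑ h' ∈ Finset.Ico 1 (X.H + 1), D k' h' ω +
            ∑ h' ∈ Finset.Ico 1 h, D k h' ω)) ∂Pr ≤ 1 := by
        intro h hh1
        induction h, hh1 using Nat.le_induction with
        | base => intro _; simpa using ih (by omega)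
        | succ h hh1 ih2 =>
          intro hhH
          have hh : h ∈ Finset.Icc 1 X.H := Finset.mem_Icc.2 (by omega)
          have hid : Measurable[R.filt (toLex (k, h)), R.filt (toLex (k, 1))] (id : Ω → Ω) :=
            measurable_id'' (R.filt_mono (Or.inr ⟨rfl, by omega⟩))
          have hf' : Measurable[(R.filt (toLex (k, h))).prod (inferInstance : MeasurableSpace S)]
              fun p : Ω × S => f k h p.1 p.2 :=
            (hf k hk h hh).comp ((hid.comp (@measurable_fst _ _ (R.filt (toLex (k, h))) _)).prodMk
              (@measurable_snd _ _ (R.filt (toLex (k, h))) _))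
          have hG : Measurable[R.filt (toLex (k, h))] fun ω => ENNReal.ofReal (Real.exp
              (∑ k' ∈ Finset.Ico 1 k, ∑ h' ∈ Finset.Ico 1 (X.H + 1), D k' h' ω +
                ∑ h' ∈ Finset.Ico 1 h, D k h' ω)) := by
            refine Measurable.ennreal_ofReal (Measurable.exp (Measurable.add ?_ ?_))
            · refine Finset.measurable_fun_sum _ fun k' hk' =>
                Finset.measurable_fun_sum _ fun h' hh' => ?_
              rw [Finset.mem_Ico] at hk'
              exact (hDm k' (Finset.mem_Icc.2 (by omega)) h' (hmem hh')).mono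
                (R.filt_mono (Or.inl hk'.2)) le_rfl
            · refine Finset.measurable_fun_sum _ fun h' hh' => ?_
              rw [Finset.mem_Ico] at hh'
              exact (hDm k hk h' (Finset.mem_Icc.2 (by omega))).mono
                (R.filt_mono (Or.inr ⟨rfl, by omega⟩)) le_rfl
          refine le_trans (le_of_eq ?_) ((R.lintegral_mul_exp_le hk hh hG
            (u := fun _ => u) measurable_const (f := f k h) hf' (hab k hk h hh)).trans
            (ih2 (by omega)))
          refine lintegral_congr fun ω => ?_
          rw [← ENNReal.ofReal_mul (Real.exp_pos _).le, ← Real.exp_add,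
            Finset.sum_Ico_succ_top hh1, ← add_assoc]
          rfl
      simpa only [Finset.sum_Ico_succ_top hk1] using inner_key (X.H + 1) (by omega) le_rfl
  exact key (K + 1) (by omega) le_rfl

/-- Azuma's inequality for the steps of all episodes. -/
lemma Run.exists_event_sum_le [IsProbabilityMeasure Pr] (R : Run X Pr K lam β)
    {f : ℕ → ℕ → Ω → S → ℝ}
    (hf : ∀ k ∈ Finset.Icc 1 K, ∀ h ∈ Finset.Icc 1 X.H,
      Measurable[(R.filt (toLex (k, 1))).prod (inferInstance : MeasurableSpace S)]
        fun p : Ω × S => f k h p.1 p.2) {a b : ℝ}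
    (hab : ∀ k ∈ Finset.Icc 1 K, ∀ h ∈ Finset.Icc 1 X.H, ∀ ω s, f k h ω s ∈ Set.Icc a b) (u : ℝ)
    (x : ℝ) :
    ∃ E : Set Ω, MeasurableSet E ∧ Pr Eᶜ ≤ ENNReal.ofReal (Real.exp (-x)) ∧
      ∀ ω ∈ E, u * ∑ k ∈ Finset.Icc 1 K, ∑ h ∈ Finset.Icc 1 X.H,
        (∫ s, f k h ω s ∂(X.P h ((R.trace ω).state k h, (R.trace ω).action k h)) -
          f k h ω ((R.trace ω).state k (h + 1))) ≤
        x + K * X.H * (u ^ 2 * ((b - a) ^ 2 / 8)) := by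
  -- The sign is reversed because `increment` is value minus mean, while the sum to be bounded is
  -- mean minus value.
  have hint := R.lintegral_exp_sum_increment_le hf hab (-u)
  have hIco : ∀ N : ℕ, Finset.Ico 1 (N + 1) = Finset.Icc 1 N := by
    intro N; ext; simp only [Finset.mem_Ico, Finset.mem_Icc]; omega
  rw [hIco, hIco] at hint
  set g : Ω → ℝ := fun ω => ∑ k ∈ Finset.Icc 1 K, ∑ h ∈ Finset.Icc 1 X.H,
      R.increment f (-u) ((b - a) ^ 2 / 8) k h ω with hg
  have hgm : Measurable g := Finset.measurable_fun_sum _ fun k hk =>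
    Finset.measurable_fun_sum _ fun h hh =>
      (R.measurable_increment hk hh (hf k hk h hh) _ _).mono (R.filt.le _) le_rfl
  refine ⟨{ω | x < g ω}ᶜ, (measurableSet_lt measurable_const hgm).compl, ?_, ?_⟩
  · rw [compl_compl, ← zero_sub]
    exact measure_lt_le_of_lintegral_exp_le hgm (by simpa using hint) x
  · intro ω hω
    simp only [Set.mem_compl_iff, Set.mem_ofPred_eq, not_lt, hg, Run.increment,
      Finset.sum_sub_distrib, Finset.sum_const, Nat.card_Icc, nsmul_eq_mul,
      ← Finset.mul_sum, Nat.add_sub_cancel, even_two, Even.neg_pow] at hω ⊢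
    linarith

end Azuma

end UCBlvd
namespace UCBlvd

/-! ### Measurability of determinants, inverses and random indices -/

section Measurability

lemma measurable_det {α ι : Type*} {mα : MeasurableSpace α} [Fintype ι] [DecidableEq ι]
    {B : α → Matrix ι ι ℝ} (hB : ∀ i j, Measurable fun x => B x i j) :
    Measurable fun x => (B x).det := by
  simp only [Matrix.det_apply]
  exact Finset.measurable_fun_sum _ fun σ _ =>
    (Finset.measurable_fun_prod _ fun i _ => hB _ _).const_smul _

lemma measurable_inv_apply {α ι : Type*} {mα : MeasurableSpace α} [Fintype ι] [DecidableEq ι]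
    {B : α → Matrix ι ι ℝ} (hB : ∀ i j, Measurable fun x => B x i j) (i j : ι) :
    Measurable fun x => (B x)⁻¹ i j := by
  -- The inverse is `(det B)⁻¹` times the adjugate, whose entries are determinants; with `0⁻¹ = 0`
  -- this includes singular matrices.
  simp only [Matrix.inv_def, Ring.inverse_eq_inv', Matrix.smul_apply, Matrix.adjugate_apply,
    smul_eq_mul]
  refine (measurable_det hB).inv.mul (measurable_det fun k l => ?_)
  by_cases hk : k = j
  · subst hk; simp
  · simpa [Matrix.updateRow_ne hk] using hB k l

lemma measurable_wnorm {α : Type*} {mα : MeasurableSpace α} {d : ℕ}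
    {B : α → Matrix (Fin d) (Fin d) ℝ} (hB : ∀ i j, Measurable fun x => B x i j)
    {v : α → Vec d} (hv : Measurable v) : Measurable fun x => wnorm (B x) (v x) := by
  have hv' : ∀ i, Measurable fun x => v x i := fun i =>
    (EuclideanSpace.proj (𝕜 := ℝ) i).continuous.measurable.comp hv
  simp only [wnorm_eq, dotProduct, Matrix.mulVec]
  exact (Finset.measurable_fun_sum _ fun i _ => (hv' i).mul
    (Finset.measurable_fun_sum _ fun j _ => (hB i j).mul (hv' j))).sqrt

/-- Meant for the random episode index `k̃`: only the `g m` with `m` among its possible values are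
known to be measurable. -/
lemma measurable_comp_of_mem_finset {α : Type*} {mα : MeasurableSpace α} {N : α → ℕ}
    (hN : Measurable N) {s : Finset ℕ} (hNs : ∀ x, N x ∈ s) {g : ℕ → α → ℝ}
    (hg : ∀ m ∈ s, Measurable (g m)) : Measurable fun x => g (N x) x := by
  have h : (fun x => g (N x) x) =
      fun x => ∑ m ∈ s, if N x = m then g m x else 0 := by
    funext x
    simp [hNs x]
  rw [h]
  exact Finset.measurable_fun_sum _ fun m hm =>
    Measurable.ite (hN (measurableSet_singleton m)) (hg m hm) measurable_const

lemma measurableSet_exists_lt {α : Type*} {mα : MeasurableSpace α} {s : Finset ℕ} (c : ℝ)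
    {f : ℕ → α → ℝ} (hf : ∀ m ∈ s, Measurable (f m)) :
    MeasurableSet {x | ∃ m ∈ s, c < f m x} := by
  have : {x | ∃ m ∈ s, c < f m x} = ⋃ m ∈ s, {x | c < f m x} := by ext; simp
  rw [this]
  exact Finset.measurableSet_biUnion _ fun m hm => measurableSet_lt measurable_const (hf m hm)

lemma measurable_comp_finite {α A β : Type*} {mα : MeasurableSpace α} [MeasurableSpace A]
    [DiscreteMeasurableSpace A] [Finite A] [MeasurableSpace β] {g : α → A → β}
    (hg : ∀ a, Measurable fun x => g x a) {N : α → A} (hN : Measurable N) :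
    Measurable fun x => g x (N x) := by
  have h : Measurable fun p : α × A => g p.1 p.2 := measurable_from_prod_countable_left hg
  exact h.comp (measurable_id.prodMk hN)

end Measurability

/-! ### Bounds and measurability of value functions -/

section Values

variable {S A W Ω' : Type*} [MeasurableSpace S] [MeasurableSpace A]

lemma integral_mem_Icc {μ : Measure S} [IsProbabilityMeasure μ] {f : S → ℝ} {c : ℝ}
    (hf : ∀ s, f s ∈ Set.Icc (0 : ℝ) c) : ∫ s, f s ∂μ ∈ Set.Icc (0 : ℝ) c := by
  refine ⟨integral_nonneg fun s => (hf s).1, ?_⟩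
  have h := norm_integral_le_of_norm_le_const (μ := μ) (f := f) (C := c) (ae_of_all _ fun s => by
    rw [Real.norm_eq_abs, abs_of_nonneg (hf s).1]; exact (hf s).2)
  rw [probReal_univ, mul_one] at h
  exact (le_abs_self _).trans h

lemma ContextualMDP.valueAux_mem_Icc (M : ContextualMDP S A W) (π : ℕ → S → W → A) (w : W)
    (j h : ℕ) (s : S) (h1 : 1 ≤ h) (hj : h + j ≤ M.H + 1) :
    M.valueAux π j h s w ∈ Set.Icc (0 : ℝ) j := by
  induction j generalizing h s with
  | zero => simp [ContextualMDP.valueAux]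
  | succ j ih =>
    have := M.isMarkov h
    have hr := M.r_mem h (Finset.mem_Icc.2 (by omega)) s (π h s w) w
    have hv := fun s' => ih (h + 1) s' (by omega) (by omega)
    have hi := integral_mem_Icc (μ := M.P h (s, π h s w)) hv
    rw [ContextualMDP.valueAux, Nat.cast_add, Nat.cast_one]
    exact ⟨add_nonneg hr.1 hi.1, by linarith [hr.2, hi.2]⟩

variable [MeasurableSpace W] [MeasurableSpace Ω'] {d d' n : ℕ} {X : Problem S A W d d' n}

lemma measurable_inner_const {α : Type*} {mα : MeasurableSpace α} {m : ℕ} (v : Vec m) {x : α → Vec m}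
    (hx : Measurable x) : Measurable fun a => (inner ℝ v (x a) : ℝ) :=
  (measurable_const.inner measurable_id : Measurable fun y : Vec m => (inner ℝ v y : ℝ)).comp hx

lemma Problem.IsLinear.measurable_ψ_comp (hX : X.IsLinear) (a : A) {c : Ω' → W}
    (hc : Measurable c) : Measurable fun p : Ω' × S => X.ψ p.2 a (c p.1) :=
  (hX.ψ_meas a).comp (measurable_snd.prodMk (hc.comp measurable_fst))

lemma Problem.IsLinear.measurable_r_comp (hX : X.IsLinear) {h : ℕ} (hh : h ∈ Finset.Icc 1 X.H)
    (a : A) {c : Ω' → W} (hc : Measurable c) :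
    Measurable fun p : Ω' × S => X.r h p.2 a (c p.1) := by
  obtain ⟨η, -, -, -, -, hr⟩ := hX.linear h hh
  simp only [hr]
  exact measurable_inner_const η (hX.measurable_ψ_comp a hc)

lemma Problem.IsLinear.measurable_valueAux [DiscreteMeasurableSpace A] [Finite A]
    (hX : X.IsLinear) {c : Ω' → W} (hc : Measurable c)
    {π : Ω' → ℕ → S → W → A}
    (hπ : ∀ h ∈ Finset.Icc 1 X.H, Measurable fun p : Ω' × S => π p.1 h p.2 (c p.1))
    (j h : ℕ) (h1 : 1 ≤ h) (hj : h + j ≤ X.H + 1) :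
    Measurable fun p : Ω' × S => X.valueAux (π p.1) j h p.2 (c p.1) := by
  induction j generalizing h with
  | zero => exact measurable_const
  | succ j ih =>
    have hh : h ∈ Finset.Icc 1 X.H := Finset.mem_Icc.2 (by omega)
    have := X.isMarkov h
    simp only [ContextualMDP.valueAux]
    refine Measurable.add ?_ ?_
    · exact measurable_comp_finite (g := fun (p : Ω' × S) a => X.r h p.2 a (c p.1))
        (fun a => hX.measurable_r_comp hh a hc) (hπ h hh)
    · let κ : Kernel (Ω' × S) S :=
        (X.P h).comap (fun p => (p.2, π p.1 h p.2 (c p.1))) (measurable_snd.prodMk (hπ h hh))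
      have h2 := ih (h + 1) (by omega) (by omega)
      have h3 : Measurable fun q : (Ω' × S) × S =>
          X.valueAux (π q.1.1) j (h + 1) q.2 (c q.1.1) :=
        h2.comp ((measurable_fst.comp measurable_fst).prodMk measurable_snd)
      exact (StronglyMeasurable.integral_kernel_prod_right (κ := κ)
        (f := fun (p : Ω' × S) s' => X.valueAux (π p.1) j (h + 1) s' (c p.1))
        h3.stronglyMeasurable).measurable

end Values

/-! ### Predictability of the optimistic values and of the played policy's values -/

section OptimisticValues

variable {S A W Ω : Type*} [mS : MeasurableSpace S] [MeasurableSpace A] [DiscreteMeasurableSpace A]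
    [Finite A] [MeasurableSpace W]
    [mΩ : MeasurableSpace Ω] {d d' n : ℕ} {X : Problem S A W d d' n} {Pr : Measure Ω}
    {K : ℕ} {lam β : ℝ}

lemma Run.measurable_gram (hX : X.IsLinear) (R : Run X Pr K lam β) {k k' h : ℕ} (hk : k ≤ k')
    (hk' : k' ≤ K) (hh : h ∈ Finset.Icc 1 X.H) (i j : Fin d) :
    Measurable[R.filt (toLex (k', 1))] fun ω => gram X lam (R.trace ω) k h i j := by
  simp only [gram, Matrix.add_apply, Matrix.sum_apply, Matrix.vecMulVec_apply]
  refine Measurable.const_add (Finset.measurable_fun_sum _ fun τ hτ => ?_) _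
  rw [Finset.mem_Ico] at hτ
  have h1 := (R.measurable_φ hX (Finset.mem_Icc.2 (by omega : 1 ≤ τ ∧ τ ≤ K)) hh).mono
    (R.filt_mono (Or.inl (by omega : τ < k')) (h' := 1)) le_rfl
  have h2 : ∀ i, Measurable[R.filt (toLex (k', 1))] fun ω =>
      X.φ ((R.trace ω).state τ h) ((R.trace ω).action τ h) i := fun i =>
    (EuclideanSpace.proj (𝕜 := ℝ) i).continuous.measurable.comp h1
  exact (h2 i).mul (h2 j)

/-- The tests up to episode `k` involve only Gram matrices built from earlier episodes, so `k̃` is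
known when episode `k` starts. -/
lemma Run.measurable_kTilde (hX : X.IsLinear) (R : Run X Pr K lam β) {k : ℕ}
    (hk : k ∈ Finset.Icc 1 K) :
    Measurable[R.filt (toLex (k, 1))] fun ω => kTilde X lam (R.trace ω) k := by
  obtain ⟨hk1, hkK⟩ := Finset.mem_Icc.1 hk
  clear hk
  induction k, hk1 using Nat.le_induction with
  | base =>
    have : (fun ω => kTilde X lam (R.trace ω) 1) = fun _ => 1 := by
      funext ω
      exact le_antisymm (kTilde_le le_rfl) (one_le_kTilde 1)
    rw [this]
    exact measurable_const
  | succ k hk1 ih =>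
    have hm := (ih (by omega)).mono (R.filt_mono (Or.inl (by omega : k < k + 1)) (h' := 1)) le_rfl
    have hset : MeasurableSet[R.filt (toLex (k + 1, 1))]
        {ω | DetTest X lam (R.trace ω) (k + 1) (kTilde X lam (R.trace ω) k)} := by
      refine measurableSet_exists_lt _ fun h hh => ?_
      refine Measurable.div (measurable_det fun i j => R.measurable_gram hX le_rfl hkK hh i j) ?_
      exact measurable_comp_of_mem_finset hm (s := Finset.Icc 1 k)
        (g := fun m ω => (gram X lam (R.trace ω) m h).det)
        (fun ω => Finset.mem_Icc.2 ⟨one_le_kTilde k, kTilde_le hk1⟩)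
        (fun m hmk => measurable_det fun i j => R.measurable_gram hX
          (by have := Finset.mem_Icc.1 hmk; omega) hkK hh i j)
    simp only [kTilde]
    exact Measurable.ite hset measurable_const hm

lemma Run.measurable_qFun (hX : X.IsLinear) (R : Run X Pr K lam β) {k k' h : ℕ} (hk1 : 1 ≤ k)
    (hk : k ≤ k') (hk' : k' ≤ K) (h1 : 1 ≤ h) (a : A) {c : Ω → W}
    (hc : Measurable[R.filt (toLex (k', 1))] c) :
    Measurable[(R.filt (toLex (k', 1))).prod (inferInstance : MeasurableSpace S)]
      fun p : Ω × S => qFun X lam β (R.trace p.1) k h p.2 a (c p.1) := by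
  by_cases hh : h ≤ X.H
  swap
  · simp only [qFun, if_neg hh]
    exact measurable_const
  have hh' : h ∈ Finset.Icc 1 X.H := Finset.mem_Icc.2 ⟨h1, hh⟩
  simp only [qFun, if_pos hh]
  have hxi := (R.xi_meas k (Finset.mem_Icc.2 ⟨hk1, hk.trans hk'⟩) h hh').mono
    (R.filt_mono (by omega : k < k' ∨ k = k' ∧ 1 ≤ 1)) le_rfl
  have hxi' := hxi.comp (@measurable_fst Ω S (R.filt (toLex (k', 1))) mS)
  have hgram : ∀ i j, Measurable[(R.filt (toLex (k', 1))).prod (inferInstance : MeasurableSpace S)]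
      fun p : Ω × S => gram X lam (R.trace p.1) k h i j := fun i j =>
    (R.measurable_gram hX hk hk' hh' i j).comp (@measurable_fst Ω S (R.filt (toLex (k', 1))) mS)
  have hψ := @Problem.IsLinear.measurable_ψ_comp S A W Ω _ _ _ (R.filt (toLex (k', 1))) d d' n X
    hX a c hc
  have hr := @Problem.IsLinear.measurable_r_comp S A W Ω _ _ _ (R.filt (toLex (k', 1))) d d' n X
    hX h hh' a c hc
  have hw := @measurable_wnorm (Ω × S) ((R.filt (toLex (k', 1))).prod inferInstance) d _
    (@measurable_inv_apply (Ω × S) (Fin d) ((R.filt (toLex (k', 1))).prod inferInstance) _ _ _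
      hgram) (fun p => X.φ p.2 a)
    ((hX.φ_meas a).comp (@measurable_snd Ω S (R.filt (toLex (k', 1))) mS))
  exact ((hr.add (hxi'.inner hψ)).add (hw.const_mul _)).max measurable_const

lemma Run.measurable_vFun_kTilde (hX : X.IsLinear) (R : Run X Pr K lam β) {k h : ℕ}
    (hk : k ∈ Finset.Icc 1 K) (h1 : 1 ≤ h) {c : Ω → W}
    (hc : Measurable[R.filt (toLex (k, 1))] c) :
    Measurable[(R.filt (toLex (k, 1))).prod (inferInstance : MeasurableSpace S)]
      fun p : Ω × S => vFun X lam β (R.trace p.1) (kTilde X lam (R.trace p.1) k) h p.2 (c p.1) := by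
  obtain ⟨hk1, hkK⟩ := Finset.mem_Icc.1 hk
  refine @measurable_comp_of_mem_finset (Ω × S) ((R.filt (toLex (k, 1))).prod inferInstance)
    (fun p => kTilde X lam (R.trace p.1) k)
    ((R.measurable_kTilde hX hk).comp (@measurable_fst Ω S (R.filt (toLex (k, 1))) mS))
    (Finset.Icc 1 k) (fun p => Finset.mem_Icc.2 ⟨one_le_kTilde k, kTilde_le hk1⟩)
    (fun m p => vFun X lam β (R.trace p.1) m h p.2 (c p.1)) fun m hm => ?_
  obtain ⟨hm1, hmk⟩ := Finset.mem_Icc.1 hm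
  simp only [vFun]
  exact (Measurable.iSup fun a => R.measurable_qFun hX hm1 hmk hkK h1 a hc).min measurable_const

lemma Run.measurable_value (hX : X.IsLinear) (R : Run X Pr K lam β) {k j h : ℕ}
    (hk : k ∈ Finset.Icc 1 K) (h1 : 1 ≤ h) (hj : h + j ≤ X.H + 1) :
    Measurable[(R.filt (toLex (k, 1))).prod (inferInstance : MeasurableSpace S)]
      fun p : Ω × S => X.valueAux (fun h => R.policy k h p.1) j h p.2 (R.context k p.1) := by
  refine @Problem.IsLinear.measurable_valueAux S A W Ω _ _ _ (R.filt (toLex (k, 1))) d d' n X _ _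
    hX (R.context k) (R.context_meas k hk) (fun ω h => R.policy k h ω) (fun i hi => ?_) j h h1 hj
  have hfst := @measurable_fst Ω S (R.filt (toLex (k, 1))) mS
  have hsnd := @measurable_snd Ω S (R.filt (toLex (k, 1))) mS
  exact (R.policy_meas k hk i hi).comp
    (hfst.prodMk (hsnd.prodMk ((R.context_meas k hk).comp hfst)))

end OptimisticValues

end UCBlvd
namespace UCBlvd

/-! ### Expectations in a linear MDP -/

section LinearMDP

variable {S A W : Type*} [MeasurableSpace S] [MeasurableSpace A] [MeasurableSpace W]
  {d d' n : ℕ} {X : Problem S A W d d' n} {h : ℕ}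

/-- In a linear MDP the expectation of a bounded function is linear in the features. -/
lemma Problem.IsLinear.exists_integral_eq_inner (hX : X.IsLinear) (hh : h ∈ Finset.Icc 1 X.H)
    {V : S → ℝ} (hV : Measurable V) {c : ℝ} (hc : 0 ≤ c) (hVc : ∀ s, V s ∈ Set.Icc (0 : ℝ) c) :
    ∃ θ : Vec d, ‖θ‖ ≤ c * Real.sqrt d ∧
      ∀ s a, ∫ s', V s' ∂(X.P h (s, a)) = inner ℝ θ (X.φ s a) := by
  obtain ⟨-, μ, -, hμ, hP, -⟩ := hX.linear h hh
  have := X.isMarkov h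
  let p : Fin d → Measure S := fun i => (μ i).toJordanDecomposition.posPart
  let q : Fin d → Measure S := fun i => (μ i).toJordanDecomposition.negPart
  have hp : ∀ i, IsFiniteMeasure (p i) := fun i =>
    (μ i).toJordanDecomposition.posPart_finite
  have hq : ∀ i, IsFiniteMeasure (q i) := fun i =>
    (μ i).toJordanDecomposition.negPart_finite
  have hint : ∀ (m : Measure S) [IsFiniteMeasure m], Integrable V m := fun m _ =>
    Integrable.of_mem_Icc 0 c hV.aemeasurable (ae_of_all _ hVc)
  have hμapp : ∀ i B, MeasurableSet B → μ i B = (p i).real B - (q i).real B := by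
    intro i B hB
    conv_lhs => rw [← SignedMeasure.toSignedMeasure_toJordanDecomposition (μ i)]
    rw [JordanDecomposition.toSignedMeasure, sub_apply,
      Measure.toSignedMeasure_apply_measurable hB, Measure.toSignedMeasure_apply_measurable hB]
  refine ⟨WithLp.toLp 2 fun i => ∫ s, V s ∂(p i) - ∫ s, V s ∂(q i), ?_, fun s a => ?_⟩
  · have hb : ∀ (m : Measure S) [IsFiniteMeasure m], 0 ≤ ∫ s, V s ∂m ∧
        ∫ s, V s ∂m ≤ c * m.real Set.univ := by
      intro m _
      refine ⟨integral_nonneg fun s => (hVc s).1, ?_⟩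
      have := norm_integral_le_of_norm_le_const (μ := m) (f := V) (C := c) (ae_of_all _ fun s => by
        rw [Real.norm_eq_abs, abs_of_nonneg (hVc s).1]; exact (hVc s).2)
      exact (le_abs_self _).trans this
    refine le_trans ?_ (mul_le_mul_of_nonneg_left hμ hc)
    rw [EuclideanSpace.norm_eq, EuclideanSpace.norm_eq, ← Real.sqrt_sq hc,
      ← Real.sqrt_mul (sq_nonneg c), Finset.mul_sum]
    refine Real.sqrt_le_sqrt (Finset.sum_le_sum fun i _ => ?_)
    rw [← mul_pow, Real.norm_eq_abs, Real.norm_eq_abs]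
    have htv : (μ i).totalVariation.real Set.univ =
        (p i).real Set.univ + (q i).real Set.univ := by
      rw [SignedMeasure.totalVariation, measureReal_add_apply]
    have h1 := hb (p i)
    have h2 := hb (q i)
    refine pow_le_pow_left₀ (abs_nonneg _) ?_ 2
    simp only [htv]
    rw [abs_of_nonneg (add_nonneg measureReal_nonneg measureReal_nonneg), abs_le]
    constructor <;> nlinarith
  · let x : Fin d → NNReal := fun i => (X.φ s a i).toNNReal
    let y : Fin d → NNReal := fun i => (-X.φ s a i).toNNReal
    have hxy : ∀ i, X.φ s a i = (x i : ℝ) - y i := fun i => by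
      simp only [x, y, Real.coe_toNNReal']
      rcases le_total 0 (X.φ s a i) with h0 | h0
      · rw [max_eq_left h0, max_eq_right (by linarith)]; ring
      · rw [max_eq_right h0, max_eq_left (by linarith)]; ring
    have hsum : ∀ (m : Fin d → Measure S) (B : Set S) [∀ i, IsFiniteMeasure (m i)],
        (∑ i, m i).real B = ∑ i, (m i).real B := fun m B _ => by
      simp only [Measure.real, Measure.finsetSum_apply]
      exact ENNReal.toReal_sum fun i _ => measure_ne_top _ _
    -- With all negative parts moved to the other side, the kernel identity becomes one between
    -- finite positive measures and can be integrated term by term.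
    have hmeas : X.P h (s, a) + ∑ i, (x i • q i + y i • p i) = ∑ i, (x i • p i + y i • q i) := by
      ext B hB
      rw [← measureReal_eq_measureReal_iff, measureReal_add_apply, hP s a B hB,
        hsum, hsum, ← Finset.sum_add_distrib]
      refine Finset.sum_congr rfl fun i _ => ?_
      rw [measureReal_add_apply, measureReal_add_apply, measureReal_nnreal_smul_apply,
        measureReal_nnreal_smul_apply, measureReal_nnreal_smul_apply,
        measureReal_nnreal_smul_apply, hμapp i B hB, hxy i]
      ring
    have hi := congrArg (fun m : Measure S => ∫ s', V s' ∂m) hmeas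
    rw [integral_add_measure (hint _) (hint _), integral_finsetSum_measure fun i _ => hint _,
      integral_finsetSum_measure fun i _ => hint _] at hi
    simp only [integral_add_measure (hint _) (hint _), integral_smul_nnreal_measure] at hi
    rw [real_inner_eq, dotProduct, ← add_left_inj, hi, ← Finset.sum_add_distrib]
    refine Finset.sum_congr rfl fun i _ => ?_
    simp only [NNReal.smul_def, smul_eq_mul]
    rw [hxy i]
    ring

lemma measurable_of_mem_functionClass [Finite A] (hX : X.IsLinear) {f : S → W → ℝ}
    (hf : f ∈ X.functionClass) (w : W) : Measurable fun s => f s w := by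
  obtain ⟨ν, Λ, b, -, hf⟩ := hf
  rw [funext fun s => hf s w]
  refine (Measurable.iSup fun a => ?_).min measurable_const
  have h0 : Measurable fun s => X.ψ s a w := (hX.ψ_meas a).comp measurable_prodMk_right
  have h1 : Measurable fun s => (inner ℝ ν (X.ψ s a w) : ℝ) := measurable_inner_const ν h0
  have h2 : Measurable fun s => wnorm Λ⁻¹ (X.φ s a) :=
    measurable_wnorm (B := fun _ => Λ⁻¹) (fun i j => measurable_const (a := Λ⁻¹ i j))
      (hX.φ_meas a)
  exact (h1.add (h2.const_mul b)).max measurable_const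

end LinearMDP

/-! ### Accuracy of planned parameters, and optimism -/

section Planning

variable {S A W : Type*} [MeasurableSpace S] [MeasurableSpace A]
  {d d' n : ℕ} {X : Problem S A W d d' n}
    {lam β : ℝ} {t : Trace S A d'} {k h : ℕ}

lemma qFun_nonneg (s : S) (a : A) (w : W) : 0 ≤ qFun X lam β t k h s a w := by
  rw [qFun]; split_ifs
  · exact le_max_right _ _
  · exact le_rfl

lemma vFun_mem_Icc (s : S) (w : W) : vFun X lam β t k h s w ∈ Set.Icc (0 : ℝ) X.H :=
  ⟨le_min (Real.iSup_nonneg fun a => qFun_nonneg s a w) (Nat.cast_nonneg _), min_le_right _ _⟩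

/-- The regularised least-squares error in terms of the noise. -/
lemma wnorm_sub_thetaTilde_le (hk : 1 ≤ k) (w : W) {θ : Vec d}
    (hθ : ∀ s a, ∫ s', vFun X 1 β t k (h + 1) s' w ∂(X.P h (s, a)) = inner ℝ θ (X.φ s a)) :
    wnorm (gram X 1 t k h) (θ - thetaTilde X 1 β t k h w) ≤ ‖θ‖ +
      wnorm (gram X 1 t k h)⁻¹ (∑ τ ∈ Finset.Ico 1 k,
        noise X t (fun s => vFun X 1 β t k (h + 1) s w) τ h •
          X.φ (t.state τ h) (t.action τ h)) := by
  have hP := gram_posDef (X := X) (t := t) one_pos k h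
  set N := ∑ τ ∈ Finset.Ico 1 k, noise X t (fun s => vFun X 1 β t k (h + 1) s w) τ h •
          X.φ (t.state τ h) (t.action τ h) with hN
  have hdiff : θ - thetaTilde X 1 β t k h w =
      Matrix.toEuclideanLin (gram X 1 t k h)⁻¹ (θ + -N) := by
    -- This is `Λθ = θ + Σ ⟨θ, φ⟩ φ`. The regression targets are `⟨θ, φ⟩` plus noise, so the sums of
    -- `⟨θ, φ⟩ φ` cancel and `Λ⁻¹(θ - N)` remains.
    have h1 : θ = Matrix.toEuclideanLin (gram X 1 t k h)⁻¹
        (θ + ∑ τ ∈ Finset.Ico 1 k, (inner ℝ θ (X.φ (t.state τ h) (t.action τ h)) : ℝ) •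
          X.φ (t.state τ h) (t.action τ h)) := by
      have h2 : θ + ∑ τ ∈ Finset.Ico 1 k, (inner ℝ θ (X.φ (t.state τ h) (t.action τ h)) : ℝ) •
          X.φ (t.state τ h) (t.action τ h) = WithLp.toLp 2 ((gram X 1 t k h).mulVec θ.ofLp) := by
        ext i
        simp only [gram, one_smul, Matrix.add_mulVec, Matrix.one_mulVec, Matrix.sum_mulVec,
          Matrix.vecMulVec_mulVec, PiLp.add_apply, WithLp.ofLp_sum, Finset.sum_apply,
          smul_eq_mul, Pi.add_apply, real_inner_eq, WithLp.ofLp_smul,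
          Pi.smul_apply]
        congr 1
        refine Finset.sum_congr rfl fun τ _ => ?_
        simp [dotProduct_comm, mul_comm]
      rw [h2]
      ext i
      simp [inv_mulVec_mulVec hP]
    conv_lhs => rw [h1]
    rw [thetaTilde, ← map_sub]
    congr 1
    rw [add_sub_assoc, hN, ← Finset.sum_sub_distrib, ← Finset.sum_neg_distrib]
    congr 1
    refine Finset.sum_congr rfl fun τ _ => ?_
    rw [noise, hθ, sub_smul, neg_sub]
  rw [hdiff, wnorm_toEuclideanLin_inv hP]
  refine (wnorm_add_le hP.inv.posSemidef _ _).trans ?_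
  rw [wnorm_neg]
  exact add_le_add (wnorm_gram_inv_le_norm hk h θ) le_rfl

/-- The parameters of episode `k` represent the expected next values up to the bonus. -/
def IsAccurate (X : Problem S A W d d' n) (lam β : ℝ) (t : Trace S A d') (k : ℕ) : Prop :=
  ∀ h ∈ Finset.Icc 1 X.H, ∀ s a w,
    |inner ℝ (t.xi k h) (X.ψ s a w) - ∫ s', vFun X lam β t k (h + 1) s' w ∂(X.P h (s, a))| ≤
      2 * X.L * β * wnorm (gram X lam t k h)⁻¹ (X.φ s a)

variable [Nonempty A]

/-- Half of the `4` is the bonus inside `Q`, the other half the accuracy error. -/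
lemma IsAccurate.vFun_le (hacc : IsAccurate X lam β t k) (hLβ : 0 ≤ X.L * β)
    (hh : h ∈ Finset.Icc 1 X.H) {s : S} {a : A} {w : W}
    (ha : ∀ b, qFun X lam β t k h s b w ≤ qFun X lam β t k h s a w) :
    vFun X lam β t k h s w ≤ X.r h s a w +
      ∫ s', vFun X lam β t k (h + 1) s' w ∂(X.P h (s, a)) +
        4 * (X.L * β) * wnorm (gram X lam t k h)⁻¹ (X.φ s a) := by
  have := X.isMarkov h
  refine (min_le_left _ _).trans ((ciSup_le ha).trans ?_)
  have h1 := (abs_le.1 (hacc h hh s a w)).2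
  have h2 := (X.r_mem h hh s a w).1
  have h3 : 0 ≤ ∫ s', vFun X lam β t k (h + 1) s' w ∂(X.P h (s, a)) :=
    integral_nonneg fun s' => (vFun_mem_Icc s' w).1
  have h4 := wnorm_nonneg (gram X lam t k h)⁻¹ (X.φ s a)
  have h5 := mul_nonneg hLβ h4
  rw [qFun, if_pos (Finset.mem_Icc.1 hh).2]
  exact max_le (by linarith) (by linarith)

lemma vFun_of_lt (hh : X.H < h) (s : S) (w : W) : vFun X lam β t k h s w = 0 := by
  simp [vFun, qFun, not_le.2 hh]

variable [MeasurableSpace W]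

/-- The reward is linear in `ψ`, so its parameter `η` is absorbed into `ν`. Past the horizon the
zero function is the member with `ν = 0`, `b = 0`. -/
lemma vFun_mem_functionClass (hX : X.IsLinear) (hlam : 0 < lam) (h1 : 1 ≤ h) :
    vFun X lam β t k h ∈ X.functionClass := by
  by_cases hh : h ≤ X.H
  · obtain ⟨η, -, -, -, -, hr⟩ := hX.linear h (Finset.mem_Icc.2 ⟨h1, hh⟩)
    refine ⟨η + t.xi k h, gram X lam t k h, 2 * X.L * β, gram_posDef hlam k h, fun s w => ?_⟩
    simp only [vFun, qFun, if_pos hh, hr, inner_add_left]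
  · refine ⟨0, 1, 0, Matrix.PosDef.one, fun s w => ?_⟩
    rw [vFun_of_lt (not_le.1 hh)]
    simp

/-- The parameter of a planned step represents the expected next value up to the bonus. -/
lemma abs_inner_xi_sub_integral_le (hX : X.Assumptions) (hlam : 0 < lam) (hβ : 0 ≤ β)
    (hh : h ∈ Finset.Icc 1 X.H) (hplan : IsPlanned X lam β t k h) (θ : Fin n → Vec d)
    (hθ : ∀ j s a, ∫ s', vFun X lam β t k (h + 1) s' (X.wRep j) ∂(X.P h (s, a)) =
      inner ℝ (θ j) (X.φ s a))
    (hθβ : ∀ j, wnorm (gram X lam t k h) (θ j - thetaTilde X lam β t k h (X.wRep j)) ≤ β)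
    (s : S) (a : A) (w : W) :
    |inner ℝ (t.xi k h) (X.ψ s a w) - ∫ s', vFun X lam β t k (h + 1) s' w ∂(X.P h (s, a))| ≤
      2 * X.L * β * wnorm (gram X lam t k h)⁻¹ (X.φ s a) := by
  have hP := gram_posDef (X := X) (t := t) hlam k h
  obtain ⟨ξ, hξ, hξint⟩ := hX.complete _
    (vFun_mem_functionClass (β := β) (t := t) (k := k) hX.linear hlam (by omega : 1 ≤ h + 1)) h hh
  obtain ⟨θ', hfeas, hmin⟩ := hplan
  have hobj0 : planObjective X (ξ, θ) = 0 := by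
    refine Finset.sum_eq_zero fun j _ => Finset.sum_eq_zero fun p _ => ?_
    simp only
    rw [← hθ j p.1 p.2, ← hξint p.1 p.2, sub_self]
    norm_num
  have hobj : planObjective X (t.xi k h, θ') = 0 := by
    refine le_antisymm ?_ (Finset.sum_nonneg fun j _ => Finset.sum_nonneg fun p _ => sq_nonneg _)
    rw [← hobj0]
    exact hmin ⟨hθβ, hξ⟩
  have hD : ∀ j, ∀ p ∈ X.D j, (inner ℝ (θ' j) (X.φ p.1 p.2) : ℝ) =
      inner ℝ (t.xi k h) (X.ψ p.1 p.2 (X.wRep j)) := by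
    intro j p hp
    have h1 := (Finset.sum_eq_zero_iff_of_nonneg fun j _ =>
      Finset.sum_nonneg fun p _ => sq_nonneg _).1 hobj j (Finset.mem_univ j)
    have h2 := (Finset.sum_eq_zero_iff_of_nonneg fun p _ => sq_nonneg _).1 h1 p hp
    exact sub_eq_zero.1 (pow_eq_zero_iff two_ne_zero |>.1 h2)
  have hall : ∀ j s a, (inner ℝ (θ' j) (X.φ s a) : ℝ) =
      inner ℝ (t.xi k h) (X.ψ s a (X.wRep j)) := by
    intro j s a
    -- A linear functional of the concatenated features that vanishes on `D j` vanishes on their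
    -- span, hence at every pair.
    let ℓ : (Vec d × Vec d') →ₗ[ℝ] ℝ :=
      (innerₛₗ ℝ (θ' j)).comp (LinearMap.fst ℝ _ _) -
        (innerₛₗ ℝ (t.xi k h)).comp (LinearMap.snd ℝ _ _)
    have hle : Submodule.span ℝ ((fun p : S × A => (X.φ p.1 p.2, X.ψ p.1 p.2 (X.wRep j))) ''
        (X.D j : Set (S × A))) ≤ LinearMap.ker ℓ := by
      rw [Submodule.span_le]
      rintro _ ⟨p, hp, rfl⟩
      simpa [ℓ, sub_eq_zero] using hD j p hp
    have := hle ((hX.planningSets j).2 s a)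
    simpa [ℓ, sub_eq_zero] using this
  obtain ⟨c, hc, hcL⟩ := hX.span.2 s a w
  -- Through `ξ`, one vector for all contexts, the expected value is also linear in `ψ`; the error
  -- thus expands over the representative contexts.
  have hsplit : inner ℝ (t.xi k h) (X.ψ s a w) -
      ∫ s', vFun X lam β t k (h + 1) s' w ∂(X.P h (s, a)) =
        ∑ j, c j * inner ℝ (θ' j - θ j) (X.φ s a) := by
    rw [hξint s a w, hc, inner_sum, inner_sum, ← Finset.sum_sub_distrib]
    refine Finset.sum_congr rfl fun j _ => ?_
    rw [inner_smul_right, inner_smul_right, ← hξint s a (X.wRep j), hθ j s a, ← hall j s a,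
      inner_sub_left, mul_sub]
  rw [hsplit]
  have hw0 := wnorm_nonneg (gram X lam t k h)⁻¹ (X.φ s a)
  calc |∑ j, c j * inner ℝ (θ' j - θ j) (X.φ s a)|
      ≤ ∑ j, |c j| * (2 * β * wnorm (gram X lam t k h)⁻¹ (X.φ s a)) := by
        refine (Finset.abs_sum_le_sum_abs _ _).trans (Finset.sum_le_sum fun j _ => ?_)
        rw [abs_mul]
        refine mul_le_mul_of_nonneg_left ((abs_inner_le_wnorm_mul_wnorm_inv hP _ _).trans
          (mul_le_mul_of_nonneg_right ?_ hw0)) (abs_nonneg _)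
        have h1 := wnorm_add_le hP.posSemidef
          (θ' j - thetaTilde X lam β t k h (X.wRep j)) (-(θ j - thetaTilde X lam β t k h (X.wRep j)))
        rw [wnorm_neg, show θ' j - thetaTilde X lam β t k h (X.wRep j) +
          -(θ j - thetaTilde X lam β t k h (X.wRep j)) = θ' j - θ j by abel] at h1
        linarith [hfeas.1 j, hθβ j]
    _ = (∑ j, |c j|) * (2 * β * wnorm (gram X lam t k h)⁻¹ (X.φ s a)) := by
        rw [Finset.sum_mul]
    _ ≤ X.L * (2 * β * wnorm (gram X lam t k h)⁻¹ (X.φ s a)) :=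
        mul_le_mul_of_nonneg_right hcL (by positivity)
    _ = _ := by ring

variable [Finite A]

lemma measurable_vFun (hX : X.IsLinear) (hlam : 0 < lam) (h1 : 1 ≤ h) (w : W) :
    Measurable fun s => vFun X lam β t k h s w :=
  measurable_of_mem_functionClass hX (vFun_mem_functionClass hX hlam h1) w

variable [DiscreteMeasurableSpace A]

/-- Optimism. -/
lemma IsAccurate.valueAux_le (hX : X.IsLinear) (hlam : 0 < lam) (hacc : IsAccurate X lam β t k)
    {π : ℕ → S → W → A} (hπ : IsPolicy π) (w : W) (j h : ℕ) (h1 : 1 ≤ h) (hj : h + j = X.H + 1)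
    (s : S) : X.valueAux π j h s w ≤ vFun X lam β t k h s w := by
  induction j generalizing h s with
  | zero => exact (vFun_mem_Icc s w).1
  | succ j ih =>
    have := X.isMarkov h
    have hh : h ∈ Finset.Icc 1 X.H := Finset.mem_Icc.2 (by omega)
    have hval := X.valueAux_mem_Icc π w (j + 1) h s h1 (by omega)
    -- Truncation at `H` is harmless: at most `H` rewards remain.
    refine le_min ?_ (hval.2.trans (by exact_mod_cast (by omega : j + 1 ≤ X.H)))
    refine le_trans ?_ (le_ciSup (Set.finite_range _).bddAbove (π h s w))
    rw [qFun, if_pos (by omega : h ≤ X.H)]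
    refine le_trans ?_ (le_max_left _ _)
    have hmeas : Measurable fun s' => X.valueAux π j (h + 1) s' w :=
      (hX.measurable_valueAux (Ω' := Unit) (c := fun _ => w) measurable_const (π := fun _ => π)
        (fun i _ => (hπ i w).comp measurable_snd) j (h + 1) (by omega) (by omega)).comp
        (measurable_prodMk_left (x := ()))
    have hle : ∫ s', X.valueAux π j (h + 1) s' w ∂(X.P h (s, π h s w)) ≤
        ∫ s', vFun X lam β t k (h + 1) s' w ∂(X.P h (s, π h s w)) := by
      refine integral_mono
        (Integrable.of_mem_Icc 0 j hmeas.aemeasurable (ae_of_all _ fun s' =>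
          X.valueAux_mem_Icc π w j (h + 1) s' (by omega) (by omega)))
        (Integrable.of_mem_Icc 0 X.H (measurable_vFun hX hlam (by omega) w).aemeasurable
          (ae_of_all _ fun s' => vFun_mem_Icc s' w)) fun s' => ?_
      exact ih (h + 1) (by omega) (by omega) s'
    rw [ContextualMDP.valueAux]
    have := (abs_le.1 (hacc h hh s (π h s w) w)).1
    linarith

lemma IsAccurate.optValue_le (hX : X.IsLinear) (hlam : 0 < lam) (hacc : IsAccurate X lam β t k)
    (s : S) (w : W) : X.optValue 1 s w ≤ vFun X lam β t k 1 s w := by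
  have : Nonempty {π : ℕ → S → W → A // IsPolicy π} :=
    ⟨⟨fun _ _ _ => Classical.arbitrary A, fun _ _ => measurable_const⟩⟩
  refine ciSup_le fun π => ?_
  exact hacc.valueAux_le hX hlam π.2 w _ 1 le_rfl (by omega) s

end Planning

end UCBlvd
namespace UCBlvd

/-! ### Finite grids in a box -/

section Grid

/-- The integer points of the box `[-R m, R m]^ι`. -/
noncomputable def intBox (ι : Type*) [Fintype ι] [DecidableEq ι] (R m : ℕ) : Finset (ι → ℤ) :=
  Fintype.piFinset fun _ => Finset.Icc (-((R * m : ℕ) : ℤ)) ((R * m : ℕ) : ℤ)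

lemma card_intBox (ι : Type*) [Fintype ι] [DecidableEq ι] (R m : ℕ) :
    (intBox ι R m).card = (2 * (R * m) + 1) ^ Fintype.card ι := by
  rw [intBox, Fintype.card_piFinset]
  simp only [Int.card_Icc, Finset.prod_const, Finset.card_univ]
  congr 1
  omega

lemma exists_mem_intBox {ι : Type*} [Fintype ι] [DecidableEq ι] {R m : ℕ} (hm : 0 < m)
    {x : ι → ℝ} (hx : ∀ i, |x i| ≤ R) :
    ∃ z ∈ intBox ι R m, ∀ i, |x i - z i / m| ≤ 1 / m := by
  have hm' : (0 : ℝ) < m := by exact_mod_cast hm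
  refine ⟨fun i => ⌊x i * m⌋, ?_, fun i => ?_⟩
  · simp only [intBox, Fintype.mem_piFinset, Finset.mem_Icc]
    intro i
    have h := abs_le.1 (hx i)
    constructor
    · rw [Int.le_floor]
      push_cast
      nlinarith
    · rw [← Int.cast_le (R := ℝ)]
      refine (Int.floor_le _).trans ?_
      push_cast
      nlinarith
  · have h1 := Int.floor_le (x i * m)
    have h2 := Int.lt_floor_add_one (x i * m)
    rw [show x i - (⌊x i * m⌋ : ℝ) / m = (x i * m - ⌊x i * m⌋) / m by field_simp, abs_div,
      abs_of_pos hm']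
    gcongr
    rw [abs_le]
    constructor <;> linarith

/-- The vector with coordinates `z i / m`. -/
noncomputable def scaledVec {d : ℕ} (m : ℕ) (z : Fin d → ℤ) : Vec d :=
  WithLp.toLp 2 fun i => (z i : ℝ) / m

lemma abs_coord_le_norm {d : ℕ} (x : Vec d) (i : Fin d) : |x i| ≤ ‖x‖ := by
  simpa using PiLp.norm_apply_le x i

lemma norm_sq_le_of_coord_le {d : ℕ} {x : Vec d} {ε : ℝ} (hx : ∀ i, |x i| ≤ ε) :
    ‖x‖ ^ 2 ≤ d * ε ^ 2 := by
  rw [EuclideanSpace.norm_sq_eq]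
  calc ∑ i, ‖x i‖ ^ 2 ≤ ∑ _i : Fin d, ε ^ 2 := Finset.sum_le_sum fun i _ =>
        pow_le_pow_left₀ (norm_nonneg _) (hx i) 2
    _ = d * ε ^ 2 := by simp

lemma exists_scaledVec {d R m : ℕ} (hm : 0 < m) {x : Vec d} (hx : ‖x‖ ≤ R) :
    ∃ z ∈ intBox (Fin d) R m, ‖x - scaledVec m z‖ ^ 2 ≤ d * (1 / m) ^ 2 := by
  obtain ⟨z, hz, h⟩ := exists_mem_intBox hm fun i => (abs_coord_le_norm x i).trans hx
  exact ⟨z, hz, norm_sq_le_of_coord_le fun i => by simpa [scaledVec] using h i⟩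

end Grid

/-! ### Stability of the optimistic value functions in their parameters -/

section ClippedMax

lemma abs_sqrt_sub_sqrt_le (x y : ℝ) : |Real.sqrt x - Real.sqrt y| ≤ Real.sqrt |x - y| := by
  have key : ∀ x y : ℝ, Real.sqrt x - Real.sqrt y ≤ Real.sqrt |x - y| := by
    intro x y
    rw [sub_le_iff_le_add, Real.sqrt_le_left (by positivity)]
    have h1 : y ≤ Real.sqrt y ^ 2 := by
      rcases le_total 0 y with h | h
      · rw [Real.sq_sqrt h]
      · exact h.trans (sq_nonneg _)
    have h2 := Real.sq_sqrt (abs_nonneg (x - y))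
    nlinarith [le_abs_self (x - y), mul_nonneg (Real.sqrt_nonneg |x - y|) (Real.sqrt_nonneg y)]
  rw [abs_le]
  refine ⟨?_, key x y⟩
  have := key y x
  rw [abs_sub_comm] at this
  linarith

/-- No positivity is assumed, since rounding the entries may destroy it; the square-root inequality
holds on all of `ℝ`. The two forms differ by at most `ε (∑ |x i|)² ≤ d ε`. -/
lemma abs_wnorm_sub_wnorm_le {d : ℕ} {B B' : Matrix (Fin d) (Fin d) ℝ} {ε : ℝ}
    (hB : ∀ i j, |B i j - B' i j| ≤ ε) {x : Vec d} (hx : ‖x‖ ≤ 1) :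
    |wnorm B x - wnorm B' x| ≤ Real.sqrt (d * ε) := by
  rw [wnorm_eq, wnorm_eq]
  refine (abs_sqrt_sub_sqrt_le _ _).trans (Real.sqrt_le_sqrt ?_)
  have hsum : (∑ i, |x i|) ^ 2 ≤ d := by
    have h := sq_sum_le_card_mul_sum_sq (s := Finset.univ) (f := fun i => |x i|)
    have h2 : ∑ i, |x i| ^ 2 ≤ 1 := by
      have := EuclideanSpace.norm_sq_eq x
      simp only [Real.norm_eq_abs] at this
      rw [← this]
      exact pow_le_one₀ (norm_nonneg _) hx
    simp only [Finset.card_univ, Fintype.card_fin] at h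
    nlinarith [(Nat.cast_nonneg d : (0 : ℝ) ≤ d)]
  have hε : 0 ≤ ε ∨ d = 0 := by
    rcases Nat.eq_zero_or_pos d with h | h
    · exact Or.inr h
    · exact Or.inl ((abs_nonneg _).trans (hB ⟨0, h⟩ ⟨0, h⟩))
  rw [← dotProduct_sub, ← Matrix.sub_mulVec]
  simp only [dotProduct, Matrix.mulVec, Matrix.sub_apply]
  calc |∑ i, x i * ∑ j, (B i j - B' i j) * x j|
      ≤ ∑ i, |x i| * ∑ j, ε * |x j| := by
        refine (Finset.abs_sum_le_sum_abs _ _).trans (Finset.sum_le_sum fun i _ => ?_)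
        rw [abs_mul]
        refine mul_le_mul_of_nonneg_left ((Finset.abs_sum_le_sum_abs _ _).trans
          (Finset.sum_le_sum fun j _ => ?_)) (abs_nonneg _)
        rw [abs_mul]
        exact mul_le_mul_of_nonneg_right (hB i j) (abs_nonneg _)
    _ = (∑ i, |x i|) ^ 2 * ε := by
        rw [← Finset.mul_sum, ← Finset.sum_mul]; ring
    _ ≤ d * ε := by
        rcases hε with h | rfl
        · exact mul_le_mul_of_nonneg_right hsum h
        · simp

lemma abs_iSup_sub_iSup_le {A : Type*} [Finite A] [Nonempty A] {f g : A → ℝ} {ε : ℝ}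
    (h : ∀ a, |f a - g a| ≤ ε) : |(⨆ a, f a) - ⨆ a, g a| ≤ ε := by
  have key : ∀ f g : A → ℝ, (∀ a, |f a - g a| ≤ ε) → (⨆ a, f a) - ⨆ a, g a ≤ ε := by
    intro f g h
    rw [sub_le_iff_le_add]
    refine ciSup_le fun a => ?_
    have h1 := (abs_le.1 (h a)).2
    have h2 := le_ciSup (Set.finite_range g).bddAbove a
    linarith
  rw [abs_le]
  refine ⟨?_, key f g h⟩
  have := key g f fun a => by rw [abs_sub_comm]; exact h a
  linarith

variable {S A W : Type*} [MeasurableSpace S] [MeasurableSpace A] {d d' n : ℕ}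
  {X : Problem S A W d d' n}

/-- The functions of the completeness class, with an arbitrary matrix in place of an inverse. -/
noncomputable def clippedMax (X : Problem S A W d d' n) (b : ℝ) (ν : Vec d')
    (B : Matrix (Fin d) (Fin d) ℝ) (s : S) (w : W) : ℝ :=
  min (⨆ a : A, max (inner ℝ ν (X.ψ s a w) + b * wnorm B (X.φ s a)) 0) (X.H : ℝ)

lemma clippedMax_mem_Icc (b : ℝ) (ν : Vec d') (B : Matrix (Fin d) (Fin d) ℝ) (s : S) (w : W) :
    clippedMax X b ν B s w ∈ Set.Icc (0 : ℝ) X.H :=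
  ⟨le_min (Real.iSup_nonneg fun _ => le_max_right _ _) (Nat.cast_nonneg _), min_le_right _ _⟩

lemma abs_clippedMax_sub_le [Finite A] [Nonempty A] (hφ : ∀ s a, ‖X.φ s a‖ ≤ 1)
    (hψ : ∀ s a w, ‖X.ψ s a w‖ ≤ 1) (b : ℝ) (ν ν' : Vec d') {B B' : Matrix (Fin d) (Fin d) ℝ}
    {ε : ℝ} (hB : ∀ i j, |B i j - B' i j| ≤ ε) (s : S) (w : W) :
    |clippedMax X b ν B s w - clippedMax X b ν' B' s w| ≤
      ‖ν - ν'‖ + |b| * Real.sqrt (d * ε) := by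
  refine (abs_min_sub_min_le_max _ _ _ _).trans (max_le ?_ (by rw [sub_self, abs_zero]; positivity))
  refine abs_iSup_sub_iSup_le fun a => ?_
  refine (abs_max_sub_max_le_max _ _ _ _).trans (max_le ?_ (by rw [sub_self, abs_zero]; positivity))
  rw [add_sub_add_comm, ← inner_sub_left, ← mul_sub]
  refine (abs_add_le _ _).trans (add_le_add ?_ ?_)
  · refine (abs_real_inner_le_norm _ _).trans ?_
    exact mul_le_of_le_one_right (norm_nonneg _) (hψ s a w)
  · rw [abs_mul]
    exact mul_le_mul_of_nonneg_left (abs_wnorm_sub_wnorm_le hB (hφ s a)) (abs_nonneg _)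

lemma measurable_clippedMax [MeasurableSpace W] [Finite A] (hX : X.IsLinear) (b : ℝ) (ν : Vec d')
    (B : Matrix (Fin d) (Fin d) ℝ) (w : W) : Measurable fun s => clippedMax X b ν B s w := by
  refine (Measurable.iSup fun a => ?_).min measurable_const
  have h0 : Measurable fun s => X.ψ s a w := (hX.ψ_meas a).comp measurable_prodMk_right
  have h1 : Measurable fun s => (inner ℝ ν (X.ψ s a w) : ℝ) := measurable_inner_const ν h0
  have h2 : Measurable fun s => wnorm B (X.φ s a) :=
    measurable_wnorm (B := fun _ => B) (fun i j => measurable_const (a := B i j)) (hX.φ_meas a)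
  exact (h1.add (h2.const_mul b)).max measurable_const

/-- `Λ ≥ I` bounds the diagonal of the inverse by `1`, and Cauchy–Schwarz then bounds all entries.
-/
lemma abs_gram_inv_apply_le {t : Trace S A d'} {k : ℕ} (hk : 1 ≤ k) (h : ℕ) (i j : Fin d) :
    |(gram X 1 t k h)⁻¹ i j| ≤ 1 := by
  have hP := (gram_posDef (X := X) (t := t) one_pos k h).inv.posSemidef
  have hent : ∀ i j : Fin d, (gram X 1 t k h)⁻¹ i j =
      (Pi.single i 1 : Fin d → ℝ) ⬝ᵥ (gram X 1 t k h)⁻¹.mulVec (Pi.single j 1) := by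
    intro i j; simp
  have hdiag : ∀ i : Fin d, (Pi.single i 1 : Fin d → ℝ) ⬝ᵥ
      (gram X 1 t k h)⁻¹.mulVec (Pi.single i 1) ≤ 1 := by
    intro i
    have h1 := wnorm_gram_inv_le_norm (X := X) (t := t) hk h (EuclideanSpace.single i (1 : ℝ))
    have hn : ‖EuclideanSpace.single i (1 : ℝ)‖ = 1 := by simp
    rw [hn] at h1
    have h2 := wnorm_sq hP (EuclideanSpace.single i (1 : ℝ))
    have h3 := pow_le_one₀ (n := 2) (wnorm_nonneg _ _) h1
    rw [h2] at h3
    simpa using h3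
  refine abs_le_of_sq_le_sq ?_ zero_le_one
  rw [hent i j]
  refine (dotProduct_mulVec_sq_le hP _ _).trans ?_
  have := dotProduct_mulVec_nonneg hP (Pi.single i (1 : ℝ))
  have := dotProduct_mulVec_nonneg hP (Pi.single j (1 : ℝ))
  nlinarith [hdiag i, hdiag j]

/-- This places the value functions in the parameter box covered by the net. At step `H + 1` nothing
constrains `xi`, but the value is zero; hence the conditional hypothesis. -/
lemma exists_vFun_eq_clippedMax [Nonempty A] [MeasurableSpace W] (hX : X.IsLinear)
    {β : ℝ} {t : Trace S A d'} {k h : ℕ} (hk : 1 ≤ k) (h1 : 1 ≤ h) (hH : 1 ≤ X.H)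
    (hxi : h ≤ X.H → ‖t.xi k h‖ ≤ X.H * Real.sqrt d') :
    ∃ (ν : Vec d') (B : Matrix (Fin d) (Fin d) ℝ), ‖ν‖ ≤ 2 * X.H * Real.sqrt d' ∧
      (∀ i j, |B i j| ≤ 1) ∧
      ∀ s w, vFun X 1 β t k h s w = clippedMax X (2 * X.L * β) ν B s w := by
  by_cases hh : h ≤ X.H
  · obtain ⟨η, -, hη, -, -, hr⟩ := hX.linear h (Finset.mem_Icc.2 ⟨h1, hh⟩)
    refine ⟨η + t.xi k h, (gram X 1 t k h)⁻¹, ?_, abs_gram_inv_apply_le hk h, fun s w => ?_⟩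
    · refine (norm_add_le _ _).trans ?_
      have hH' : (1 : ℝ) ≤ X.H := by exact_mod_cast hH
      nlinarith [hxi hh, Real.sqrt_nonneg (d' : ℝ)]
    · simp only [vFun, qFun, if_pos hh, hr, inner_add_left, clippedMax]
  · refine ⟨0, 0, by simp; positivity, by simp, fun s w => ?_⟩
    rw [vFun_of_lt (not_le.1 hh)]
    simp [clippedMax, wnorm]

end ClippedMax

/-! ### The self-normalised bound from a grid of directions -/

section SelfNormalised

variable {S A W : Type*} [MeasurableSpace S] [MeasurableSpace A] {d d' n : ℕ}
  {X : Problem S A W d d' n} {t : Trace S A d'} {k h : ℕ}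

lemma wnorm_gram_sq (x : Vec d) :
    wnorm (gram X 1 t k h) x ^ 2 = ‖x‖ ^ 2 +
      ∑ τ ∈ Finset.Ico 1 k, inner ℝ x (X.φ (t.state τ h) (t.action τ h)) ^ 2 := by
  rw [wnorm_sq (gram_posDef one_pos k h).posSemidef, gram, one_smul, Matrix.add_mulVec,
    Matrix.one_mulVec, dotProduct_add, Matrix.sum_mulVec, dotProduct_sum, norm_sq_eq_dotProduct]
  congr 1
  refine Finset.sum_congr rfl fun τ _ => ?_
  rw [Matrix.vecMulVec_mulVec, real_inner_eq]
  simp [dotProduct_comm x.ofLp, sq]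

lemma wnorm_gram_sq_le (hφ : ∀ s a, ‖X.φ s a‖ ≤ 1) (hk : 1 ≤ k) (x : Vec d) :
    wnorm (gram X 1 t k h) x ^ 2 ≤ k * ‖x‖ ^ 2 := by
  rw [wnorm_gram_sq]
  have h1 : ∑ τ ∈ Finset.Ico 1 k, (inner ℝ x (X.φ (t.state τ h) (t.action τ h)) : ℝ) ^ 2 ≤
      ∑ τ ∈ Finset.Ico 1 k, ‖x‖ ^ 2 := by
    refine Finset.sum_le_sum fun τ _ => sq_le_sq' ?_ ?_
    · have := abs_le.1 (abs_real_inner_le_norm x (X.φ (t.state τ h) (t.action τ h)))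
      nlinarith [norm_nonneg x, hφ (t.state τ h) (t.action τ h)]
    · have := abs_le.1 (abs_real_inner_le_norm x (X.φ (t.state τ h) (t.action τ h)))
      nlinarith [norm_nonneg x, hφ (t.state τ h) (t.action τ h)]
  rw [Finset.sum_const, Nat.card_Ico, nsmul_eq_mul, Nat.cast_sub hk] at h1
  push_cast at h1
  linarith

lemma abs_integral_le_of_abs_le {μ : Measure S} [IsProbabilityMeasure μ] {f : S → ℝ} {c : ℝ}
    (hf : ∀ s, |f s| ≤ c) : |∫ s, f s ∂μ| ≤ c := by
  have h := norm_integral_le_of_norm_le_const (μ := μ) (f := f) (C := c) (ae_of_all _ hf)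
  rwa [probReal_univ, mul_one] at h

lemma abs_noise_le {f : S → ℝ} {c : ℝ} (hf : ∀ s, f s ∈ Set.Icc (0 : ℝ) c) :
    |noise X t f k h| ≤ c := by
  have := X.isMarkov h
  have h1 := integral_mem_Icc (μ := X.P h (t.state k h, t.action k h)) hf
  have h2 := hf (t.state k (h + 1))
  rw [noise, abs_le]
  constructor <;> linarith [h1.1, h1.2, h2.1, h2.2]

lemma norm_sum_smul_φ_le (hφ : ∀ s a, ‖X.φ s a‖ ≤ 1) {ε : ℕ → ℝ} {c : ℝ}
    (hε : ∀ τ, |ε τ| ≤ c) {K : ℕ} (hkK : k ≤ K + 1) :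
    ‖∑ τ ∈ Finset.Ico 1 k, ε τ • X.φ (t.state τ h) (t.action τ h)‖ ≤ K * c := by
  have hc : 0 ≤ c := (abs_nonneg _).trans (hε 0)
  calc _ ≤ ∑ τ ∈ Finset.Ico 1 k, c := by
        refine norm_sum_le_of_le _ fun τ _ => ?_
        rw [norm_smul, Real.norm_eq_abs]
        exact (mul_le_of_le_one_right (abs_nonneg _) (hφ _ _)).trans (hε τ)
    _ ≤ K * c := by
        rw [Finset.sum_const, Nat.card_Ico, nsmul_eq_mul]
        gcongr
        omega

/-- The self-normalised bound for one function, from a grid of directions. -/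
lemma wnorm_inv_sum_noise_sq_le (hφ : ∀ s a, ‖X.φ s a‖ ≤ 1) (hd : 1 ≤ d) (hH : 1 ≤ X.H) {K : ℕ}
    (hk : k ∈ Finset.Icc 1 K) {f : S → ℝ} (hf : ∀ s, f s ∈ Set.Icc (0 : ℝ) X.H) {x : ℝ}
    (hx : ∀ z ∈ intBox (Fin d) K (2 * d * K * X.H),
      logSupermartingale X t (scaledVec (2 * d * K * X.H) z) f k h ≤ x) :
    wnorm (gram X 1 t k h)⁻¹ (∑ τ ∈ Finset.Ico 1 k,
      noise X t f τ h • X.φ (t.state τ h) (t.action τ h)) ^ 2 ≤ (X.H : ℝ) ^ 2 * (2 * x + 1) := by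
  obtain ⟨hk1, hkK⟩ := Finset.mem_Icc.1 hk
  have hP := gram_posDef (X := X) (t := t) one_pos k h
  have hK1 : 1 ≤ K := hk1.trans hkK
  have hKr : (1 : ℝ) ≤ K := by exact_mod_cast hK1
  have hHr : (1 : ℝ) ≤ X.H := by exact_mod_cast hH
  have hdr : (1 : ℝ) ≤ d := by exact_mod_cast hd
  have hkr : (k : ℝ) ≤ K := by exact_mod_cast hkK
  set N := ∑ τ ∈ Finset.Ico 1 k, noise X t f τ h • X.φ (t.state τ h) (t.action τ h) with hN
  have hNn : ‖N‖ ≤ K * X.H := norm_sum_smul_φ_le hφ (fun τ => abs_noise_le hf) (by omega)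
  set q := wnorm (gram X 1 t k h)⁻¹ N ^ 2 with hq
  set Hr : ℝ := ((X.H : ℕ) : ℝ) with hHr'
  -- With the factor `H⁻²`, expanding `H⁴‖θ₀ - θ‖²` in the norm of `Λ` gives `q - 2H²⟨θ, N⟩ +
  -- H⁴‖θ‖²`. Its last term outweighs the variance term `2H² · (H²/8)‖θ‖²` of the supermartingale,
  -- so any grid point `θ` near `θ₀` bounds `q`.
  let θ₀ : Vec d := (Hr ^ 2)⁻¹ • Matrix.toEuclideanLin (gram X 1 t k h)⁻¹ N
  have hu : ‖Matrix.toEuclideanLin (gram X 1 t k h)⁻¹ N‖ ≤ ‖N‖ := by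
    refine le_trans ?_ (wnorm_gram_inv_le_norm (X := X) (t := t) hk1 h N)
    rw [← wnorm_toEuclideanLin_inv hP]
    refine abs_le_of_sq_le_sq' ?_ (wnorm_nonneg _ _) |>.2
    rw [wnorm_gram_sq]
    exact le_add_of_nonneg_right (Finset.sum_nonneg fun _ _ => sq_nonneg _)
  have hθ₀ : ‖θ₀‖ ≤ K := by
    rw [norm_smul, Real.norm_eq_abs, abs_of_nonneg (by positivity), inv_mul_le_iff₀ (by positivity)]
    refine (hu.trans hNn).trans ?_
    have : Hr ≤ Hr ^ 2 := by nlinarith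
    nlinarith
  obtain ⟨z, hz, hze⟩ := exists_scaledVec (m := 2 * d * K * X.H)
    (by have : 0 < d := hd; have : 0 < X.H := hH; positivity) hθ₀
  set θ := scaledVec (2 * d * K * X.H) z with hθ
  have hlog := hx z hz
  have hlog' : inner ℝ θ N - Hr ^ 2 / 8 * (wnorm (gram X 1 t k h) θ ^ 2 - ‖θ‖ ^ 2) ≤ x := by
    refine le_trans (le_of_eq ?_) hlog
    rw [logSupermartingale, Finset.sum_sub_distrib, ← Finset.sum_mul, wnorm_gram_sq, hN, inner_sum]
    simp only [inner_smul_right]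
    rw [Finset.sum_congr rfl fun τ _ => mul_comm (inner ℝ θ _ : ℝ) (noise X t f τ h)]
    ring
  have hθΛ : θ.ofLp ⬝ᵥ (gram X 1 t k h).mulVec θ₀.ofLp = (Hr ^ 2)⁻¹ * inner ℝ θ N := by
    simp [θ₀, Matrix.mulVec_smul, mulVec_inv_mulVec hP, real_inner_eq]
  have hθ₀Λ : θ₀.ofLp ⬝ᵥ (gram X 1 t k h).mulVec θ₀.ofLp = ((Hr ^ 2)⁻¹) ^ 2 * q := by
    rw [hq, wnorm_sq hP.inv.posSemidef]
    simp [θ₀, Matrix.mulVec_smul, mulVec_inv_mulVec hP, dotProduct_comm]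
    ring
  have he : wnorm (gram X 1 t k h) (θ₀ - θ) ^ 2 = wnorm (gram X 1 t k h) θ ^ 2 -
      2 * ((Hr ^ 2)⁻¹ * inner ℝ θ N) + ((Hr ^ 2)⁻¹) ^ 2 * q := by
    rw [wnorm_sq hP.posSemidef, wnorm_sq hP.posSemidef]
    simp only [WithLp.ofLp_sub, Matrix.mulVec_sub, dotProduct_sub, sub_dotProduct,
      dotProduct_mulVec_swap hP.1 θ₀.ofLp θ.ofLp, hθΛ, hθ₀Λ]
    ring
  -- Since `Λ ≤ k I`, the mesh `1/(2dKH)` leaves an error of at most `kd/(2dKH)² ≤ H⁻²`.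
  have heb : wnorm (gram X 1 t k h) (θ₀ - θ) ^ 2 ≤ (Hr ^ 2)⁻¹ := by
    refine (wnorm_gram_sq_le hφ hk1 _).trans ?_
    calc (k : ℝ) * ‖θ₀ - θ‖ ^ 2 ≤ K * (d * (1 / (2 * d * K * X.H : ℕ)) ^ 2) := by gcongr
      _ = (Hr ^ 2)⁻¹ * (1 / (4 * (d * K))) := by
          push_cast; field_simp; ring
      _ ≤ (Hr ^ 2)⁻¹ * 1 := by
          gcongr
          rw [div_le_one (by positivity)]
          nlinarith
      _ = _ := mul_one _
  have hH2 : 0 < Hr ^ 2 := by positivity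
  have hmul := mul_le_mul_of_nonneg_left heb (sq_nonneg (Hr ^ 2))
  rw [he] at hmul
  have e1 : (Hr ^ 2) ^ 2 * (wnorm (gram X 1 t k h) θ ^ 2 - 2 * ((Hr ^ 2)⁻¹ * inner ℝ θ N) +
      ((Hr ^ 2)⁻¹) ^ 2 * q) = (Hr ^ 2) ^ 2 * wnorm (gram X 1 t k h) θ ^ 2 -
        2 * Hr ^ 2 * inner ℝ θ N + q := by field_simp
  have e2 : (Hr ^ 2) ^ 2 * (Hr ^ 2)⁻¹ = Hr ^ 2 := by field_simp
  rw [e1, e2] at hmul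
  have hw := sq_nonneg (wnorm (gram X 1 t k h) θ)
  have h3 := mul_le_mul_of_nonneg_left hlog' hH2.le
  have h4 : 0 ≤ (Hr ^ 2) ^ 2 * wnorm (gram X 1 t k h) θ ^ 2 := by positivity
  have h5 : 0 ≤ (Hr ^ 2) ^ 2 * ‖θ‖ ^ 2 := by positivity
  nlinarith

end SelfNormalised

end UCBlvd
namespace UCBlvd

/-! ### Uniform concentration over a net of value functions -/

section Concentration

variable {S A W Ω : Type*} [MeasurableSpace S] [MeasurableSpace A]
  {d d' n : ℕ} {X : Problem S A W d d' n} {β : ℝ}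

lemma abs_noise_sub_noise_le {t : Trace S A d'} {f g : S → ℝ} (hf : Measurable f)
    (hg : Measurable g) {c ε : ℝ} (hfc : ∀ s, f s ∈ Set.Icc (0 : ℝ) c)
    (hgc : ∀ s, g s ∈ Set.Icc (0 : ℝ) c) (h : ∀ s, |f s - g s| ≤ ε) (k i : ℕ) :
    |noise X t f k i - noise X t g k i| ≤ 2 * ε := by
  have := X.isMarkov i
  rw [noise, noise, sub_sub_sub_comm, ← integral_sub
    (Integrable.of_mem_Icc 0 c hf.aemeasurable (ae_of_all _ hfc))
    (Integrable.of_mem_Icc 0 c hg.aemeasurable (ae_of_all _ hgc))]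
  refine (abs_sub _ _).trans ?_
  have h1 := abs_integral_le_of_abs_le (μ := X.P i (t.state k i, t.action k i)) h
  linarith [h (t.state k (i + 1))]

/-- The size of the union bound in the uniform concentration inequality. -/
def netSize (d d' n H K m : ℕ) : ℕ :=
  (2 * (K * (2 * d * K * H)) + 1) ^ d * n *
    ((2 * (2 * H * d' * (2 * K * d')) + 1) ^ d' * (2 * (1 * m) + 1) ^ (d * d)) * (K * H)

variable [DiscreteMeasurableSpace A] [Finite A] [Nonempty A] [MeasurableSpace W]
  [mΩ : MeasurableSpace Ω] {Pr : Measure Ω} {K : ℕ}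

/-- The value function depends on the same data as the noise, so it is replaced by a member of a
deterministic net. Contexts contribute only a factor `n`, since only representative ones occur. The
restriction to planning episodes is what keeps `xi` bounded. -/
lemma Run.exists_event_wnorm_inv_sum_noise_le [IsProbabilityMeasure Pr] (hX : X.IsLinear)
    (hd : 1 ≤ d) (hd' : 1 ≤ d') (hn : 1 ≤ n) (hH : 1 ≤ X.H) (hK : 1 ≤ K)
    (R : Run X Pr K 1 β) {m : ℕ} (hm : 0 < m)
    (hmβ : 4 * (K : ℝ) ^ 2 * (2 * X.L * β) ^ 2 * d ≤ m) {η : ℝ} (hη : 0 < η)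
    (hN : 0 ≤ Real.log (netSize d d' n X.H K m / η)) :
    ∃ E : Set Ω, MeasurableSet E ∧ Pr Eᶜ ≤ ENNReal.ofReal η ∧
      ∀ ω ∈ E, ∀ k ∈ Finset.Icc 1 K, kTilde X 1 (R.trace ω) k = k →
        ∀ h ∈ Finset.Icc 1 X.H, ∀ j,
          wnorm (gram X 1 (R.trace ω) k h)⁻¹ (∑ τ ∈ Finset.Ico 1 k,
            noise X (R.trace ω) (fun s => vFun X 1 β (R.trace ω) k (h + 1) s (X.wRep j)) τ h •
              X.φ ((R.trace ω).state τ h) ((R.trace ω).action τ h)) ≤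
            X.H * Real.sqrt (2 * Real.log (netSize d d' n X.H K m / η) + 1) + 2 := by
  have hKr : (1 : ℝ) ≤ K := by exact_mod_cast hK
  have hdr : (1 : ℝ) ≤ d := by exact_mod_cast hd
  have hdr' : (1 : ℝ) ≤ d' := by exact_mod_cast hd'
  have hmr : (0 : ℝ) < m := by exact_mod_cast hm
  set b := 2 * X.L * β with hb
  -- The union bound runs over direction, representative context, rounded `ν` and rounded inverse
  -- Gram matrix.
  let J := (intBox (Fin d) K (2 * d * K * X.H) ×ˢ (Finset.univ : Finset (Fin n))) ×ˢ
    (intBox (Fin d') (2 * X.H * d') (2 * K * d') ×ˢ intBox (Fin d × Fin d) 1 m)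
  let F : ((Fin d → ℤ) × Fin n) × ((Fin d' → ℤ) × (Fin d × Fin d → ℤ)) → S → ℝ := fun p s =>
    clippedMax X b (scaledVec (2 * K * d') p.2.1)
      (Matrix.of fun i j => (p.2.2 (i, j) : ℝ) / m) s (X.wRep p.1.2)
  have hcard : J.card * (K * X.H) = netSize d d' n X.H K m := by
    simp [J, card_intBox, netSize]
  have hpos : 0 < J.card * (K * X.H) := by
    rw [hcard, netSize]
    have : 0 < X.H := hH
    have : 0 < n := hn
    have : 0 < K := hK
    positivity
  obtain ⟨E, hEm, hEP, hE⟩ := R.exists_event_logSupermartingale_le hX J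
    (fun p => scaledVec (2 * d * K * X.H) p.1.1) F
    (fun p => measurable_clippedMax hX _ _ _ _) (fun p s => clippedMax_mem_Icc _ _ _ _ _) hpos hη
  rw [hcard] at hE
  refine ⟨E, hEm, hEP, fun ω hω k hk hkk h hh j => ?_⟩
  obtain ⟨hk1, hkK⟩ := Finset.mem_Icc.1 hk
  obtain ⟨hh1, hhH⟩ := Finset.mem_Icc.1 hh
  set t := R.trace ω with ht
  have hxi : h + 1 ≤ X.H → ‖t.xi k (h + 1)‖ ≤ X.H * Real.sqrt d' := fun hle => by
    obtain ⟨θ, hfeas, -⟩ := R.planned ω k hk hkk (h + 1) (Finset.mem_Icc.2 ⟨by omega, hle⟩)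
    exact hfeas.2
  obtain ⟨ν, B, hν, hB, hV⟩ := exists_vFun_eq_clippedMax (β := β) hX hk1
    (by omega : 1 ≤ h + 1) hH hxi
  have hν' : ‖ν‖ ≤ (2 * X.H * d' : ℕ) := by
    refine hν.trans ?_
    push_cast
    have : Real.sqrt d' ≤ d' := Real.sqrt_le_left (by positivity) |>.2 (by nlinarith)
    gcongr
  obtain ⟨zν, hzν, hνe⟩ := exists_scaledVec (m := 2 * K * d') (by positivity) hν'
  obtain ⟨zB, hzB, hBe⟩ := exists_mem_intBox (R := 1) hm
    (x := fun p : Fin d × Fin d => B p.1 p.2) (fun p => by simpa using hB p.1 p.2)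
  set f : S → ℝ := fun s => clippedMax X b (scaledVec (2 * K * d') zν)
      (Matrix.of fun i j => (zB (i, j) : ℝ) / m) s (X.wRep j) with hf
  -- Half of `1 / K` comes from `ν`, half from the matrix through `hmβ`. Each of at most `K` noise
  -- terms moves by at most `2 / K`, which is the additive `2` of the bound.
  have hclose : ∀ s, |vFun X 1 β t k (h + 1) s (X.wRep j) - f s| ≤ 1 / K := by
    intro s
    rw [hV]
    refine (abs_clippedMax_sub_le hX.φ_norm hX.ψ_norm b ν _ (ε := 1 / m)
      (fun i j => hBe (i, j)) s _).trans ?_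
    have h1 : ‖ν - scaledVec (2 * K * d') zν‖ ≤ 1 / (2 * K) := by
      refine abs_le_of_sq_le_sq' (hνe.trans ?_) (by positivity) |>.2
      push_cast
      rw [show (d' : ℝ) * (1 / (2 * K * d')) ^ 2 = (1 / (2 * K)) ^ 2 * (1 / d') by field_simp]
      exact mul_le_of_le_one_right (by positivity) ((div_le_one (by positivity)).2 hdr')
    have h2 : |b| * Real.sqrt (d * (1 / m)) ≤ 1 / (2 * K) := by
      refine abs_le_of_sq_le_sq' ?_ (by positivity) |>.2
      rw [mul_pow, Real.sq_sqrt (by positivity), sq_abs,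
        show b ^ 2 * (d * (1 / (m : ℝ))) = (4 * K ^ 2 * b ^ 2 * d) / m * (1 / (2 * K)) ^ 2 by
          field_simp; norm_num]
      exact mul_le_of_le_one_left (by positivity) ((div_le_one hmr).2 hmβ)
    calc _ ≤ 1 / (2 * (K : ℝ)) + 1 / (2 * K) := add_le_add h1 h2
      _ = 1 / K := by field_simp; norm_num
  have hVm : Measurable fun s => vFun X 1 β t k (h + 1) s (X.wRep j) :=
    measurable_vFun hX one_pos (by omega) _
  have hfm : Measurable f := measurable_clippedMax hX _ _ _ _
  have hfc : ∀ s, f s ∈ Set.Icc (0 : ℝ) X.H := fun s => clippedMax_mem_Icc _ _ _ _ _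
  have hP := gram_posDef (X := X) (t := t) one_pos k h
  have hmain := wnorm_inv_sum_noise_sq_le (t := t) (h := h) hX.φ_norm hd hH hk hfc
    (x := Real.log (netSize d d' n X.H K m / η)) (fun z hz => hE ω hω ((z, j), (zν, zB))
      (by simp only [J, Finset.mem_product, Finset.mem_univ]; exact ⟨⟨hz, trivial⟩, hzν, hzB⟩)
      k hk h hh)
  have hsplit : ∑ τ ∈ Finset.Ico 1 k,
      noise X t (fun s => vFun X 1 β t k (h + 1) s (X.wRep j)) τ h •
        X.φ (t.state τ h) (t.action τ h) =
      (∑ τ ∈ Finset.Ico 1 k, noise X t f τ h • X.φ (t.state τ h) (t.action τ h)) +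
      ∑ τ ∈ Finset.Ico 1 k, (noise X t (fun s => vFun X 1 β t k (h + 1) s (X.wRep j)) τ h -
        noise X t f τ h) • X.φ (t.state τ h) (t.action τ h) := by
    rw [← Finset.sum_add_distrib]
    refine Finset.sum_congr rfl fun τ _ => ?_
    rw [← add_smul, add_sub_cancel]
  rw [hsplit]
  refine (wnorm_add_le hP.inv.posSemidef _ _).trans (add_le_add ?_ ?_)
  · refine abs_le_of_sq_le_sq' ?_ (by positivity) |>.2
    rw [mul_pow, Real.sq_sqrt (by positivity)]
    exact hmain
  · refine (wnorm_gram_inv_le_norm hk1 h _).trans ((norm_sum_smul_φ_le hX.φ_norm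
      (fun τ => abs_noise_sub_noise_le hVm hfm (fun s => vFun_mem_Icc s _) hfc hclose τ h)
      (by omega : k ≤ K + 1)).trans (le_of_eq ?_))
    field_simp

/-- With high probability all planned parameters are accurate. -/
lemma Run.exists_event_isAccurate [IsProbabilityMeasure Pr] (hX : X.Assumptions)
    (hd : 1 ≤ d) (hd' : 1 ≤ d') (hn : 1 ≤ n) (hH : 1 ≤ X.H) (hK : 1 ≤ K)
    (R : Run X Pr K 1 β) {m : ℕ} (hm : 0 < m)
    (hmβ : 4 * (K : ℝ) ^ 2 * (2 * X.L * β) ^ 2 * d ≤ m) {η : ℝ} (hη : 0 < η)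
    (hN : 0 ≤ Real.log (netSize d d' n X.H K m / η))
    (hβ : X.H * Real.sqrt d +
      (X.H * Real.sqrt (2 * Real.log (netSize d d' n X.H K m / η) + 1) + 2) ≤ β) :
    ∃ E : Set Ω, MeasurableSet E ∧ Pr Eᶜ ≤ ENNReal.ofReal η ∧
      ∀ ω ∈ E, ∀ k ∈ Finset.Icc 1 K, kTilde X 1 (R.trace ω) k = k →
        IsAccurate X 1 β (R.trace ω) k := by
  obtain ⟨E, hEm, hEP, hE⟩ := R.exists_event_wnorm_inv_sum_noise_le hX.linear hd hd' hn hH hK hm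
    hmβ hη hN
  refine ⟨E, hEm, hEP, fun ω hω k hk hkk h hh => ?_⟩
  have hex := fun j => hX.linear.exists_integral_eq_inner hh
    (measurable_vFun (k := k) (β := β) (t := R.trace ω) hX.linear one_pos
      (by omega : 1 ≤ h + 1) (X.wRep j))
    (Nat.cast_nonneg X.H) (fun s => vFun_mem_Icc s _)
  choose θ hθn hθ using hex
  refine abs_inner_xi_sub_integral_le hX one_pos (le_trans (by positivity) hβ) hh
    (R.planned ω k hk hkk h hh) θ hθ fun j => ?_
  refine (wnorm_sub_thetaTilde_le (Finset.mem_Icc.1 hk).1 _ (hθ j)).trans (le_trans ?_ hβ)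
  exact add_le_add (hθn j) (hE ω hω k hk hkk h hh j)

end Concentration

end UCBlvd
namespace UCBlvd

/-! ### Regret decomposition -/

section Regret

variable {S A W Ω : Type*} [MeasurableSpace S] [MeasurableSpace A]
  {d d' n : ℕ} {X : Problem S A W d d' n} {β : ℝ}

/-- The sum of the bonuses. -/
lemma sum_sum_wnorm_le (hφ : ∀ s a, ‖X.φ s a‖ ≤ 1) (hd : 1 ≤ d) (t : Trace S A d') (K : ℕ) :
    ∑ k ∈ Finset.Icc 1 K, ∑ h ∈ Finset.Icc 1 X.H,
      wnorm (gram X 1 t k h)⁻¹ (X.φ (t.state k h) (t.action k h)) ≤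
        X.H * Real.sqrt (2 * d * K * Real.log (1 + K / d)) := by
  rw [Finset.sum_comm]
  calc _ ≤ ∑ h ∈ Finset.Icc 1 X.H, Real.sqrt (2 * d * K * Real.log (1 + K / d)) := by
        refine Finset.sum_le_sum fun h _ => Real.le_sqrt_of_sq_le ?_
        have h1 := sq_sum_le_card_mul_sum_sq (s := Finset.Icc 1 K)
          (f := fun k => wnorm (gram X 1 t k h)⁻¹ (X.φ (t.state k h) (t.action k h)))
        have h2 := sum_wnorm_gram_inv_sq_le (t := t) hφ h K
        have h3 := log_det_gram_le (t := t) one_pos hφ hd (by omega : 1 ≤ K + 1) h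
        simp only [gram_one, one_smul, Matrix.det_one, Real.log_one, sub_zero, mul_one,
          Nat.cast_add, Nat.cast_one, add_sub_cancel_right] at h3
        rw [Nat.card_Icc, Nat.add_sub_cancel] at h1
        refine h1.trans ?_
        calc (K : ℝ) * _ ≤ K * (2 * (d * Real.log (1 + K / d))) := by gcongr; linarith
          _ = _ := by ring
    _ = _ := by simp

variable [MeasurableSpace W]
  [mΩ : MeasurableSpace Ω] {Pr : Measure Ω} {K : ℕ} {lam : ℝ}

/-- The gap between the optimistic value function and the value of the policy that is played. -/
noncomputable def Run.valueGap (R : Run X Pr K lam β) (k h : ℕ) (ω : Ω) (s : S) : ℝ :=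
  vFun X lam β (R.trace ω) (kTilde X lam (R.trace ω) k) h s (R.context k ω) -
    X.value (fun h => R.policy k h ω) h s (R.context k ω)

lemma Run.valueGap_mem_Icc (R : Run X Pr K lam β) (k : ℕ) {h : ℕ} (h1 : 1 ≤ h)
    (hh : h ≤ X.H + 1) (ω : Ω) (s : S) :
    R.valueGap k h ω s ∈ Set.Icc (-(X.H : ℝ)) X.H := by
  have h2 := vFun_mem_Icc (X := X) (lam := lam) (β := β) (t := R.trace ω)
    (k := kTilde X lam (R.trace ω) k) (h := h) s (R.context k ω)
  have h3 := X.valueAux_mem_Icc (fun h => R.policy k h ω) (R.context k ω) (X.H + 1 - h) h s h1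
    (by omega)
  have h4 : ((X.H + 1 - h : ℕ) : ℝ) ≤ X.H := by exact_mod_cast (by omega : X.H + 1 - h ≤ X.H)
  rw [Run.valueGap, ContextualMDP.value]
  constructor <;> linarith [h2.1, h2.2, h3.1, h3.2]

/-- This crude bound settles the cases `K ≤ 2`, `L > K` and `K H = 0`. -/
lemma Run.regret_le_mul [Nonempty A] (R : Run X Pr K lam β) (ω : Ω) : R.regret ω ≤ K * X.H := by
  have : Nonempty {π : ℕ → S → W → A // IsPolicy π} :=
    ⟨⟨fun _ _ _ => Classical.arbitrary A, fun _ _ => measurable_const⟩⟩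
  calc R.regret ω ≤ ∑ k ∈ Finset.Icc 1 K, (X.H : ℝ) := by
        refine Finset.sum_le_sum fun k _ => ?_
        have h1 := X.valueAux_mem_Icc (fun h => R.policy k h ω) (R.context k ω) (X.H + 1 - 1) 1
          ((R.trace ω).state k 1) le_rfl (by omega)
        have h2 : X.optValue 1 ((R.trace ω).state k 1) (R.context k ω) ≤ X.H :=
          ciSup_le fun π => (X.valueAux_mem_Icc π.1 (R.context k ω) (X.H + 1 - 1) 1
            ((R.trace ω).state k 1) le_rfl (by omega)).2
        have h3 := h1.1
        rw [ContextualMDP.value]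
        linarith
    _ = K * X.H := by simp

variable [DiscreteMeasurableSpace A] [Finite A]

lemma Run.measurable_valueGap (hX : X.IsLinear) (R : Run X Pr K lam β) {k h : ℕ}
    (hk : k ∈ Finset.Icc 1 K) (h1 : 1 ≤ h) (hh : h ≤ X.H + 1) :
    Measurable[(R.filt (toLex (k, 1))).prod (inferInstance : MeasurableSpace S)]
      fun p : Ω × S => R.valueGap k h p.1 p.2 :=
  (R.measurable_vFun_kTilde hX hk h1 (R.context_meas k hk)).sub
    (R.measurable_value hX hk h1 (by omega))

variable [Nonempty A]

/-- The Bellman equation of the played policy is subtracted from its optimistic counterpart at the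
same, greedy, action. The bonus is measured in the Gram matrix of episode `k̃`; the failed
determinant test converts it to episode `k` at the price of `√e`. -/
lemma Run.valueGap_le (hX : X.IsLinear) (R : Run X Pr K 1 β) (hLβ : 0 ≤ X.L * β) {ω : Ω} {k h : ℕ}
    (hk : k ∈ Finset.Icc 1 K) (hh : h ∈ Finset.Icc 1 X.H)
    (hacc : IsAccurate X 1 β (R.trace ω) (kTilde X 1 (R.trace ω) k)) :
    R.valueGap k h ω ((R.trace ω).state k h) ≤
      ∫ s, R.valueGap k (h + 1) ω s ∂(X.P h ((R.trace ω).state k h, (R.trace ω).action k h)) +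
        4 * (X.L * β) * (Real.sqrt (Real.exp 1) * wnorm (gram X 1 (R.trace ω) k h)⁻¹
          (X.φ ((R.trace ω).state k h) ((R.trace ω).action k h))) := by
  obtain ⟨hh1, hhH⟩ := Finset.mem_Icc.1 hh
  obtain ⟨hk1, hkK⟩ := Finset.mem_Icc.1 hk
  have := X.isMarkov h
  set t := R.trace ω with ht
  set w := R.context k ω with hw
  set k₀ := kTilde X 1 t k with hk₀
  have ha : t.action k h = R.policy k h ω (t.state k h) w := R.action_eq ω k hk h hh
  have h1 := hacc.vFun_le hLβ hh (s := t.state k h) (a := t.action k h) (w := w) (fun b => by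
    rw [ha]; exact R.greedy ω k hk h hh _ _ b)
  have h2 := wnorm_gram_inv_le_of_not_detTest (X := X) (t := t) one_pos
    (one_le_kTilde (lam := 1) k) (kTilde_le hk1) hh (not_detTest_kTilde one_pos hk1)
    (X.φ (t.state k h) (t.action k h))
  have h3 : X.value (fun h => R.policy k h ω) h (t.state k h) w =
      X.r h (t.state k h) (t.action k h) w +
        ∫ s, X.value (fun h => R.policy k h ω) (h + 1) s w
          ∂(X.P h (t.state k h, t.action k h)) := by
    simp only [ContextualMDP.value]
    rw [show X.H + 1 - h = (X.H + 1 - (h + 1)) + 1 by omega, ContextualMDP.valueAux, ha]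
  have hprod := R.measurable_value hX (j := X.H + 1 - (h + 1)) (h := h + 1) hk (by omega)
    (by omega)
  have hvm : Measurable fun s => X.value (fun h => R.policy k h ω) (h + 1) s w :=
    hprod.comp (@measurable_prodMk_left Ω S (R.filt (toLex (k, 1))) _ ω)
  have h4 : ∫ s, R.valueGap k (h + 1) ω s ∂(X.P h (t.state k h, t.action k h)) =
      ∫ s, vFun X 1 β t k₀ (h + 1) s w ∂(X.P h (t.state k h, t.action k h)) -
        ∫ s, X.value (fun h => R.policy k h ω) (h + 1) s w
          ∂(X.P h (t.state k h, t.action k h)) := by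
    refine integral_sub ?_ ?_
    · exact Integrable.of_mem_Icc 0 X.H (measurable_vFun hX one_pos (by omega) w).aemeasurable
        (ae_of_all _ fun s => vFun_mem_Icc s w)
    · exact Integrable.of_mem_Icc 0 _ hvm.aemeasurable (ae_of_all _ fun s =>
        X.valueAux_mem_Icc _ w _ (h + 1) s (by omega) (by omega))
  have h5 := mul_le_mul_of_nonneg_left h2 (mul_nonneg (by norm_num : (0 : ℝ) ≤ 4) hLβ)
  rw [h4, Run.valueGap, h3]
  linarith

/-- The regret decomposition. -/
lemma Run.regret_le (hX : X.IsLinear) (hd : 1 ≤ d) (R : Run X Pr K 1 β) (hLβ : 0 ≤ X.L * β) {ω : Ω}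
    (hacc : ∀ k ∈ Finset.Icc 1 K, kTilde X 1 (R.trace ω) k = k →
      IsAccurate X 1 β (R.trace ω) k) :
    R.regret ω ≤ ∑ k ∈ Finset.Icc 1 K, ∑ h ∈ Finset.Icc 1 X.H,
        (∫ s, R.valueGap k (h + 1) ω s ∂(X.P h ((R.trace ω).state k h, (R.trace ω).action k h)) -
          R.valueGap k (h + 1) ω ((R.trace ω).state k (h + 1))) +
      4 * (X.L * β) * (Real.sqrt (Real.exp 1) *
        (X.H * Real.sqrt (2 * d * K * Real.log (1 + K / d)))) := by
  have hepisode : ∀ k ∈ Finset.Icc 1 K,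
      X.optValue 1 ((R.trace ω).state k 1) (R.context k ω) -
        X.value (fun h => R.policy k h ω) 1 ((R.trace ω).state k 1) (R.context k ω) ≤
      ∑ h ∈ Finset.Icc 1 X.H,
        (∫ s, R.valueGap k (h + 1) ω s ∂(X.P h ((R.trace ω).state k h, (R.trace ω).action k h)) -
          R.valueGap k (h + 1) ω ((R.trace ω).state k (h + 1))) +
      4 * (X.L * β) * (Real.sqrt (Real.exp 1) * ∑ h ∈ Finset.Icc 1 X.H,
        wnorm (gram X 1 (R.trace ω) k h)⁻¹
          (X.φ ((R.trace ω).state k h) ((R.trace ω).action k h))) := by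
    intro k hk
    obtain ⟨hk1, hkK⟩ := Finset.mem_Icc.1 hk
    have hacc' := hacc (kTilde X 1 (R.trace ω) k)
      (Finset.mem_Icc.2 ⟨one_le_kTilde k, (kTilde_le hk1).trans hkK⟩) (kTilde_kTilde k)
    have hgap : X.optValue 1 ((R.trace ω).state k 1) (R.context k ω) -
        X.value (fun h => R.policy k h ω) 1 ((R.trace ω).state k 1) (R.context k ω) ≤
        R.valueGap k 1 ω ((R.trace ω).state k 1) :=
      sub_le_sub_right (hacc'.optValue_le hX one_pos _ _) _
    refine hgap.trans ?_
    have htel : ∑ h ∈ Finset.Icc 1 X.H, (R.valueGap k h ω ((R.trace ω).state k h) -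
        R.valueGap k (h + 1) ω ((R.trace ω).state k (h + 1))) =
          R.valueGap k 1 ω ((R.trace ω).state k 1) := by
      have hlast : R.valueGap k (X.H + 1) ω ((R.trace ω).state k (X.H + 1)) = 0 := by
        rw [Run.valueGap, vFun_of_lt (by omega)]
        simp [ContextualMDP.value, ContextualMDP.valueAux]
      have h1 : ∀ m, ∑ h ∈ Finset.Icc 1 m, (R.valueGap k h ω ((R.trace ω).state k h) -
          R.valueGap k (h + 1) ω ((R.trace ω).state k (h + 1))) =
          R.valueGap k 1 ω ((R.trace ω).state k 1) -
            R.valueGap k (m + 1) ω ((R.trace ω).state k (m + 1)) := by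
        intro m
        induction m with
        | zero => simp
        | succ m ih => rw [Finset.sum_Icc_succ_top (by omega), ih]; ring
      rw [h1, hlast, sub_zero]
    rw [← htel, Finset.mul_sum, Finset.mul_sum, ← Finset.sum_add_distrib]
    refine Finset.sum_le_sum fun h hh => ?_
    have := R.valueGap_le hX hLβ hk hh hacc'
    linarith
  refine (Finset.sum_le_sum hepisode).trans ?_
  rw [Finset.sum_add_distrib, ← Finset.mul_sum, ← Finset.mul_sum]
  have h1 := sum_sum_wnorm_le hX.φ_norm hd (R.trace ω) K
  gcongr

end Regret

end UCBlvd
namespace UCBlvd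

/-! ### Nonvanishing features, positive dimensions and `L ≥ 1` -/

section Nondegeneracy

variable {S A W : Type*} [MeasurableSpace S] [MeasurableSpace A]
  [MeasurableSpace W] {d d' n : ℕ} {X : Problem S A W d d' n}

lemma Problem.IsLinear.φ_ne_zero (hX : X.IsLinear) (hH : 1 ≤ X.H) (s : S) (a : A) :
    X.φ s a ≠ 0 := by
  intro h0
  obtain ⟨-, μ, -, -, hP, -⟩ := hX.linear 1 (Finset.mem_Icc.2 ⟨le_rfl, hH⟩)
  have := X.isMarkov 1
  have h1 := hP s a Set.univ MeasurableSet.univ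
  rw [h0, probReal_univ] at h1
  simp at h1

variable [Finite A] [Nonempty A]

/-- Completeness is applied to the truncation of `max_a ‖φ(s,a)‖`, which is positive everywhere: its
expectation is positive, yet linear in `ψ`. -/
lemma Problem.Assumptions.ψ_ne_zero (hX : X.Assumptions) (hH : 1 ≤ X.H) (s : S) (a : A) (w : W) :
    X.ψ s a w ≠ 0 := by
  intro h0
  have := X.isMarkov 1
  let f : S → W → ℝ := fun s w =>
    min (⨆ a : A, max (inner ℝ (0 : Vec d') (X.ψ s a w) +
      1 * wnorm (1 : Matrix (Fin d) (Fin d) ℝ)⁻¹ (X.φ s a)) 0) (X.H : ℝ)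
  have hfc : f ∈ X.functionClass := ⟨0, 1, 1, Matrix.PosDef.one, fun _ _ => rfl⟩
  have hHr : (0 : ℝ) < X.H := by exact_mod_cast hH
  have hpos : ∀ s, 0 < f s w := by
    intro s
    refine lt_min (lt_of_lt_of_le ?_ (le_ciSup (Set.finite_range _).bddAbove
      (Classical.arbitrary A))) hHr
    refine lt_max_of_lt_left ?_
    rw [inner_zero_left, zero_add, one_mul, inv_one, wnorm_one]
    exact norm_pos_iff.2 (hX.linear.φ_ne_zero hH _ _)
  obtain ⟨ξ, -, hξ⟩ := hX.complete f hfc 1 (Finset.mem_Icc.2 ⟨le_rfl, hH⟩)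
  have h1 := hξ s a w
  rw [h0, inner_zero_right] at h1
  have hint : Integrable (fun s' => f s' w) (X.P 1 (s, a)) :=
    Integrable.of_mem_Icc 0 X.H (measurable_of_mem_functionClass hX.linear hfc w).aemeasurable
      (ae_of_all _ fun s' => ⟨(hpos s').le, min_le_right _ _⟩)
  have h2 := (integral_pos_iff_support_of_nonneg (fun s' => (hpos s').le) hint).2 (by
    rw [show Function.support (fun s' => f s' w) = Set.univ from
      Set.eq_univ_of_forall fun s' => (hpos s').ne']
    simp)
  linarith

/-- For `L`, the longest of the vectors `ψ(s, a, w⁽ʲ⁾)` is expanded over all of them. -/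
lemma Problem.Assumptions.one_le [Nonempty S] [Nonempty W] (hX : X.Assumptions) (hH : 1 ≤ X.H) :
    1 ≤ d ∧ 1 ≤ d' ∧ 1 ≤ n ∧ 1 ≤ X.L := by
  obtain ⟨s⟩ := ‹Nonempty S›
  obtain ⟨a⟩ := ‹Nonempty A›
  obtain ⟨w⟩ := ‹Nonempty W›
  have hφ := hX.linear.φ_ne_zero hH s a
  have hψ := hX.ψ_ne_zero hH s a
  have hd : 1 ≤ d := by
    by_contra! h
    obtain rfl : d = 0 := by omega
    exact hφ (Subsingleton.elim _ _)
  have hn : 1 ≤ n := by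
    by_contra! h
    obtain rfl : n = 0 := by omega
    obtain ⟨c, hc, -⟩ := hX.span.2 s a w
    exact hψ w (by simpa using hc)
  refine ⟨hd, hn.trans hX.span.1, hn, ?_⟩
  have : Nonempty (Fin n) := ⟨⟨0, hn⟩⟩
  obtain ⟨j, hj⟩ := Finite.exists_max fun j => ‖X.ψ s a (X.wRep j)‖
  obtain ⟨c, hc, hcL⟩ := hX.span.2 s a (X.wRep j)
  have hm := norm_pos_iff.2 (hψ (X.wRep j))
  refine le_of_mul_le_mul_right ?_ hm
  calc 1 * ‖X.ψ s a (X.wRep j)‖ = ‖∑ i, c i • X.ψ s a (X.wRep i)‖ := by rw [one_mul, ← hc]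
    _ ≤ ∑ i, |c i| * ‖X.ψ s a (X.wRep j)‖ := by
        refine norm_sum_le_of_le _ fun i _ => ?_
        rw [norm_smul, Real.norm_eq_abs]
        exact mul_le_mul_of_nonneg_left (hj i) (abs_nonneg _)
    _ ≤ X.L * ‖X.ψ s a (X.wRep j)‖ := by
        rw [← Finset.sum_mul]
        exact mul_le_mul_of_nonneg_right hcL hm.le

end Nondegeneracy

/-! ### Numerical estimates and constants -/

section Arithmetic

/-- The powers `5`, `6` and `26` of `B` absorb the side lengths of the grids for directions, `ν` and
the `d²` matrix entries; the last `1` pays for `nKH/δ ≤ B`. The `23` comes from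
`grid_resolution_le`. -/
lemma log_netSize_div_le {d d' n H K m : ℕ} (hd : 1 ≤ d) (hn : 1 ≤ n) (hnd : n ≤ d')
    (hH : 1 ≤ H) (hK : 1 ≤ K) {δ B : ℝ} (hδ : 0 < δ) (hδ2 : δ < 1 / 2)
    (hB : B = d * d' * (K * H) / δ) (hm : (m : ℝ) ≤ B ^ 23 + 1) :
    0 ≤ Real.log (netSize d d' n H K m / δ) ∧
      Real.log (netSize d d' n H K m / δ) ≤
        (5 * d + 6 * d' + 26 * d ^ 2 + 1) * Real.log B := by
  have hd1 : (1 : ℝ) ≤ d := by exact_mod_cast hd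
  have hd'1 : (1 : ℝ) ≤ d' := by exact_mod_cast hn.trans hnd
  have hn1 : (1 : ℝ) ≤ n := by exact_mod_cast hn
  have hnd1 : (n : ℝ) ≤ d' := by exact_mod_cast hnd
  have hH1 : (1 : ℝ) ≤ H := by exact_mod_cast hH
  have hK1 : (1 : ℝ) ≤ K := by exact_mod_cast hK
  set q : ℝ := d * d' * (K * H) with hq
  have hKH : (1 : ℝ) ≤ K * H := one_le_mul_of_one_le_of_one_le hK1 hH1
  have hdd : (1 : ℝ) ≤ d * d' := one_le_mul_of_one_le_of_one_le hd1 hd'1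
  have hq1 : 1 ≤ q := one_le_mul_of_one_le_of_one_le hdd hKH
  have hqB : q = B * δ := by rw [hB]; field_simp
  have hB2 : 2 ≤ B := by nlinarith
  have hqB' : q ≤ B := by nlinarith
  have h1 : 2 * ((K : ℝ) * (2 * d * K * H)) + 1 ≤ B ^ 5 := by
    have e : (K : ℝ) * (d * K * H) ≤ q * q := by
      calc (K : ℝ) * (d * K * H) = (1 * 1 * (K * 1)) * (d * 1 * (K * H)) := by ring
        _ ≤ (d * d' * (K * H)) * (d * d' * (K * H)) := by gcongr
        _ = q * q := rfl
    have e2 : q * q ≤ B * B := by gcongr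
    have e3 : 8 * (B * B) ≤ B ^ 5 := by
      have : (2 : ℝ) ^ 3 ≤ B ^ 3 := by gcongr
      nlinarith [mul_self_nonneg B]
    nlinarith
  have h2 : 2 * (2 * (H : ℝ) * d' * (2 * K * d')) + 1 ≤ B ^ 6 := by
    have e : (H : ℝ) * d' * (K * d') ≤ q * q := by
      calc (H : ℝ) * d' * (K * d') = (1 * d' * (1 * H)) * (1 * d' * (K * 1)) := by ring
        _ ≤ (d * d' * (K * H)) * (d * d' * (K * H)) := by gcongr
        _ = q * q := rfl
    have e2 : q * q ≤ B * B := by gcongr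
    have e3 : 16 * (B * B) ≤ B ^ 6 := by
      have : (2 : ℝ) ^ 4 ≤ B ^ 4 := by gcongr
      nlinarith [mul_self_nonneg B]
    nlinarith
  have h3 : 2 * (1 * (m : ℝ)) + 1 ≤ B ^ 26 := by
    have e : (2 : ℝ) ^ 23 ≤ B ^ 23 := by gcongr
    have e2 : 8 * B ^ 23 ≤ B ^ 26 := by
      have : (2 : ℝ) ^ 3 ≤ B ^ 3 := by gcongr
      calc 8 * B ^ 23 ≤ B ^ 3 * B ^ 23 := by gcongr; linarith
        _ = B ^ 26 := by ring
    linarith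
  have h4 : (n : ℝ) * (K * H) / δ ≤ B := by
    rw [hB]
    have : (n : ℝ) * (K * H) ≤ q := by
      refine mul_le_mul_of_nonneg_right ?_ (by linarith)
      nlinarith
    gcongr
  have hle : (netSize d d' n H K m : ℝ) / δ ≤ B ^ (5 * d + 6 * d' + 26 * d ^ 2 + 1) := by
    calc (netSize d d' n H K m : ℝ) / δ
        = (2 * ((K : ℝ) * (2 * d * K * H)) + 1) ^ d *
          ((2 * (2 * (H : ℝ) * d' * (2 * K * d')) + 1) ^ d' *
            (2 * (1 * (m : ℝ)) + 1) ^ (d * d)) * ((n : ℝ) * (K * H) / δ) := by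
          rw [netSize]; push_cast; ring
      _ ≤ (B ^ 5) ^ d * ((B ^ 6) ^ d' * (B ^ 26) ^ (d * d)) * B := by gcongr
      _ = _ := by
          rw [← pow_mul, ← pow_mul, ← pow_mul, ← pow_add, ← pow_add, ← pow_succ]
          congr 1
          ring
  have hpos : 1 ≤ (netSize d d' n H K m : ℝ) / δ := by
    rw [le_div_iff₀ hδ, one_mul]
    have : 1 ≤ netSize d d' n H K m := by
      rw [netSize, Nat.one_le_iff_ne_zero]
      have : H ≠ 0 := by omega
      have : K ≠ 0 := by omega
      have : n ≠ 0 := by omega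
      positivity
    have : (1 : ℝ) ≤ netSize d d' n H K m := by exact_mod_cast this
    linarith
  refine ⟨Real.log_nonneg hpos, ?_⟩
  have := Real.log_le_log (by linarith) hle
  rw [Real.log_pow] at this
  push_cast at this
  exact this

/-- The matrix net, of dimension `d²`, produces `d` and the net for `ν` produces `√d'`. The summands
amount to `2 + 10 + 2`, so `64` is generous. -/
lemma confidence_width_le {d d' H : ℕ} (hd : 1 ≤ d) (hd' : 1 ≤ d') (hH : 1 ≤ H) {ι x : ℝ}
    (hι : 1 / 2 ≤ ι) (hx : x ≤ (5 * d + 6 * d' + 26 * d ^ 2 + 1) * ι) :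
    H * Real.sqrt d + (H * Real.sqrt (2 * x + 1) + 2) ≤
      64 * H * (d + Real.sqrt d') * Real.sqrt ι := by
  have hd1 : (1 : ℝ) ≤ d := by exact_mod_cast hd
  have hd'1 : (1 : ℝ) ≤ d' := by exact_mod_cast hd'
  have hH1 : (1 : ℝ) ≤ H := by exact_mod_cast hH
  set r := Real.sqrt d' with hr
  have hr1 : 1 ≤ r := Real.one_le_sqrt.2 hd'1
  have hr2 : r ^ 2 = d' := Real.sq_sqrt (by linarith)
  set y := Real.sqrt ι with hy
  have hy0 : 0 ≤ y := Real.sqrt_nonneg _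
  have hy2 : y ^ 2 = ι := Real.sq_sqrt (by linarith)
  have hyh : 1 / 2 ≤ y := by
    refine Real.le_sqrt_of_sq_le ?_
    norm_num; linarith
  have h1 : Real.sqrt d ≤ d := Real.sqrt_le_left (by linarith) |>.2 (by nlinarith)
  have h2 : Real.sqrt (2 * x + 1) ≤ 10 * (d + r) * y := by
    refine Real.sqrt_le_left (by positivity) |>.2 ?_
    rw [show (10 * ((d : ℝ) + r) * y) ^ 2 = 100 * (d + r) ^ 2 * ι by rw [← hy2]; ring]
    have e1 : 2 * x + 1 ≤ (2 * (5 * d + 6 * d' + 26 * d ^ 2 + 1) + 2) * ι := by nlinarith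
    refine e1.trans (mul_le_mul_of_nonneg_right ?_ (by linarith))
    rw [← hr2]
    nlinarith
  have hs : 2 ≤ (d : ℝ) + r := by linarith
  have h3 : Real.sqrt d ≤ 2 * (d + r) * y := by nlinarith
  have h4 : 2 ≤ H * (2 * (d + r) * y) := by
    have : 2 ≤ 2 * (d + r) * y := by nlinarith
    nlinarith
  have h5 : 0 ≤ H * ((d + r) * y) := by positivity
  calc H * Real.sqrt d + (H * Real.sqrt (2 * x + 1) + 2)
      ≤ H * (2 * (d + r) * y) + (H * (10 * (d + r) * y) + H * (2 * (d + r) * y)) := by gcongr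
    _ ≤ 64 * H * (d + r) * y := by nlinarith

/-- `L ≤ K` eliminates `L`; the left side is then at most `2¹⁸ q⁴ B`, and `2 ≤ B`, `q ≤ B` give the
exponent. -/
lemma grid_resolution_le {d d' H K : ℕ} (hd : 1 ≤ d) (hd' : 1 ≤ d') (hH : 1 ≤ H) (hK : 1 ≤ K)
    {δ B L : ℝ} (hδ : 0 < δ) (hδ2 : δ < 1 / 2) (hB : B = d * d' * (K * H) / δ) (hL : 0 ≤ L)
    (hLK : L ≤ K) :
    4 * (K : ℝ) ^ 2 * (2 * L * (64 * H * (d + Real.sqrt d') * Real.sqrt (Real.log B))) ^ 2 * d ≤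
      B ^ 23 := by
  have hd1 : (1 : ℝ) ≤ d := by exact_mod_cast hd
  have hd'1 : (1 : ℝ) ≤ d' := by exact_mod_cast hd'
  have hH1 : (1 : ℝ) ≤ H := by exact_mod_cast hH
  have hK1 : (1 : ℝ) ≤ K := by exact_mod_cast hK
  set q : ℝ := d * d' * (K * H) with hq
  have hKH : (1 : ℝ) ≤ K * H := one_le_mul_of_one_le_of_one_le hK1 hH1
  have hdd : (1 : ℝ) ≤ d * d' := one_le_mul_of_one_le_of_one_le hd1 hd'1
  have hq1 : 1 ≤ q := one_le_mul_of_one_le_of_one_le hdd hKH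
  have hqB : q = B * δ := by rw [hB]; field_simp
  have hB2 : 2 ≤ B := by nlinarith
  have hqB' : q ≤ B := by nlinarith
  have hlog0 : 0 ≤ Real.log B := Real.log_nonneg (by linarith)
  have hlogB : Real.log B ≤ B := (Real.log_le_sub_one_of_pos (by linarith)).trans (by linarith)
  have hs : (d : ℝ) + Real.sqrt d' ≤ 2 * (d * d') := by
    have : Real.sqrt d' ≤ d' := Real.sqrt_le_left (by linarith) |>.2 (by nlinarith)
    nlinarith
  have h2 : (2 : ℝ) ^ 18 ≤ B ^ 18 := by gcongr
  calc 4 * (K : ℝ) ^ 2 * (2 * L * (64 * H * (d + Real.sqrt d') * Real.sqrt (Real.log B))) ^ 2 * d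
      = 4 * (K : ℝ) ^ 2 * (2 * L * (64 * H * (d + Real.sqrt d'))) ^ 2 * d *
          Real.sqrt (Real.log B) ^ 2 := by ring
    _ ≤ 4 * (K : ℝ) ^ 2 * (2 * K * (64 * H * (2 * (d * d')))) ^ 2 * d * B := by
        rw [Real.sq_sqrt hlog0]
        gcongr
    _ = 2 ^ 18 * ((K * (1 * 1) * d * 1) * (K * H * d * d') * (K * H * d * d') * (K * 1 * 1 * 1)) *
          B := by ring
    _ ≤ 2 ^ 18 * ((K * (H * 1) * d * d') * (K * H * d * d') * (K * H * d * d') *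
          (K * H * d * d')) * B := by gcongr
    _ = 2 ^ 18 * q ^ 4 * B := by rw [hq]; ring
    _ ≤ B ^ 18 * B ^ 4 * B := by gcongr
    _ = B ^ 23 := by ring

/-- This absorbs the `√e` of the lazy updates and replaces `log (1 + K)` by `log K`. It needs `x`
away from `1`; `x ≥ 3 > e` makes `log x ≥ 1`. -/
lemma exp_mul_log_one_add_le {x : ℝ} (hx : 3 ≤ x) :
    Real.exp 1 * Real.log (1 + x) ≤ 4 * Real.log x := by
  have hx0 : 0 < x := by linarith
  have h1 : Real.log (1 + x) ≤ Real.log x + 1 / 3 := by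
    have e : 1 + x = x * (1 + 1 / x) := by field_simp; ring
    rw [e, Real.log_mul hx0.ne' (by positivity)]
    have h := Real.log_le_sub_one_of_pos (show 0 < 1 + 1 / x by positivity)
    have : 1 / x ≤ 1 / 3 := one_div_le_one_div_of_le (by norm_num) hx
    linarith
  have h2 : 1 ≤ Real.log x := by
    rw [Real.le_log_iff_exp_le hx0]
    linarith [Real.exp_one_lt_d9]
  nlinarith [Real.exp_one_lt_d9, Real.exp_pos 1]

/-- `1028 = 4 + 1024`: the martingale term gives `2 · 2`, using `√ι ≤ 2ι`, and the bonuses give `8 ·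
64 · 2`. -/
lemma regret_bound_le {d d' H K : ℕ} (hd : 1 ≤ d) (hd' : 1 ≤ d') (hH : 1 ≤ H) (hK : 1 ≤ K)
    {δ T L β : ℝ} (hL : 1 ≤ L) (hδ : 0 < δ) (hδ2 : δ < 1 / 2) (hT : T = K * H)
    (hβ : β = 64 * H * (d + Real.sqrt d') * Real.sqrt (Real.log (d * d' * T / δ))) :
    2 * H * Real.sqrt (T * Real.log (d * T / δ)) +
        8 * H * L * β * Real.sqrt (2 * d * K * Real.log K) ≤
      1028 * (L * Real.sqrt ((d ^ 3 + d * d') * H ^ 3 * T)) * Real.log (d * d' * T / δ) := by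
  have hd1 : (1 : ℝ) ≤ d := by exact_mod_cast hd
  have hd'1 : (1 : ℝ) ≤ d' := by exact_mod_cast hd'
  have hH1 : (1 : ℝ) ≤ H := by exact_mod_cast hH
  have hK1 : (1 : ℝ) ≤ K := by exact_mod_cast hK
  have hT1 : 1 ≤ T := hT ▸ one_le_mul_of_one_le_of_one_le hK1 hH1
  have hdT : 1 ≤ d * T := one_le_mul_of_one_le_of_one_le hd1 hT1
  set ι := Real.log (d * d' * T / δ) with hι
  have hdTd' : d * T ≤ d * d' * T := by nlinarith
  have hB2 : 2 ≤ d * T / δ := by rw [le_div_iff₀ hδ]; linarith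
  have hℓι : Real.log (d * T / δ) ≤ ι := Real.log_le_log (by linarith) (by gcongr)
  have hℓ : Real.log 2 ≤ Real.log (d * T / δ) := Real.log_le_log (by norm_num) hB2
  have hι2 : 1 / 2 ≤ ι := by linarith [Real.log_two_gt_d9]
  have hKι : Real.log K ≤ ι := by
    refine Real.log_le_log (by linarith) ?_
    rw [le_div_iff₀ hδ]
    have : (K : ℝ) ≤ d * d' * T := by
      rw [hT]
      calc (K : ℝ) = 1 * 1 * (K * 1) := by ring
        _ ≤ d * d' * (K * H) := by gcongr
    nlinarith
  have hK0 : 0 ≤ Real.log K := Real.log_nonneg hK1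
  set G := Real.sqrt ((d ^ 3 + d * d') * H ^ 3 * T) with hG
  have hℓ0 : 0 ≤ Real.log (d * T / δ) := by linarith [Real.log_two_gt_d9]
  set y := Real.sqrt ι with hy
  have hy2 : y * y = ι := Real.mul_self_sqrt (by linarith)
  have hyh : 1 / 2 ≤ y := by
    refine Real.le_sqrt_of_sq_le ?_
    norm_num; linarith
  have hG0 : 0 ≤ G := Real.sqrt_nonneg _
  have h1 : H * Real.sqrt (T * Real.log (d * T / δ)) ≤ G * y := by
    rw [hG, hy, ← Real.sqrt_mul (by positivity)]
    refine Real.le_sqrt_of_sq_le ?_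
    rw [mul_pow, Real.sq_sqrt (by positivity)]
    have e1 : (H : ℝ) ^ 2 ≤ (d ^ 3 + d * d') * H ^ 3 := by
      have e2 : (1 : ℝ) ≤ d ^ 3 + d * d' := by nlinarith [one_le_pow₀ hd1 (n := 3)]
      calc (H : ℝ) ^ 2 = 1 * (H : ℝ) ^ 2 := by ring
        _ ≤ ((d : ℝ) ^ 3 + d * d') * (H : ℝ) ^ 3 := by gcongr; norm_num
    calc (H : ℝ) ^ 2 * (T * Real.log (d * T / δ)) ≤ ((d ^ 3 + d * d') * H ^ 3) * (T * ι) := by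
          gcongr
      _ = _ := by ring
  have h2 : H * (H * (d + Real.sqrt d')) * Real.sqrt (2 * d * K * Real.log K) ≤ 2 * (G * y) := by
    have hr2 : Real.sqrt d' ^ 2 = d' := Real.sq_sqrt (by linarith)
    have hG2 : G ^ 2 = (d ^ 3 + d * d') * H ^ 3 * T := Real.sq_sqrt (by positivity)
    refine abs_le_of_sq_le_sq' ?_ (by positivity) |>.2
    rw [mul_pow, Real.sq_sqrt (by positivity)]
    have e1 : ((d : ℝ) + Real.sqrt d') ^ 2 * d ≤ 2 * (d ^ 3 + d * d') := by
      have : ((d : ℝ) + Real.sqrt d') ^ 2 ≤ 2 * (d ^ 2 + d') := by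
        nlinarith [sq_nonneg ((d : ℝ) - Real.sqrt d')]
      nlinarith
    calc (H * (H * ((d : ℝ) + Real.sqrt d'))) ^ 2 * (2 * d * K * Real.log K)
        = 2 * (((d : ℝ) + Real.sqrt d') ^ 2 * d) * (H ^ 4 * K) * Real.log K := by ring
      _ ≤ 2 * (2 * (d ^ 3 + d * d')) * (H ^ 4 * K) * ι := by gcongr
      _ = 4 * ((d ^ 3 + d * d') * H ^ 3 * T) * ι := by rw [hT]; ring
      _ = (2 * (G * y)) ^ 2 := by rw [← hG2, ← hy2]; ring
  have h3 : G * y ≤ 2 * (L * G * ι) := by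
    rw [← hy2]
    have : G * y ≤ L * (G * y) := le_mul_of_one_le_left (by positivity) hL
    nlinarith [mul_nonneg (mul_nonneg (by linarith : 0 ≤ L) hG0) (by linarith : 0 ≤ y)]
  have h4 : 8 * H * L * β * Real.sqrt (2 * d * K * Real.log K) ≤ 1024 * (L * G * ι) := by
    calc 8 * H * L * β * Real.sqrt (2 * d * K * Real.log K)
        = 512 * (L * y) * (H * (H * (d + Real.sqrt d')) * Real.sqrt (2 * d * K * Real.log K)) := by
          rw [hβ]; ring
      _ ≤ 512 * (L * y) * (2 * (G * y)) := by gcongr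
      _ = 1024 * (L * G * (y * y)) := by ring
      _ = 1024 * (L * G * ι) := by rw [hy2]
  linarith

end Arithmetic

end UCBlvd
namespace UCBlvd

/-! ### The two high-probability events combined -/

section HighProbability

variable {S A W Ω : Type*} [MeasurableSpace S] [MeasurableSpace A] [DiscreteMeasurableSpace A]
  [Finite A] [MeasurableSpace W] [MeasurableSpace Ω] {Pr : Measure Ω}
  [IsProbabilityMeasure Pr] {d d' n K : ℕ} {X : Problem S A W d d' n} {δ T β : ℝ}

/-- The martingale part of the regret. -/
lemma Run.exists_event_sum_valueGap_le (hX : X.IsLinear) (hd : 1 ≤ d) (hH : 1 ≤ X.H) (hK : 1 ≤ K)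
    (hδ : 0 < δ) (hδ2 : δ < 1 / 2) (hT : T = K * X.H) (R : Run X Pr K 1 β) :
    ∃ E : Set Ω, MeasurableSet E ∧ Pr Eᶜ ≤ ENNReal.ofReal δ ∧
      ∀ ω ∈ E, ∑ k ∈ Finset.Icc 1 K, ∑ h ∈ Finset.Icc 1 X.H,
        (∫ s, R.valueGap k (h + 1) ω s ∂(X.P h ((R.trace ω).state k h, (R.trace ω).action k h)) -
          R.valueGap k (h + 1) ω ((R.trace ω).state k (h + 1))) ≤
        2 * X.H * Real.sqrt (T * Real.log (d * T / δ)) := by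
  have hd1 : (1 : ℝ) ≤ d := by exact_mod_cast hd
  have hH1 : (1 : ℝ) ≤ X.H := by exact_mod_cast hH
  have hK1 : (1 : ℝ) ≤ K := by exact_mod_cast hK
  have hT1 : 1 ≤ T := hT ▸ one_le_mul_of_one_le_of_one_le hK1 hH1
  have hdT : 1 ≤ d * T := one_le_mul_of_one_le_of_one_le hd1 hT1
  have hB : 1 < d * T / δ := by rw [lt_div_iff₀ hδ]; linarith
  set ℓ := Real.log (d * T / δ) with hℓ
  have hℓ0 : 0 < ℓ := Real.log_pos hB
  -- For increments in `[-H, H]` this `u` makes the variance term `ℓ / 2`, so the sum is at most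
  -- `(3/2) H √(Tℓ)`. The failure probability is `exp (-ℓ) = δ / (dT)`.
  set u := Real.sqrt (ℓ / T) / X.H with hu
  have hs0 : 0 < Real.sqrt (ℓ / T) := Real.sqrt_pos.2 (by positivity)
  have hu0 : 0 < u := by positivity
  obtain ⟨E, hEm, hEP, hE⟩ := R.exists_event_sum_le (f := fun k h => R.valueGap k (h + 1))
    (fun k hk h hh => R.measurable_valueGap hX hk (by omega)
      (by have := Finset.mem_Icc.1 hh; omega))
    (fun k _ h hh ω s => R.valueGap_mem_Icc k (by omega)
      (by have := Finset.mem_Icc.1 hh; omega) ω s) u ℓ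
  refine ⟨E, hEm, hEP.trans (ENNReal.ofReal_le_ofReal ?_), fun ω hω => ?_⟩
  · rw [hℓ, Real.exp_neg, Real.exp_log (by linarith), inv_div]
    exact div_le_self hδ.le hdT
  · refine le_of_mul_le_mul_left ((hE ω hω).trans ?_) hu0
    have hsqrt : Real.sqrt (T * ℓ) = T * Real.sqrt (ℓ / T) := by
      rw [show T * ℓ = T ^ 2 * (ℓ / T) by field_simp, Real.sqrt_mul (sq_nonneg T),
        Real.sqrt_sq (by linarith)]
    have hsq : Real.sqrt (ℓ / T) ^ 2 = ℓ / T := Real.sq_sqrt (by positivity)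
    have e1 : u * (2 * X.H * Real.sqrt (T * ℓ)) = 2 * ℓ := by
      rw [hsqrt, hu, show Real.sqrt (ℓ / T) / X.H * (2 * X.H * (T * Real.sqrt (ℓ / T))) =
        2 * T * Real.sqrt (ℓ / T) ^ 2 by field_simp, hsq]
      field_simp
    have e2 : K * X.H * (u ^ 2 * (((X.H : ℝ) - -X.H) ^ 2 / 8)) = ℓ / 2 := by
      rw [← hT, hu, div_pow, hsq]
      field_simp
      ring
    rw [e1, e2]
    linarith

variable [Nonempty A]

lemma Run.exists_event_regret_le (hX : X.Assumptions) (hd : 1 ≤ d) (hn : 1 ≤ n) (hH : 1 ≤ X.H)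
    (hK : 1 ≤ K) (hL : 1 ≤ X.L) (hδ : 0 < δ) (hδ2 : δ < 1 / 2) (hT : T = K * X.H)
    (hβ : β = 64 * X.H * (d + Real.sqrt d') * Real.sqrt (Real.log (d * d' * T / δ)))
    (R : Run X Pr K 1 β) :
    ∃ E : Set Ω, MeasurableSet E ∧ ENNReal.ofReal (1 - 2 * δ) ≤ Pr E ∧
      ∀ ω ∈ E, R.regret ω ≤
        2 * X.H * Real.sqrt (T * Real.log (d * T / δ)) +
          8 * X.H * X.L * β * Real.sqrt (2 * d * K * Real.log K) := by
  have hd' : 1 ≤ d' := hn.trans hX.span.1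
  have hd1 : (1 : ℝ) ≤ d := by exact_mod_cast hd
  have hd'1 : (1 : ℝ) ≤ d' := by exact_mod_cast hd'
  have hH1 : (1 : ℝ) ≤ X.H := by exact_mod_cast hH
  have hK1 : (1 : ℝ) ≤ K := by exact_mod_cast hK
  have hT1 : 1 ≤ T := hT ▸ one_le_mul_of_one_le_of_one_le hK1 hH1
  have hdT : 1 ≤ d * T := one_le_mul_of_one_le_of_one_le hd1 hT1
  have hdd'T : d * T ≤ d * d' * T := by nlinarith
  have hB2 : 2 ≤ d * T / δ := by rw [le_div_iff₀ hδ]; linarith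
  have hℓ : 1 / 2 ≤ Real.log (d * T / δ) := by
    have := Real.log_le_log (by norm_num) hB2
    linarith [Real.log_two_gt_d9]
  have hι : 1 / 2 ≤ Real.log (d * d' * T / δ) :=
    hℓ.trans (Real.log_le_log (by linarith) (by gcongr))
  have hβ1 : 1 ≤ β := by
    rw [hβ]
    have h1 : 1 / 2 ≤ Real.sqrt (Real.log (d * d' * T / δ)) :=
      Real.le_sqrt_of_sq_le (by norm_num; linarith)
    have h2 : 1 ≤ (d : ℝ) + Real.sqrt d' := by linarith [Real.sqrt_nonneg (d' : ℝ)]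
    calc (1 : ℝ) ≤ 64 * 1 * 1 * (1 / 2) := by norm_num
      _ ≤ _ := by gcongr
  have hlogK : 0 ≤ Real.log K := Real.log_nonneg hK1
  -- The bound is trivial when there are few episodes or when `L` is large.
  by_cases htriv : K ≤ 2 ∨ (K : ℝ) < X.L
  · refine ⟨Set.univ, MeasurableSet.univ, ?_, fun ω _ => (R.regret_le_mul ω).trans ?_⟩
    · rw [measure_univ]
      exact ENNReal.ofReal_le_one.2 (by linarith)
    have hbonus : 0 ≤ 8 * X.H * X.L * β * Real.sqrt (2 * d * K * Real.log K) := by positivity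
    have hmart : 0 ≤ 2 * X.H * Real.sqrt (T * Real.log (d * T / δ)) := by positivity
    by_cases hK2 : K ≤ 2
    · have hK2' : (K : ℝ) ≤ 2 := by exact_mod_cast hK2
      have h1 : (K : ℝ) / 2 ≤ Real.sqrt (T * Real.log (d * T / δ)) := by
        refine Real.le_sqrt_of_sq_le ?_
        have h2 : (K : ℝ) ≤ T := by rw [hT]; nlinarith
        nlinarith
      nlinarith
    · have hLK : (K : ℝ) < X.L := by tauto
      have hK3 : (3 : ℝ) ≤ K := by exact_mod_cast (by omega : 3 ≤ K)
      have h1 : 1 ≤ Real.sqrt (2 * d * K * Real.log K) := by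
        rw [Real.one_le_sqrt]
        have h2 : 1 ≤ Real.log K := by
          rw [Real.le_log_iff_exp_le (by linarith)]
          linarith [Real.exp_one_lt_d9]
        calc (1 : ℝ) ≤ 2 * 1 * 1 * 1 := by norm_num
          _ ≤ _ := by gcongr
      calc (K : ℝ) * X.H = 1 * X.H * K * 1 * 1 := by ring
        _ ≤ 8 * X.H * X.L * β * Real.sqrt (2 * d * K * Real.log K) := by gcongr; norm_num
        _ ≤ _ := by linarith
  push Not at htriv
  -- From here on `L ≤ K`, so the resolution of the net is polynomial in `B` and `β` need not depend
  -- on `L`.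
  obtain ⟨hK3, hLK⟩ := htriv
  have hK3' : (3 : ℝ) ≤ K := by exact_mod_cast hK3
  set B := d * d' * T / δ with hBdef
  have hB : B = d * d' * (K * X.H) / δ := by rw [hBdef, hT]
  set x := 4 * (K : ℝ) ^ 2 * (2 * X.L * β) ^ 2 * d with hx
  have hx0 : 0 < x := by positivity
  have hxB : x ≤ B ^ 23 := by
    rw [hx, hβ]
    exact grid_resolution_le hd hd' hH hK hδ hδ2 hB (by linarith) hLK
  have hm : ((⌈x⌉₊ : ℕ) : ℝ) ≤ B ^ 23 + 1 := by
    linarith [(Nat.ceil_lt_add_one hx0.le).le]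
  obtain ⟨hN0, hN⟩ := log_netSize_div_le hd hn hX.span.1 hH hK hδ hδ2 hB hm
  obtain ⟨E₁, hE₁m, hE₁P, hE₁⟩ := R.exists_event_isAccurate hX hd hd' hn hH hK
    (Nat.ceil_pos.2 hx0) (Nat.le_ceil x) hδ hN0 (by
      rw [hβ]
      exact confidence_width_le hd hd' hH hι hN)
  obtain ⟨E₂, hE₂m, hE₂P, hE₂⟩ := R.exists_event_sum_valueGap_le hX.linear hd hH hK hδ hδ2 hT
  refine ⟨E₁ ∩ E₂, hE₁m.inter hE₂m, ?_, fun ω hω => ?_⟩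
  · have hcompl : Pr (E₁ ∩ E₂)ᶜ ≤ ENNReal.ofReal (2 * δ) := by
      rw [Set.compl_inter, two_mul, ENNReal.ofReal_add hδ.le hδ.le]
      exact (measure_union_le _ _).trans (add_le_add hE₁P hE₂P)
    rw [ENNReal.ofReal_sub _ (by linarith), ENNReal.ofReal_one, tsub_le_iff_right]
    calc (1 : ENNReal) = Pr (E₁ ∩ E₂) + Pr (E₁ ∩ E₂)ᶜ := by
          rw [measure_add_measure_compl (hE₁m.inter hE₂m), measure_univ]
      _ ≤ _ := add_le_add le_rfl hcompl
  · refine (R.regret_le hX.linear hd (mul_nonneg (by linarith) (by linarith))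
      (hE₁ ω hω.1)).trans (add_le_add (hE₂ ω hω.2) ?_)
    have hsqrt : Real.sqrt (Real.exp 1) * Real.sqrt (2 * d * K * Real.log (1 + K / d)) ≤
        2 * Real.sqrt (2 * d * K * Real.log K) := by
      rw [← Real.sqrt_mul (Real.exp_pos 1).le]
      refine Real.sqrt_le_left (by positivity) |>.2 ?_
      rw [mul_pow, Real.sq_sqrt (by positivity)]
      have h1 : Real.log (1 + K / d) ≤ Real.log (1 + K) :=
        Real.log_le_log (by positivity) (by gcongr; exact div_le_self (by linarith) hd1)
      calc Real.exp 1 * (2 * d * K * Real.log (1 + K / d))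
          ≤ Real.exp 1 * (2 * d * K * Real.log (1 + K)) := by gcongr
        _ = 2 * d * K * (Real.exp 1 * Real.log (1 + K)) := by ring
        _ ≤ 2 * d * K * (4 * Real.log K) :=
          mul_le_mul_of_nonneg_left (exp_mul_log_one_add_le hK3') (by positivity)
        _ = _ := by ring
    calc 4 * (X.L * β) * (Real.sqrt (Real.exp 1) *
          (X.H * Real.sqrt (2 * d * K * Real.log (1 + K / d))))
        = 4 * (X.L * β) * X.H * (Real.sqrt (Real.exp 1) *
            Real.sqrt (2 * d * K * Real.log (1 + K / d))) := by ring
      _ ≤ 4 * (X.L * β) * X.H * (2 * Real.sqrt (2 * d * K * Real.log K)) := by gcongr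
      _ = _ := by ring

end HighProbability

end UCBlvd

/-! ### The theorem -/

theorem mainTheorem4 :
    -- number of planning calls, for every regularisation and every sample path
    (∀ (S : Type u₁) (A : Type u₂) (W : Type u₃) (Ω : Type u₄)
      [MeasurableSpace S] [MeasurableSpace A] [DiscreteMeasurableSpace A] [Finite A] [Nonempty A]
      [MeasurableSpace W] [MeasurableSpace Ω] (Pr : Measure Ω) [IsProbabilityMeasure Pr]
      (d d' n K : ℕ) (X : UCBlvd.Problem S A W d d' n), X.Assumptions →
      ∀ (lam β : ℝ), 0 < lam → ∀ (R : UCBlvd.Run X Pr K lam β) (ω : Ω),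
        (UCBlvd.planningCalls X lam (R.trace ω) K : ℝ) ≤
          d * X.H * Real.log (1 + K / (d * lam))) ∧
    -- regret, with absolute constants `c` and `C`
    ∃ c C : ℝ, 0 < c ∧ 0 < C ∧
      ∀ (S : Type u₁) (A : Type u₂) (W : Type u₃) (Ω : Type u₄)
        [MeasurableSpace S] [MeasurableSpace A] [DiscreteMeasurableSpace A] [Finite A] [Nonempty A]
        [MeasurableSpace W] [MeasurableSpace Ω] (Pr : Measure Ω) [IsProbabilityMeasure Pr]
        (d d' n K : ℕ) (X : UCBlvd.Problem S A W d d' n), X.Assumptions →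
        ∀ (δ T β : ℝ), 0 < δ → δ < 1 / 2 → T = K * X.H →
          β = c * X.H * (d + Real.sqrt d') * Real.sqrt (Real.log (d * d' * T / δ)) →
          ∀ R : UCBlvd.Run X Pr K 1 β,
            (∃ E : Set Ω, MeasurableSet E ∧ ENNReal.ofReal (1 - 2 * δ) ≤ Pr E ∧
              ∀ ω ∈ E, R.regret ω ≤
                2 * X.H * Real.sqrt (T * Real.log (d * T / δ)) +
                  8 * X.H * X.L * β * Real.sqrt (2 * d * K * Real.log K)) ∧
            2 * X.H * Real.sqrt (T * Real.log (d * T / δ)) +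
                8 * X.H * X.L * β * Real.sqrt (2 * d * K * Real.log K) ≤
              C * (X.L * Real.sqrt ((d ^ 3 + d * d') * X.H ^ 3 * T)) *
                Real.log (d * d' * T / δ) := by
  refine ⟨?_, 64, 1028, by norm_num, by norm_num, ?_⟩
  · intro S A W Ω _ _ _ _ _ _ _ Pr _ d d' n K X hX lam β hlam R ω
    exact UCBlvd.planningCalls_le hlam hX.linear.φ_norm K
  · intro S A W Ω _ _ _ _ _ _ _ Pr _ d d' n K X hX δ T β hδ hδ2 hT hβ R
    -- Here all bounds are zero and the regret is at most `K H = 0`. Nondegeneracy of the features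
    -- is available only for `H ≥ 1`.
    by_cases h0 : K = 0 ∨ X.H = 0
    · have hT0 : T = 0 := by
        rw [hT]
        rcases h0 with h | h <;> simp [h]
      have hbound : 2 * X.H * Real.sqrt (T * Real.log (d * T / δ)) +
          8 * X.H * X.L * β * Real.sqrt (2 * d * K * Real.log K) = 0 := by
        rw [hT0]
        rcases h0 with h | h <;> simp [h]
      rw [hbound]
      refine ⟨⟨Set.univ, MeasurableSet.univ, ?_, fun ω _ => ?_⟩, ?_⟩
      · rw [measure_univ]
        exact ENNReal.ofReal_le_one.2 (by linarith)
      · refine (R.regret_le_mul ω).trans (le_of_eq ?_)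
        rw [← hT, hT0]
      · simp [hT0]
    · push Not at h0
      have hK : 1 ≤ K := Nat.one_le_iff_ne_zero.2 h0.1
      have hH : 1 ≤ X.H := Nat.one_le_iff_ne_zero.2 h0.2
      obtain ⟨ω⟩ : Nonempty Ω := Pr.nonempty_of_neZero
      have : Nonempty S := ⟨(R.trace ω).state 1 1⟩
      have : Nonempty W := ⟨R.context 1 ω⟩
      obtain ⟨hd, hd', hn, hL⟩ := hX.one_le hH
      exact ⟨R.exists_event_regret_le hX hd hn hH hK hL hδ hδ2 hT hβ,
        UCBlvd.regret_bound_le hd hd' hH hK hL hδ hδ2 hT hβ⟩
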